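/- Let $n\ge 0$ be an integer. Let $(M_0,\xi_0)$ and $(M_1,\xi_1)$ be two smooth $(2n+1)$-dimensional contact manifolds without boundary; that is, $\xi_j\subset TM_j$ is a field of hyperplanes which near every point of $M_j$ is the kernel of a smooth nowhere vanishing $1$-form $\alpha$ such that $d\alpha$ is nondegenerate on $\ker\alpha$ ($\xi_j$ is not required to be coorientable). Let $\Sigma$ be a smooth $2n$-dimensional manifold without boundary, not necessarily compact, and let $$\iota_0\colon \Sigma\hookrightarrow M_0,\qquad \iota_1\colon\Sigma\hookrightarrow M_1$$ be two smooth embeddings (immersions that are homeomorphisms onto their images, which need not be closed subsets) such that the induced singular distributions agree, i.e. for every $p\in\Sigma$ $$\{v\in T_p\Sigma \mid D_p\iota_0(v)\in \xi_0(\iota_0(p))\}=\{v\in T_p\Sigma \mid D_p\iota_1(v)\in \xi_1(\iota_1(p))\}.$$ Then there exist an open neighborhood $U_0\subset M_0$ of $\iota_0(\Sigma)$, an open neighborhood $U_1\subset M_1$ of $\iota_1(\Sigma)$, and a contactomorphism $\Phi\colon (U_0,\xi_0)\to(U_1,\xi_1)$, i.e. a smooth diffeomorphism $\Phi\colon U_0\to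 U_1$ with $D_x\Phi(\xi_0(x))=\xi_1(\Phi(x))$ for all $x\in U_0$, such that $\Phi\circ\iota_0=\iota_1$. -/

import Mathlib

open Set Topology TopologicalSpace Bundle
open scoped Manifold ContDiff

namespace ContactGeometry

variable {m n k : ℕ}

/-- A field of tangent subspaces on an `m`-manifold: a linear subspace `D x ⊆ T_x M` for every
point `x`. The rank may vary with the point and no regularity is imposed (a "singular
distribution"). -/
abbrev TangentDistribution (m : ℕ) (M : Type*) [TopologicalSpace M]
    [ChartedSpace (EuclideanSpace ℝ (Fin m)) M] :=
  ∀ x : M, Submodule ℝ (TangentSpace (𝓡 m) x)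

/-- A (not necessarily continuous) `1`-form on an `m`-manifold. -/
abbrev OneForm (m : ℕ) (M : Type*) [TopologicalSpace M]
    [ChartedSpace (EuclideanSpace ℝ (Fin m)) M] :=
  ∀ x : M, TangentSpace (𝓡 m) x →L[ℝ] ℝ

section

variable {M : Type*} [TopologicalSpace M] [ChartedSpace (EuclideanSpace ℝ (Fin m)) M]
  {N : Type*} [TopologicalSpace N] [ChartedSpace (EuclideanSpace ℝ (Fin k)) N]

/-- The distribution `(Df)⁻¹(ξ)` on `M` induced by a distribution `ξ` on `N` through a map
`f : M → N`: at `x` it is `{v ∈ T_x M | Df_x v ∈ ξ (f x)}`. -/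
noncomputable def TangentDistribution.pullback (f : M → N) (ξ : TangentDistribution k N) :
    TangentDistribution m M :=
  fun x => (ξ (f x)).comap (mfderiv (𝓡 m) (𝓡 k) f x).toLinearMap

/-- The restriction of a distribution to an open subset, itself regarded as a manifold. -/
noncomputable def TangentDistribution.restrict (ξ : TangentDistribution m M) (U : Opens M) :
    TangentDistribution m U :=
  TangentDistribution.pullback (fun x : U => (x : M)) ξ

/-- The `1`-form `α` is smooth on `U`, as a section of the cotangent bundle. -/
def OneForm.SmoothOn [IsManifold (𝓡 m) ∞ M] (α : OneForm m M) (U : Set M) : Prop :=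
  ContMDiffOn (𝓡 m) ((𝓡 m).prod 𝓘(ℝ, EuclideanSpace ℝ (Fin m) →L[ℝ] ℝ)) ∞
    (fun x => (⟨x, α x⟩ : TotalSpace (EuclideanSpace ℝ (Fin m) →L[ℝ] ℝ)
      (fun x : M => TangentSpace (𝓡 m) x →L[ℝ] Bundle.Trivial M ℝ x))) U

/-- The `1`-form `α` read in the preferred chart `φ` at `p`, that is, the pullback of `α` under
`φ⁻¹`; it is meaningful on the target of `φ`. -/
noncomputable def OneForm.inChart (α : OneForm m M) (p : M) :
    EuclideanSpace ℝ (Fin m) →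
      EuclideanSpace ℝ (Fin m) [⋀^Fin 1]→L[ℝ] ℝ :=
  fun y => ContinuousAlternatingMap.ofSubsingleton ℝ (EuclideanSpace ℝ (Fin m)) ℝ (0 : Fin 1)
    ((α ((extChartAt (𝓡 m) p).symm y)).comp
      (mfderiv 𝓘(ℝ, EuclideanSpace ℝ (Fin m)) (𝓡 m) (extChartAt (𝓡 m) p).symm y))

/-- The exterior derivative of a `1`-form: `dα_x (u, v)` is computed in the preferred chart at
`x`. It is meaningful where `α` is smooth. -/
noncomputable def OneForm.d (α : OneForm m M) (x : M) (u v : TangentSpace (𝓡 m) x) : ℝ :=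
  extDeriv (α.inChart x) (extChartAt (𝓡 m) x x)
    ![mfderiv (𝓡 m) 𝓘(ℝ, EuclideanSpace ℝ (Fin m)) (extChartAt (𝓡 m) x) x u,
      mfderiv (𝓡 m) 𝓘(ℝ, EuclideanSpace ℝ (Fin m)) (extChartAt (𝓡 m) x) x v]

/-- `α` is a contact form on the open set `U`: it is smooth and, at every point `x` of `U`, it
does not vanish and `dα_x` is nondegenerate (that is, symplectic) on the hyperplane `ker α_x`. -/
structure OneForm.IsContactOn [IsManifold (𝓡 m) ∞ M] (α : OneForm m M) (U : Set M) : Prop where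
  smoothOn : α.SmoothOn U
  ne_zero : ∀ x ∈ U, α x ≠ 0
  nondegenerate : ∀ x ∈ U, ∀ u : TangentSpace (𝓡 m) x, α x u = 0 →
    (∀ v : TangentSpace (𝓡 m) x, α x v = 0 → α.d x u v = 0) → u = 0

/-- `ξ` is a contact structure on `M`: near every point it is the kernel of a contact form.
(No coorientation, i.e. no global contact form, is required.) -/
def IsContactStructure [IsManifold (𝓡 m) ∞ M] (ξ : TangentDistribution m M) : Prop :=
  ∀ p : M, ∃ U : Set M, IsOpen U ∧ p ∈ U ∧ ∃ α : OneForm m M, α.IsContactOn U ∧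
    ∀ x ∈ U, ξ x = LinearMap.ker (α x).toLinearMap

end

/-- The diffeomorphism `Φ : M → N` is a contactomorphism `(M, ξ) → (N, η)`:
`DΦ_x (ξ x) = η (Φ x)` for all `x`. -/
def IsContactomorphism {M : Type*} [TopologicalSpace M]
    [ChartedSpace (EuclideanSpace ℝ (Fin m)) M] {N : Type*} [TopologicalSpace N]
    [ChartedSpace (EuclideanSpace ℝ (Fin m)) N]
    (ξ : TangentDistribution m M) (η : TangentDistribution m N)
    (Φ : M ≃ₘ^∞⟮𝓡 m, 𝓡 m⟯ N) : Prop :=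
  ∀ x : M, (ξ x).map (mfderiv (𝓡 m) (𝓡 m) Φ x).toLinearMap = η (Φ x)

end ContactGeometry

/-! Locally choose contact forms `a`, `a'` and read both embeddings as maps `j`, `j'` of one
hypersurface. The induced forms `j^*a` and `j'^*a'` have the same kernels, and their exterior
derivatives are nondegenerate wherever they vanish. Hence they are proportional with a smooth
nowhere vanishing factor: `j'^*a' = f · j^*a` (`exists_smooth_factor`, via Hadamard's lemma). In
positive dimension the factor is unique, because such forms are nonzero on a dense set.

A function `H` determines a contact Hamiltonian field `X` by `a(X) = H` and `ι_X da + dH = ρ a`; its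
flow preserves `ker a`. Choose `H` so that `X` is transverse to the hypersurface, and `H'` on the
other side with `H' ∘ j' = f · (H ∘ j)`. Then `X'` is transverse as well
(`hamPair_mem_range_of_mem_range`), and sending the flow lines of `X` to those of `X'` extends `j y
↦ j' y` to a contactomorphism germ: along the hypersurface both forms and both Hamiltonians differ
by the same factor `f`, and the flows propagate this (`exists_isContactGerm`). No Moser isotopy is
needed.

The structures need not be coorientable, so contact forms and Hamiltonians exist only locally, and
the germs are built inductively over a countable cover by small compact sets. The step is a relative
extension (`exists_local_extension`). If a contact germ `Ψ` with `Ψ^*a' = g a` is given along a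
compact set, then `g ∘ j = f` by uniqueness of the factor, so `H'` can be chosen with `H' ∘ Ψ = g H`
there. Then `Ψ` maps `X` to `X'` (`fderiv_hamPair_eq`), and since a germ with this property is
determined by its values on the hypersurface (`Intertwines.germ_unique`), the new germ agrees with
`Ψ`.

Coherent germs along the hypersurface come from a single map by paracompactness
(`exists_eventuallyEq_of_coherent`), and a local diffeomorphism that embeds a subspace is injective
near it (`exists_injOn_of_isInducing`). This yields the diffeomorphism between open neighbourhoods.
-/

namespace ContactGeometry

open Filter

universe u

/-! ### Smoothness of composition operators on spaces of continuous functions -/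

section Nemytskii

variable {K : Type*} [TopologicalSpace K] [CompactSpace K]

/-- Pointwise application of a continuous bilinear map to a pair of continuous functions. -/
noncomputable def pointwiseBilin {H E G : Type*} [NormedAddCommGroup H] [NormedSpace ℝ H]
    [NormedAddCommGroup E] [NormedSpace ℝ E]
    [NormedAddCommGroup G] [NormedSpace ℝ G] (B : H →L[ℝ] E →L[ℝ] G) :
    C(K, H) →L[ℝ] C(K, E) →L[ℝ] C(K, G) :=
  LinearMap.mkContinuous₂
    (LinearMap.mk₂ ℝ (fun (L : C(K, H)) (h : C(K, E)) =>
        (⟨fun t => B (L t) (h t), by fun_prop⟩ : C(K, G)))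
      (fun _ _ _ => by ext; simp) (fun _ _ _ => by ext; simp)
      (fun _ _ _ => by ext; simp) (fun _ _ _ => by ext; simp)) ‖B‖
    (fun L h => by
      refine (ContinuousMap.norm_le _ (by positivity)).2 fun t => ?_
      exact B.le_of_opNorm₂_le_of_le le_rfl (L.norm_coe_le_norm t) (h.norm_coe_le_norm t))

theorem contDiff_pointwiseBilin {H E G : Type*} [NormedAddCommGroup H] [NormedSpace ℝ H]
    [NormedAddCommGroup E] [NormedSpace ℝ E]
    [NormedAddCommGroup G] [NormedSpace ℝ G] (B : H →L[ℝ] E →L[ℝ] G) {n : WithTop ℕ∞} :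
    ContDiff ℝ n (fun L : C(K, H) => pointwiseBilin B L) :=
  ContinuousLinearMap.contDiff (𝕜 := ℝ) (E := C(K, H)) (F := C(K, E) →L[ℝ] C(K, G))
    (pointwiseBilin B)

/-- The image of `γ` is compact, so `g'` is uniformly continuous around it, and the mean value
inequality bounds the first order remainder by `ε ‖h‖` uniformly in the parameter. -/
theorem hasFDerivAt_comp_continuousMap {E G : Type*} [NormedAddCommGroup E] [NormedSpace ℝ E]
    [NormedAddCommGroup G] [NormedSpace ℝ G] {g : E → G} {g' : C(E, E →L[ℝ] G)}
    (hg : ∀ x, HasFDerivAt g (g' x) x) (γ : C(K, E)) :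
    HasFDerivAt
      (fun γ : C(K, E) => (⟨g, continuous_iff_continuousAt.2 fun x => (hg x).continuousAt⟩ :
        C(E, G)).comp γ)
      (pointwiseBilin (.id ℝ (E →L[ℝ] G)) (g'.comp γ)) γ := by
  rw [hasFDerivAt_iff_isLittleO_nhds_zero, Asymptotics.isLittleO_iff]
  intro ε hε
  have hK : IsCompact (range γ) := isCompact_range γ.continuous
  have hu := hK.uniformContinuousAt_of_continuousAt g' (fun x _ => g'.continuous.continuousAt)
    (Metric.dist_mem_uniformity hε)
  obtain ⟨δ, hδ, H⟩ := Metric.mem_uniformity_dist.1 hu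
  have hb : ∀ᶠ h : C(K, E) in 𝓝 0, ‖h‖ < δ := by
    have := Metric.ball_mem_nhds (0 : C(K, E)) hδ
    filter_upwards [this] with h hh using by simpa using hh
  filter_upwards [hb] with h hh
  refine (ContinuousMap.norm_le _ (by positivity)).2 fun t => ?_
  have hmem : γ t + h t ∈ Metric.ball (γ t) δ := by
    simpa using (h.norm_coe_le_norm t).trans_lt hh
  have key := (convex_ball (γ t) δ).norm_image_sub_le_of_norm_hasFDerivWithin_le'
    (f := g) (f' := fun x => g' x) (φ := g' (γ t)) (C := ε)
    (fun x _ => (hg x).hasFDerivWithinAt)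
    (fun x hx => by
      have := H (a := γ t) (b := x) (by rwa [dist_comm]) (mem_range_self t)
      rw [← dist_eq_norm, dist_comm]
      exact le_of_lt this)
    (Metric.mem_ball_self hδ) hmem
  have h2 : ‖g (γ t + h t) - g (γ t) - g' (γ t) (h t)‖ ≤ ε * ‖h t‖ := by simpa using key
  change ‖g (γ t + h t) - g (γ t) - g' (γ t) (h t)‖ ≤ _
  exact h2.trans (mul_le_mul_of_nonneg_left (h.norm_coe_le_norm t) hε.le)

set_option synthInstance.maxHeartbeats 200000 in
/-- Composition with a `C^n` map is a `C^n` operation on spaces of continuous functions. -/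
theorem contDiff_nat_comp_continuousMap {K : Type*} [TopologicalSpace K] [CompactSpace K]
    {E : Type u} [NormedAddCommGroup E] [NormedSpace ℝ E]
    (n : ℕ) : ∀ {G : Type u} [NormedAddCommGroup G] [NormedSpace ℝ G]
      (g : C(E, G)), ContDiff ℝ n g → ContDiff ℝ n (fun γ : C(K, E) => g.comp γ) := by
  induction n with
  | zero =>
    intro G _ _ g _
    exact contDiff_zero.2 (ContinuousMap.continuous_postcomp g)
  | succ n ih =>
    intro G _ _ g hg
    -- The derivative of the operator is composition with `g'` followed by a bounded bilinear map,
    -- so the induction passes from target `G` to target `E →L[ℝ] G`. This is why `G` is quantified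
    -- inside it and shares the universe of `E`.
    obtain ⟨g', hg', hd⟩ := contDiff_succ_iff_hasFDerivAt.1 (by exact_mod_cast hg)
    let G' : C(E, E →L[ℝ] G) := ⟨g', hg'.continuous⟩
    have h1 := ih G' hg'
    push_cast
    refine contDiff_succ_iff_hasFDerivAt.2
      ⟨fun γ => pointwiseBilin (.id ℝ (E →L[ℝ] G)) (G'.comp γ), (contDiff_pointwiseBilin (.id ℝ (E →L[ℝ] G))).comp h1,
        fun γ => hasFDerivAt_comp_continuousMap (g' := G') hd γ⟩

/-- Composition with a smooth map is a smooth operation on spaces of continuous functions. -/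
theorem contDiff_comp_continuousMap {K : Type*} [TopologicalSpace K] [CompactSpace K]
    {E G : Type u} [NormedAddCommGroup E] [NormedSpace ℝ E] [NormedAddCommGroup G]
    [NormedSpace ℝ G] (g : C(E, G)) (hg : ContDiff ℝ ∞ g) :
    ContDiff ℝ ∞ (fun γ : C(K, E) => g.comp γ) :=
  contDiff_infty.2 fun n => contDiff_nat_comp_continuousMap n g (contDiff_infty.1 hg n)

end Nemytskii

/-- A map which is smooth near a point coincides near that point with a globally smooth map. -/
theorem exists_contDiff_eventuallyEq {E G : Type*} [NormedAddCommGroup E] [NormedSpace ℝ E]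
    [HasContDiffBump E] [NormedAddCommGroup G] [NormedSpace ℝ G] {f : E → G} {x₀ : E}
    (hf : ∀ᶠ x in 𝓝 x₀, ContDiffAt ℝ ∞ f x) : ∃ g : E → G, ContDiff ℝ ∞ g ∧ g =ᶠ[𝓝 x₀] f := by
  obtain ⟨r, hr, H⟩ := Metric.eventually_nhds_iff_ball.1 hf
  let φ : ContDiffBump x₀ := ⟨r / 3, r / 2, by positivity, by linarith⟩
  refine ⟨fun x => φ x • f x, contDiff_iff_contDiffAt.2 fun x => ?_, ?_⟩
  · by_cases hx : x ∈ Metric.ball x₀ r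
    · exact φ.contDiff.contDiffAt.smul (H x hx)
    · have hx' : x ∉ tsupport φ := by
        rw [φ.tsupport_eq]
        intro h
        exact hx (Metric.closedBall_subset_ball (show r / 2 < r by linarith) h)
      have h0 : (fun x => φ x • f x) =ᶠ[𝓝 x] fun _ => 0 := by
        filter_upwards [notMem_tsupport_iff_eventuallyEq.1 hx'] with y hy
        simp [hy]
      exact contDiffAt_const.congr_of_eventuallyEq h0
  · filter_upwards [φ.eventuallyEq_one] with y hy
    simp [hy]

/-! ### Implicit functions -/

section ImplicitFunction

variable {E₁ E₂ F : Type*} [NormedAddCommGroup E₁] [NormedSpace ℝ E₁] [CompleteSpace E₁]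
  [NormedAddCommGroup E₂] [NormedSpace ℝ E₂] [CompleteSpace E₂]
  [NormedAddCommGroup F] [NormedSpace ℝ F] [CompleteSpace F]

/-- Implicit function theorem, with smoothness on a neighbourhood. -/
theorem exists_smooth_implicitFunction {f : E₁ × E₂ → F} {u : E₁ × E₂} (hf : ContDiff ℝ ∞ f)
    (hu : (fderiv ℝ f u ∘L .inr ℝ E₁ E₂).IsInvertible) :
    ∃ ψ : E₁ → E₂, (∀ᶠ x in 𝓝 u.1, ContDiffAt ℝ ∞ ψ x) ∧ ψ u.1 = u.2 ∧
      ∀ᶠ v in 𝓝 u, f v = f u ↔ ψ v.1 = v.2 := by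
  have h0 : (∞ : WithTop ℕ∞) ≠ 0 := by simp
  have cdf := hf.contDiffAt (x := u)
  set ψ := cdf.implicitFunction h0 hu with hψ
  have hψu : ψ u.1 = u.2 := cdf.implicitFunction_apply_self h0 hu
  have hc : ContDiffAt ℝ ∞ ψ u.1 := cdf.contDiffAt_implicitFunction h0 hu
  have hiff := cdf.eventually_apply_eq_iff_implicitFunction h0 hu
  refine ⟨ψ, ?_, hψu, hiff⟩
  -- Smoothness of order `∞` at the single point `u.1` only gives `C^n` neighbourhoods that may
  -- shrink with `n`. Instead the theorem is applied afresh at every nearby point `(x, ψ x)`, where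
  -- its local solution coincides with `ψ` by uniqueness.
  have hinv : ∀ᶠ v in 𝓝 u, (fderiv ℝ f v ∘L .inr ℝ E₁ E₂).IsInvertible := by
    have hcont : Continuous fun v => fderiv ℝ f v ∘L .inr ℝ E₁ E₂ :=
      (hf.continuous_fderiv h0).clm_comp continuous_const
    obtain ⟨e, he⟩ := hu
    have := ContinuousLinearEquiv.nhds e
    rw [he] at this
    filter_upwards [hcont.continuousAt this] with v hv
    exact hv
  have hcont1 : ∀ᶠ x in 𝓝 u.1, ContinuousAt ψ x := by
    filter_upwards [(hc.of_le (m := 1) (by simp)).eventually (by simp)] with x hx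
    exact hx.continuousAt
  have htend : Tendsto (fun x => (x, ψ x)) (𝓝 u.1) (𝓝 u) := by
    have : Tendsto (fun x => (x, ψ x)) (𝓝 u.1) (𝓝 (u.1, ψ u.1)) :=
      continuousAt_id.prodMk hc.continuousAt
    rwa [hψu] at this
  filter_upwards [htend.eventually hinv, htend.eventually hiff.eventually_nhds, hcont1]
    with x hx hx2 hxc
  have cdx := hf.contDiffAt (x := (x, ψ x))
  have h1 := cdx.contDiffAt_implicitFunction h0 hx
  have hfx : f (x, ψ x) = f u := (hx2.self_of_nhds).2 rfl
  have h2 := cdx.eventually_apply_implicitFunction h0 hx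
  have h3 : Tendsto (fun y => (y, cdx.implicitFunction h0 hx y)) (𝓝 x) (𝓝 (x, ψ x)) := by
    have h4 := (continuousAt_id (x := x)).prodMk h1.continuousAt
    have h5 : cdx.implicitFunction h0 hx x = ψ x := cdx.implicitFunction_apply_self h0 hx
    unfold ContinuousAt at h4
    simpa only [h5, id] using h4
  refine h1.congr_of_eventuallyEq ?_
  filter_upwards [h3.eventually hx2, h2] with y hy hy2
  exact hy.1 (hy2.trans hfx)

end ImplicitFunction

/-! ### Smooth local flows -/

section Flow

variable {E : Type*} [NormedAddCommGroup E] [NormedSpace ℝ E] [CompleteSpace E]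

/-- The primitive vanishing at `0` of a continuous curve on `[-1, 1]`. -/
noncomputable def primitiveCLM (E : Type*) [NormedAddCommGroup E] [NormedSpace ℝ E]
    [CompleteSpace E] : C(Icc (-1 : ℝ) 1, E) →L[ℝ] C(Icc (-1 : ℝ) 1, E) :=
  LinearMap.mkContinuous
    { toFun := fun γ => ⟨fun t => ∫ u in (0 : ℝ)..t, IccExtend (by norm_num) γ u, by
        have h : Continuous (IccExtend (by norm_num : (-1 : ℝ) ≤ 1) γ) := γ.continuous.Icc_extend'
        exact (intervalIntegral.continuous_primitive
          (fun a b => h.intervalIntegrable a b) 0).comp continuous_subtype_val⟩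
      map_add' := fun γ η => by
        ext t
        exact intervalIntegral.integral_add (γ.continuous.Icc_extend'.intervalIntegrable _ _)
          (η.continuous.Icc_extend'.intervalIntegrable _ _)
      map_smul' := fun c γ => by
        ext t
        exact intervalIntegral.integral_smul c _ } 1
    (fun γ => by
      refine (ContinuousMap.norm_le _ (by positivity)).2 fun t => ?_
      refine (intervalIntegral.norm_integral_le_of_norm_le_const (C := ‖γ‖)
        fun u _ => γ.norm_coe_le_norm _).trans ?_
      rw [mul_comm]
      have : |(t : ℝ)| ≤ 1 := abs_le.2 t.2
      simpa using mul_le_mul_of_nonneg_right this (norm_nonneg γ))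

/-- A smooth vector field has a local flow, depending smoothly on time and initial condition. -/
theorem exists_smooth_flow {E : Type u} [NormedAddCommGroup E] [NormedSpace ℝ E] [CompleteSpace E]
    [HasContDiffBump E] {X : E → E} {x₀ : E} (hX : ∀ᶠ x in 𝓝 x₀, ContDiffAt ℝ ∞ X x) :
    ∃ Φ : E × ℝ → E, (∀ᶠ p in 𝓝 (x₀, (0 : ℝ)), ContDiffAt ℝ ∞ Φ p ∧
      HasDerivAt (fun s => Φ (p.1, s)) (X (Φ p)) p.2) ∧ ∀ᶠ x in 𝓝 x₀, Φ (x, 0) = x := by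
  obtain ⟨Y, hY, hXY⟩ := exists_contDiff_eventuallyEq hX
  let Y' : C(E, E) := ⟨Y, hY.continuous⟩
  let B := C(Icc (-1 : ℝ) 1, E)
  let cst : E →L[ℝ] B := ContinuousLinearMap.mk
    { toFun := fun x => ContinuousMap.const _ x
      map_add' := fun _ _ => rfl
      map_smul' := fun _ _ => rfl } ContinuousMap.continuous_const'
  have hcst : ∀ x t, cst x t = x := fun _ _ => rfl
  let N : B → B := fun γ => primitiveCLM E (Y'.comp γ)
  have hN : ContDiff ℝ ∞ N :=
    (primitiveCLM E).contDiff.comp (contDiff_comp_continuousMap Y' hY)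
  -- A zero `((x, s), γ)` solves `γ' = s Y(γ)`, `γ 0 = x` on `[-1, 1]`, so `γ t` is the flow of `Y`
  -- at time `s t`. At `s = 0` the partial derivative in `γ` is the identity, and the implicit
  -- function theorem applies.
  let f : (E × ℝ) × B → B := fun v => v.2 - cst v.1.1 - v.1.2 • N v.2
  have hf : ContDiff ℝ ∞ f := by
    refine (contDiff_snd.sub (cst.contDiff.comp (contDiff_fst.comp contDiff_fst))).sub ?_
    exact (contDiff_snd.comp contDiff_fst).smul (hN.comp contDiff_snd)
  let u : (E × ℝ) × B := ((x₀, 0), cst x₀)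
  have hfu : f u = 0 := by simp [f, u]
  have hinv : (fderiv ℝ f u ∘L .inr ℝ (E × ℝ) B).IsInvertible := by
    have h1 : HasFDerivAt (fun γ : B => f ((x₀, 0), γ))
        (fderiv ℝ f u ∘L .inr ℝ (E × ℝ) B) (cst x₀) := by
      have := ((hf.differentiable (by simp)) u).hasFDerivAt
      exact HasFDerivAt.comp (g := f) (cst x₀) this (hasFDerivAt_prodMk_right _ _)
    have h2 : HasFDerivAt (fun γ : B => f ((x₀, 0), γ)) (ContinuousLinearMap.id ℝ B) (cst x₀) := by
      have : (fun γ : B => f ((x₀, 0), γ)) = fun γ => γ - cst x₀ := by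
        ext γ; simp [f]
      rw [this]
      exact (hasFDerivAt_id _).sub_const _
    rw [h1.unique h2]
    exact ⟨ContinuousLinearEquiv.refl ℝ B, rfl⟩
  obtain ⟨Γ, hΓ, hΓu, hiff⟩ := exists_smooth_implicitFunction hf hinv
  rw [hfu] at hiff
  have hΓc : ContinuousAt Γ (x₀, 0) := hΓ.self_of_nhds.continuousAt
  -- the defining equation
  have heq : ∀ᶠ p in 𝓝 (x₀, (0 : ℝ)), Γ p = cst p.1 + p.2 • N (Γ p) := by
    have h3 : Tendsto (fun p => (p, Γ p)) (𝓝 (x₀, (0 : ℝ))) (𝓝 u) := by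
      have : Tendsto (fun p => (p, Γ p)) (𝓝 (x₀, (0 : ℝ))) (𝓝 ((x₀, 0), Γ (x₀, 0))) :=
        continuousAt_id.prodMk hΓc
      have h4 : Γ (x₀, 0) = cst x₀ := hΓu
      rwa [h4] at this
    filter_upwards [h3.eventually hiff] with p hp
    have h5 : Γ p - cst p.1 - p.2 • N (Γ p) = 0 := hp.2 rfl
    rw [sub_sub, sub_eq_zero] at h5
    exact h5
  let one : Icc (-1 : ℝ) 1 := ⟨1, by norm_num⟩
  let ev : B →L[ℝ] E := ContinuousMap.evalCLM ℝ one
  have hev : ∀ γ, ev γ = γ one := fun _ => rfl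
  obtain ⟨δ, hδ, Hδ⟩ := Metric.eventually_nhds_iff.1 hiff
  have hΓδ : ∀ᶠ p in 𝓝 (x₀, (0 : ℝ)), dist (Γ p) (cst x₀) < δ := by
    have h4 : Γ (x₀, 0) = cst x₀ := hΓu
    have := hΓc.eventually (Metric.ball_mem_nhds _ hδ)
    rwa [h4] at this
  obtain ⟨η, hη, Hη⟩ := Metric.eventually_nhds_iff.1 (hΓδ.and heq)
  obtain ⟨s₀, hs₀, hs₀'⟩ : ∃ s₀ > 0, s₀ < min η δ := exists_between (lt_min hη hδ)
  have hs₀η := hs₀'.trans_le (min_le_left _ _)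
  have hs₀δ := hs₀'.trans_le (min_le_right _ _)
  have hI : (-1 : ℝ) ≤ 1 := by norm_num
  have hmem : ∀ c : ℝ, |c| ≤ 1 → c ∈ Icc (-1 : ℝ) 1 := fun c hc => abs_le.1 hc
  -- For one fixed small time scale `s₀`, the rescaled curve `t ↦ Γ (x, s₀) (t r / s₀)` solves the
  -- equation with scale `r`, hence equals `Γ (x, r)`. Its value at `t = 1` therefore runs along the
  -- single curve `Γ (x, s₀)` as `r` varies, and can be differentiated in `r`.
  have key : ∀ x, dist x x₀ < min η δ → ∀ r, |r| ≤ s₀ →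
      Γ (x, r) one = x + s₀ • ∫ u in (0 : ℝ)..(r / s₀), Y (IccExtend hI (Γ (x, s₀)) u) ∧
      Γ (x, r) one = IccExtend hI (Γ (x, s₀)) (r / s₀) := by
    intro x hx r hr
    have hxη := hx.trans_le (min_le_left _ _)
    have hxδ := hx.trans_le (min_le_right _ _)
    set γ := Γ (x, s₀) with hγ
    have hp : dist (x, s₀) (x₀, (0 : ℝ)) < η := by
      rw [Prod.dist_eq]
      exact max_lt hxη (by simpa [abs_of_pos hs₀] using hs₀η)
    obtain ⟨hγδ, hγeq⟩ := Hη hp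
    have hγt : ∀ t : ℝ, |t| ≤ 1 →
        IccExtend hI γ t = x + s₀ • ∫ u in (0 : ℝ)..t, Y (IccExtend hI γ u) := by
      intro t ht
      rw [IccExtend_of_mem _ _ (hmem t ht)]
      have := congrArg (fun η : B => η ⟨t, hmem t ht⟩) hγeq
      exact this
    have hc : |r / s₀| ≤ 1 := by
      rw [abs_div, abs_of_pos hs₀]
      exact div_le_one_of_le₀ hr hs₀.le
    let γr : B := ⟨fun t => IccExtend hI γ (t * (r / s₀)),
      γ.continuous.Icc_extend'.comp (by fun_prop)⟩
    have hγr : ∀ t : Icc (-1 : ℝ) 1, γr t = IccExtend hI γ (t * (r / s₀)) := fun _ => rfl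
    have hfr : f ((x, r), γr) = 0 := by
      have : γr = cst x + r • N γr := by
        ext t
        have ht : |(t : ℝ) * (r / s₀)| ≤ 1 := by
          rw [abs_mul]
          exact mul_le_one₀ (abs_le.2 t.2) (abs_nonneg _) hc
        rw [hγr, hγt _ ht]
        change _ = x + r • ∫ u in (0 : ℝ)..t, Y (IccExtend hI γr u)
        have h6 : ∫ u in (0 : ℝ)..t, Y (IccExtend hI γr u) =
            ∫ u in (0 : ℝ)..t, Y (IccExtend hI γ (u * (r / s₀))) := by
          refine intervalIntegral.integral_congr fun u hu => ?_
          have hu1 : u ∈ Icc (-1 : ℝ) 1 := by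
            refine (convex_Icc (-1 : ℝ) 1).ordConnected.uIcc_subset ?_ t.2 hu
            norm_num
          simp only [IccExtend_of_mem hI γr hu1, hγr]
        have h7 := intervalIntegral.smul_integral_comp_mul_right (a := 0) (b := (t : ℝ))
          (fun u => Y (IccExtend hI γ u)) (r / s₀)
        rw [zero_mul] at h7
        rw [h6, ← h7, smul_smul, mul_div_cancel₀ _ hs₀.ne']
      change γr - cst x - r • N γr = 0
      rw [sub_sub, sub_eq_zero]
      exact this
    have hγrδ : dist γr (cst x₀) < δ := by
      refine lt_of_le_of_lt ?_ hγδ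
      refine (ContinuousMap.dist_le dist_nonneg).2 fun t => ?_
      exact ContinuousMap.dist_apply_le_dist (f := γ) (g := cst x₀) _
    have hv : dist ((x, r), γr) u < δ := by
      rw [Prod.dist_eq, Prod.dist_eq]
      refine max_lt (max_lt hxδ ?_) hγrδ
      simpa [u] using hr.trans_lt hs₀δ
    have hΓr : Γ (x, r) = γr := (Hδ hv).1 hfr
    have h8 : Γ (x, r) one = IccExtend hI γ (r / s₀) := by
      rw [hΓr, hγr]; simp [one]
    exact ⟨h8.trans (hγt _ hc), h8⟩
  refine ⟨fun p => ev (Γ p), ?_, ?_⟩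
  · have hXY' : ∀ᶠ p in 𝓝 (x₀, (0 : ℝ)), Y (ev (Γ p)) = X (ev (Γ p)) := by
      have h9 : ContinuousAt (fun p => ev (Γ p)) (x₀, 0) :=
        ev.continuous.continuousAt.comp hΓc
      have h10 : ev (Γ (x₀, 0)) = x₀ := by
        have h4 : Γ (x₀, 0) = cst x₀ := hΓu
        rw [h4]; rfl
      have h11 : Tendsto (fun p => ev (Γ p)) (𝓝 (x₀, 0)) (𝓝 x₀) := by
        have := h9.tendsto
        rwa [h10] at this
      exact h11.eventually hXY
    have hball : ∀ᶠ p in 𝓝 (x₀, (0 : ℝ)), dist p.1 x₀ < min η δ ∧ |p.2| < s₀ := by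
      have h12 := Metric.ball_mem_nhds x₀ (lt_min hη hδ)
      have h13 := Metric.ball_mem_nhds (0 : ℝ) hs₀
      filter_upwards [prod_mem_nhds h12 h13] with p hp
      exact ⟨hp.1, by simpa using hp.2⟩
    filter_upwards [hΓ, hXY', hball] with p hp1 hp2 hp3
    refine ⟨ev.contDiff.contDiffAt.comp p hp1, ?_⟩
    rw [← hp2]
    set h : ℝ → E := fun u => Y (IccExtend hI (Γ (p.1, s₀)) u) with hh
    have hcont : Continuous h := hY.continuous.comp (Γ (p.1, s₀)).continuous.Icc_extend'
    have hd : HasDerivAt (fun r => p.1 + s₀ • ∫ u in (0 : ℝ)..(r / s₀), h u)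
        (s₀ • (1 / s₀) • h (p.2 / s₀)) p.2 := by
      refine HasDerivAt.const_add _ (HasDerivAt.const_smul s₀ ?_)
      have := hcont.integral_hasStrictDerivAt 0 (p.2 / s₀)
      exact this.hasDerivAt.scomp p.2 ((hasDerivAt_id p.2).div_const s₀)
    have h14 : s₀ • (1 / s₀) • h (p.2 / s₀) = Y (ev (Γ p)) := by
      rw [smul_smul, mul_one_div_cancel hs₀.ne', one_smul, hh]
      exact congrArg Y ((key p.1 hp3.1 p.2 hp3.2.le).2).symm
    rw [h14] at hd
    refine hd.congr_of_eventuallyEq ?_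
    have : ∀ᶠ r in 𝓝 p.2, |r| < s₀ := continuous_abs.continuousAt.eventually_lt
      continuousAt_const hp3.2
    filter_upwards [this] with r hr
    exact (key p.1 hp3.1 r hr.le).1
  · have : ∀ᶠ x in 𝓝 x₀, dist x x₀ < min η δ := Metric.ball_mem_nhds x₀ (lt_min hη hδ)
    filter_upwards [this] with x hx
    have h15 := (key x hx 0 (by simpa using hs₀.le)).1
    rw [zero_div, intervalIntegral.integral_same, smul_zero, add_zero] at h15
    exact h15

end Flow

/-! ### Inverse functions, Hadamard's lemma and uniqueness of integral curves -/

theorem isInvertible_of_injective {E G : Type*} [NormedAddCommGroup E] [NormedSpace ℝ E]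
    [FiniteDimensional ℝ E] [NormedAddCommGroup G] [NormedSpace ℝ G] [FiniteDimensional ℝ G]
    (h : Module.finrank ℝ E = Module.finrank ℝ G) {L : E →L[ℝ] G} (hL : Function.Injective L) :
    L.IsInvertible :=
  ⟨(LinearEquiv.ofInjectiveOfFinrankEq L.toLinearMap hL h).toContinuousLinearEquiv, by ext; rfl⟩

/-- Inverse function theorem, with smoothness on open sets. -/
theorem exists_openPartialHomeomorph {E G : Type*} [NormedAddCommGroup E] [NormedSpace ℝ E]
    [CompleteSpace E] [NormedAddCommGroup G] [NormedSpace ℝ G] {f : E → G} {a : E}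
    (hf : ∀ᶠ x in 𝓝 a, ContDiffAt ℝ ∞ f x) (ha : (fderiv ℝ f a).IsInvertible) :
    ∃ e : OpenPartialHomeomorph E G, a ∈ e.source ∧ (∀ x, e x = f x) ∧
      (∀ x ∈ e.source, ContDiffAt ℝ ∞ f x ∧ (fderiv ℝ f x).IsInvertible) ∧
      ∀ y ∈ e.target, ContDiffAt ℝ ∞ e.symm y := by
  have h0 : (∞ : WithTop ℕ∞) ≠ 0 := by simp
  obtain ⟨f', hf'⟩ := ha
  have hfa := hf.self_of_nhds
  have hd : HasFDerivAt f (f' : E →L[ℝ] G) a := by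
    rw [hf']; exact (hfa.differentiableAt h0).hasFDerivAt
  let e := hfa.toOpenPartialHomeomorph f hd h0
  have hinv : ∀ᶠ x in 𝓝 a, (fderiv ℝ f x).IsInvertible := by
    have hc : ContinuousAt (fderiv ℝ f) a := (hfa.fderiv_right (m := 0) (by simp)).continuousAt
    have := ContinuousLinearEquiv.nhds f'
    rw [hf'] at this
    filter_upwards [hc this] with v hv
    exact hv
  obtain ⟨s, hs, hso, has⟩ := eventually_nhds_iff.1 (hf.and hinv)
  refine ⟨e.restrOpen s hso, ⟨hfa.mem_toOpenPartialHomeomorph_source hd h0, has⟩, fun x => rfl,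
    fun x hx => hs x hx.2, fun y hy => ?_⟩
  have hy' := (e.restrOpen s hso).map_target hy
  obtain ⟨h1, f'', h2⟩ := hs _ hy'.2
  refine (e.restrOpen s hso).contDiffAt_symm (f₀' := f'') hy ?_ h1
  rw [h2]
  exact (h1.differentiableAt h0).hasFDerivAt

/-- Hadamard's lemma: a smooth function vanishing on the regular zero set of `b` is divisible
by `b`. -/
theorem exists_smooth_quotient {F : Type} [NormedAddCommGroup F] [NormedSpace ℝ F]
    [FiniteDimensional ℝ F] {b c : F → ℝ} {p : F}
    (hb : ∀ᶠ x in 𝓝 p, ContDiffAt ℝ ∞ b x) (hc : ∀ᶠ x in 𝓝 p, ContDiffAt ℝ ∞ c x)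
    (hp : b p = 0) (hdb : fderiv ℝ b p ≠ 0) (hbc : ∀ᶠ x in 𝓝 p, b x = 0 → c x = 0) :
    ∃ f : F → ℝ, ∀ᶠ x in 𝓝 p, ContDiffAt ℝ ∞ f x ∧ c x = f x * b x := by
  have := FiniteDimensional.complete ℝ F
  have h0 : (∞ : WithTop ℕ∞) ≠ 0 := by simp
  set L := fderiv ℝ b p with hL
  obtain ⟨u, hu⟩ : ∃ u, L u = 1 := by
    obtain ⟨w, hw⟩ := DFunLike.ne_iff.1 hdb
    refine ⟨(L w)⁻¹ • w, ?_⟩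
    have : L w ≠ 0 := by simpa using hw
    simp [this]
  -- This change of coordinates has derivative the identity at `p` and satisfies `L ∘ Θ = b`, which
  -- reduces the division to the case of a linear divisor `L`.
  let Θ : F → F := fun x => (x - p) + (b x - L (x - p)) • u
  have hΘ : ∀ᶠ x in 𝓝 p, ContDiffAt ℝ ∞ Θ x := by
    filter_upwards [hb] with x hx
    have h1 : ContDiffAt ℝ ∞ (fun x => x - p) x := contDiffAt_id.sub contDiffAt_const
    exact h1.add ((hx.sub (L.contDiff.contDiffAt.comp x h1)).smul contDiffAt_const)
  have hΘp : Θ p = 0 := by simp [Θ, hp]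
  have hLΘ : ∀ x, L (Θ x) = b x := fun x => by simp [Θ, hu]
  have hdΘ : HasFDerivAt Θ (ContinuousLinearMap.id ℝ F) p := by
    have h1 : HasFDerivAt (fun x => x - p) (ContinuousLinearMap.id ℝ F) p :=
      (hasFDerivAt_id p).sub_const p
    have h2 := (hb.self_of_nhds.differentiableAt h0).hasFDerivAt
    have h3 := h1.add ((h2.sub (L.hasFDerivAt.comp p h1)).smul_const u)
    refine h3.congr_fderiv ?_
    ext v
    simp [hL]
  have hinv : (fderiv ℝ Θ p).IsInvertible := by
    rw [hdΘ.fderiv]; exact ⟨ContinuousLinearEquiv.refl ℝ F, rfl⟩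
  obtain ⟨e, hpe, heΘ, -, hsymm⟩ := exists_openPartialHomeomorph hΘ hinv
  have h0t : (0 : F) ∈ e.target := by
    have := e.map_source hpe
    rwa [heΘ, hΘp] at this
  have hs0 : e.symm 0 = p := by
    have := e.left_inv hpe
    rwa [heΘ, hΘp] at this
  have hst : Tendsto e.symm (𝓝 0) (𝓝 p) := by
    have := (e.continuousAt_symm h0t).tendsto
    rwa [hs0] at this
  have hC : ∀ᶠ y in 𝓝 (0 : F), ContDiffAt ℝ ∞ (fun y => c (e.symm y)) y := by
    filter_upwards [hst.eventually hc, e.open_target.mem_nhds h0t] with y hy hy2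
    exact hy.comp y (hsymm y hy2)
  obtain ⟨C, hCs, hCe⟩ := exists_contDiff_eventuallyEq hC
  let pr : F →L[ℝ] F := ContinuousLinearMap.id ℝ F - L.smulRight u
  have hLpr : ∀ y, L (pr y) = 0 := fun y => by simp [pr, hu]
  have hCpr : ∀ᶠ y in 𝓝 (0 : F), C (pr y) = 0 := by
    have h1 : Tendsto pr (𝓝 0) (𝓝 0) := by
      have := pr.continuous.tendsto 0
      rwa [map_zero] at this
    filter_upwards [h1.eventually hCe, h1.eventually (hst.eventually hbc),
      h1.eventually (e.open_target.mem_nhds h0t)] with y hy1 hy2 hy3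
    rw [hy1]
    refine hy2 ?_
    rw [← hLΘ, ← heΘ, e.right_inv hy3, hLpr]
  let D : F → ℝ := fun y => fderiv ℝ C y u
  have hD : ContDiff ℝ ∞ D :=
    ((contDiff_infty_iff_fderiv.1 hCs).2).clm_apply contDiff_const
  let D' : C(F, ℝ) := ⟨D, hD.continuous⟩
  let curve : F →L[ℝ] C(Icc (-1 : ℝ) 1, F) := ContinuousLinearMap.mk
    { toFun := fun y => ⟨fun t => pr y + (t : ℝ) • L y • u, by fun_prop⟩
      map_add' := fun _ _ => by ext t; simp [add_smul]; abel
      map_smul' := fun a y => by ext t; simp [mul_smul, smul_comm a] }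
    (ContinuousMap.continuous_of_continuous_uncurry _ (by
      change Continuous fun q : F × Icc (-1 : ℝ) 1 => pr q.1 + (q.2 : ℝ) • L q.1 • u
      fun_prop))
  have hI : (-1 : ℝ) ≤ 1 := by norm_num
  let one : Icc (-1 : ℝ) 1 := ⟨1, by norm_num⟩
  -- The quotient is the integral of the derivative of `C` in the direction `u` along the segment
  -- from the projection `pr y` on `ker L` to `y`. Smoothness of composition operators takes the
  -- place of differentiation under the integral sign.
  let g : F → ℝ := fun y => primitiveCLM ℝ (D'.comp (curve y)) one
  have hg : ContDiff ℝ ∞ g := by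
    have h1 : ContDiff ℝ ∞ fun y => D'.comp (curve y) :=
      (contDiff_comp_continuousMap D' hD).comp curve.contDiff
    exact (ContinuousMap.evalCLM ℝ one).contDiff.comp ((primitiveCLM ℝ).contDiff.comp h1)
  have hgC : ∀ y, C y - C (pr y) = g y * L y := by
    intro y
    have h1 : g y = ∫ t in (0 : ℝ)..1, D (pr y + t • L y • u) := by
      change ∫ t in (0 : ℝ)..1, IccExtend hI (D'.comp (curve y)) t = _
      refine intervalIntegral.integral_congr fun t ht => ?_
      have ht1 : t ∈ Icc (-1 : ℝ) 1 := by
        rw [uIcc_of_le zero_le_one] at ht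
        exact ⟨by linarith [ht.1], ht.2⟩
      rw [IccExtend_of_mem _ _ ht1]
      rfl
    have h2 : ∀ t : ℝ, HasDerivAt (fun t : ℝ => C (pr y + t • L y • u))
        (D (pr y + t • L y • u) * L y) t := by
      intro t
      have h3 : HasDerivAt (fun t : ℝ => pr y + t • L y • u) (L y • u) t := by
        simpa using ((hasDerivAt_id t).smul_const (L y • u)).const_add (pr y)
      have h4 := ((hCs.differentiable h0) (pr y + t • L y • u)).hasFDerivAt.comp_hasDerivAt t h3
      refine HasDerivAt.congr_deriv (f := fun t : ℝ => C (pr y + t • L y • u)) h4 ?_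
      simp [D, mul_comm]
    have h5 : Continuous fun t : ℝ => D (pr y + t • L y • u) * L y := by
      have := hD.continuous
      fun_prop
    have h6 := intervalIntegral.integral_eq_sub_of_hasDerivAt (a := 0) (b := 1)
      (fun t _ => h2 t) (h5.intervalIntegrable _ _)
    rw [intervalIntegral.integral_mul_const, ← h1] at h6
    rw [h6]
    congr 2
    · simp [pr]
    · simp
  refine ⟨fun x => g (Θ x), ?_⟩
  have hΘt : Tendsto Θ (𝓝 p) (𝓝 0) := by
    have := hdΘ.continuousAt.tendsto
    rwa [hΘp] at this
  filter_upwards [hΘ, hΘt.eventually hCe, hΘt.eventually hCpr, e.open_source.mem_nhds hpe]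
    with x hx1 hx2 hx3 hx4
  refine ⟨hg.contDiffAt.comp x hx1, ?_⟩
  have := hgC (Θ x)
  rw [hx3, sub_zero, hLΘ, hx2, ← heΘ, e.left_inv hx4, heΘ] at this
  exact this

/-- Uniqueness of integral curves of a vector field which is `C^1` near the curves. -/
theorem integralCurve_unique {E : Type*} [NormedAddCommGroup E] [NormedSpace ℝ E]
    {X : E → E} {γ η : ℝ → E} {ε : ℝ}
    (hX : ∀ s ∈ Ioo (-ε) ε, ContDiffAt ℝ 1 X (γ s))
    (hγ : ∀ s ∈ Ioo (-ε) ε, HasDerivAt γ (X (γ s)) s)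
    (hη : ∀ s ∈ Ioo (-ε) ε, HasDerivAt η (X (η s)) s) (h0 : γ 0 = η 0) :
    ∀ s ∈ Ioo (-ε) ε, γ s = η s := by
  intro s hs
  have hε : 0 < ε := by linarith [hs.1, hs.2]
  have hconn : IsPreconnected (Ioo (-ε) ε) := isPreconnected_Ioo
  have hmem0 : (0 : ℝ) ∈ Ioo (-ε) ε := ⟨by linarith, hε⟩
  let A : Set ℝ := {s | γ =ᶠ[𝓝 s] η}
  have hAo : IsOpen A := isOpen_iff_mem_nhds.2 fun s hs => hs.eventuallyEq_nhds
  have hloc : ∀ s ∈ Ioo (-ε) ε, γ s = η s → s ∈ A := by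
    intro s hs heq
    obtain ⟨K, V, hV, hK⟩ := (hX s hs).exists_lipschitzOnWith
    have hI := Ioo_mem_nhds hs.1 hs.2
    refine ODE_solution_unique_of_eventually (v := fun _ => X) (s := fun _ => V) (K := K)
      (Eventually.of_forall fun _ => hK) ?_ ?_ heq
    · filter_upwards [hI, (hγ s hs).continuousAt.eventually_mem hV] with t ht1 ht2
      exact ⟨hγ t ht1, ht2⟩
    · filter_upwards [hI, (hη s hs).continuousAt.eventually_mem (heq ▸ hV)] with t ht1 ht2
      exact ⟨hη t ht1, ht2⟩
  have hsub : Ioo (-ε) ε ⊆ A := by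
    refine hconn.subset_of_closure_inter_subset hAo ⟨0, hmem0, hloc 0 hmem0 h0⟩ ?_
    rintro t ⟨ht1, ht2⟩
    refine hloc t ht2 ?_
    have hγc := (hγ t ht2).continuousAt
    have hηc := (hη t ht2).continuousAt
    by_contra hne
    have hev : ∀ᶠ r in 𝓝 t, γ r - η r ≠ 0 := (hγc.sub hηc).eventually_ne (sub_ne_zero.2 hne)
    obtain ⟨r, hr1, hr2⟩ := mem_closure_iff_nhds.1 ht1 _ hev
    exact hr1 (sub_eq_zero.2 hr2.self_of_nhds)
  exact (hsub hs).self_of_nhds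

/-! ### Contact forms and contact Hamiltonian vector fields -/

section ContactAlgebra

variable {E : Type*} [NormedAddCommGroup E] [NormedSpace ℝ E]

/-- The exterior derivative of a `1`-form on a normed space. -/
noncomputable def dOne (a : E → E →L[ℝ] ℝ) (x u v : E) : ℝ :=
  fderiv ℝ a x u v - fderiv ℝ a x v u

/-- `a` is smooth near `x` and is a contact form at `x`. -/
structure IsContactAt (a : E → E →L[ℝ] ℝ) (x : E) : Prop where
  smooth : ∀ᶠ y in 𝓝 x, ContDiffAt ℝ ∞ a y
  ne_zero : a x ≠ 0
  nondegenerate : ∀ u, a x u = 0 → (∀ v, a x v = 0 → dOne a x u v = 0) → u = 0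

theorem IsContactAt.contDiffAt {a : E → E →L[ℝ] ℝ} {x : E} (h : IsContactAt a x) :
    ContDiffAt ℝ ∞ a x := h.smooth.self_of_nhds

/-- The linear map `(X, ρ) ↦ (ι_X da - ρ a, a X)` at the point `x`. -/
noncomputable def contactMap (a : E → E →L[ℝ] ℝ) (x : E) : E × ℝ →L[ℝ] (E →L[ℝ] ℝ) × ℝ :=
  ((fderiv ℝ a x - (fderiv ℝ a x).flip) ∘L .fst ℝ E ℝ -
    (ContinuousLinearMap.snd ℝ E ℝ).smulRight (a x)).prod (a x ∘L .fst ℝ E ℝ)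

theorem contactMap_fst_apply (a : E → E →L[ℝ] ℝ) (x : E) (z : E × ℝ) (v : E) :
    (contactMap a x z).1 v = dOne a x z.1 v - z.2 * a x v := rfl

theorem contactMap_snd (a : E → E →L[ℝ] ℝ) (x : E) (z : E × ℝ) :
    (contactMap a x z).2 = a x z.1 := rfl

theorem exists_apply_ne_zero {a : E →L[ℝ] ℝ} (h : a ≠ 0) : ∃ v, a v ≠ 0 := by
  by_contra! hv
  exact h (by ext v; simpa using hv v)

/-- If `a X = 0` and `ι_X da = ρ a`, then `da (X, ·)` vanishes on `ker a`, so `X = 0`, and then `ρ a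
= 0` forces `ρ = 0`. As the dimensions agree, the map is invertible; this gives existence,
uniqueness and smoothness of contact Hamiltonian fields at once. -/
theorem IsContactAt.contactMap_injective {a : E → E →L[ℝ] ℝ} {x : E} (h : IsContactAt a x) :
    Function.Injective (contactMap a x) := by
  refine (injective_iff_map_eq_zero _).2 fun z hz => ?_
  have h1 : a x z.1 = 0 := by rw [← contactMap_snd, hz]; rfl
  have h2 : ∀ v, dOne a x z.1 v = z.2 * a x v := fun v => by
    have := contactMap_fst_apply a x z v
    rw [hz] at this
    exact (sub_eq_zero.1 this.symm)
  have h3 : z.1 = 0 := h.nondegenerate z.1 h1 fun v hv => by rw [h2, hv, mul_zero]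
  obtain ⟨v, hv⟩ := exists_apply_ne_zero h.ne_zero
  have h4 := h2 v
  rw [h3] at h4
  have h5 : z.2 * a x v = 0 := by rw [← h4]; simp [dOne]
  exact Prod.ext h3 ((mul_eq_zero.1 h5).resolve_right hv)

set_option synthInstance.maxHeartbeats 200000 in
theorem contDiff_flip {G K : Type*} [NormedAddCommGroup G] [NormedSpace ℝ G]
    [NormedAddCommGroup K] [NormedSpace ℝ K] {n : WithTop ℕ∞} :
    ContDiff ℝ n (fun L : E →L[ℝ] G →L[ℝ] K => L.flip) :=
  LinearIsometryEquiv.contDiff (𝕜 := ℝ) (E := E →L[ℝ] G →L[ℝ] K) (F := G →L[ℝ] E →L[ℝ] K)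
    (ContinuousLinearMap.flipₗᵢ ℝ E G K)

theorem contDiffAt_clm_prod {Y G K : Type*} [NormedAddCommGroup Y] [NormedSpace ℝ Y]
    [NormedAddCommGroup G] [NormedSpace ℝ G] [NormedAddCommGroup K] [NormedSpace ℝ K]
    {n : WithTop ℕ∞} {f : Y → E →L[ℝ] G} {g : Y → E →L[ℝ] K} {y : Y}
    (hf : ContDiffAt ℝ n f y) (hg : ContDiffAt ℝ n g y) :
    ContDiffAt ℝ n (fun y => (f y).prod (g y)) y := by
  have h : (fun y => (f y).prod (g y)) =
      fun y => .inl ℝ G K ∘L f y + .inr ℝ G K ∘L g y := by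
    funext y; ext v <;> simp
  rw [h]
  exact (contDiffAt_const.clm_comp hf).add (contDiffAt_const.clm_comp hg)

theorem contDiffAt_contactMap {a : E → E →L[ℝ] ℝ} {x : E} (h : ContDiffAt ℝ ∞ a x) :
    ContDiffAt ℝ ∞ (contactMap a) x := by
  have hd : ContDiffAt ℝ ∞ (fderiv ℝ a) x := h.fderiv_right (by simp)
  have h1 : ContDiffAt ℝ ∞ (fun x => (fderiv ℝ a x).flip) x :=
    ContDiffAt.comp (g := fun L : E →L[ℝ] E →L[ℝ] ℝ => L.flip) x contDiff_flip.contDiffAt hd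
  exact contDiffAt_clm_prod (((hd.sub h1).clm_comp contDiffAt_const).sub
    (contDiffAt_const.smulRight h)) (h.clm_comp contDiffAt_const)

variable [FiniteDimensional ℝ E]

theorem IsContactAt.isInvertible {a : E → E →L[ℝ] ℝ} {x : E} (h : IsContactAt a x) :
    (contactMap a x).IsInvertible := by
  refine isInvertible_of_injective ?_ h.contactMap_injective
  have : Module.finrank ℝ (E →L[ℝ] ℝ) = Module.finrank ℝ E := by
    rw [← (LinearMap.toContinuousLinearMap (𝕜 := ℝ) (E := E) (F' := ℝ)).finrank_eq]
    exact Subspace.dual_finrank_eq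
  simp [this]

/-- The contact Hamiltonian vector field `X` of the function `H`, together with its conformal
factor `ρ`: `a X = H` and `ι_X da + dH = ρ a`. -/
noncomputable def hamPair (a : E → E →L[ℝ] ℝ) (H : E → ℝ) (x : E) : E × ℝ :=
  (contactMap a x).inverse (-fderiv ℝ H x, H x)

theorem IsContactAt.contactMap_hamPair {a : E → E →L[ℝ] ℝ} {x : E} (h : IsContactAt a x)
    (H : E → ℝ) : contactMap a x (hamPair a H x) = (-fderiv ℝ H x, H x) :=
  h.isInvertible.self_apply_inverse _

theorem IsContactAt.eq_hamPair {a : E → E →L[ℝ] ℝ} {x : E} (h : IsContactAt a x)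
    {H : E → ℝ} {Z : E} {ρ : ℝ} (h1 : a x Z = H x)
    (h2 : ∀ v, dOne a x Z v + fderiv ℝ H x v = ρ * a x v) : hamPair a H x = (Z, ρ) := by
  refine h.contactMap_injective ?_
  rw [h.contactMap_hamPair]
  refine Prod.ext ?_ h1.symm
  ext v
  rw [contactMap_fst_apply]
  have := h2 v
  simp only [neg_apply]
  linarith

theorem IsContactAt.apply_hamPair {a : E → E →L[ℝ] ℝ} {x : E} (h : IsContactAt a x)
    (H : E → ℝ) : a x (hamPair a H x).1 = H x := by
  rw [← contactMap_snd, h.contactMap_hamPair]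

theorem IsContactAt.dOne_hamPair {a : E → E →L[ℝ] ℝ} {x : E} (h : IsContactAt a x)
    (H : E → ℝ) (v : E) :
    dOne a x (hamPair a H x).1 v + fderiv ℝ H x v = (hamPair a H x).2 * a x v := by
  have := contactMap_fst_apply a x (hamPair a H x) v
  rw [h.contactMap_hamPair] at this
  simp only [neg_apply] at this
  linarith

theorem IsContactAt.contDiffAt_hamPair {a : E → E →L[ℝ] ℝ} {x : E} (h : IsContactAt a x)
    {H : E → ℝ} (hH : ContDiffAt ℝ ∞ H x) : ContDiffAt ℝ ∞ (hamPair a H) x := by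
  have := FiniteDimensional.complete ℝ E
  obtain ⟨e, he⟩ := h.isInvertible
  have h1 : ContDiffAt ℝ ∞ (fun x => (contactMap a x).inverse) x := by
    have := contDiffAt_map_inverse (𝕜 := ℝ) (n := ∞) e
    rw [he] at this
    exact this.comp x (contDiffAt_contactMap h.contDiffAt)
  exact h1.clm_apply ((hH.fderiv_right (by simp)).neg.prodMk hH)

/-- The Lie derivative of `a` along a contact Hamiltonian vector field is `ρ a`. -/
theorem IsContactAt.lieDerivative_hamPair {a : E → E →L[ℝ] ℝ} {x : E}
    (h : ∀ᶠ y in 𝓝 x, IsContactAt a y) {H : E → ℝ} (hH : ContDiffAt ℝ ∞ H x) (w : E) :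
    fderiv ℝ a x (hamPair a H x).1 w + a x (fderiv ℝ (fun y => (hamPair a H y).1) x w) =
      (hamPair a H x).2 * a x w := by
  have h0 : (∞ : WithTop ℕ∞) ≠ 0 := by simp
  have hx := h.self_of_nhds
  have h1 : (fun y => a y (hamPair a H y).1) =ᶠ[𝓝 x] H := by
    filter_upwards [h] with y hy using hy.apply_hamPair H
  have ha := (hx.contDiffAt.differentiableAt h0).hasFDerivAt
  have hX : DifferentiableAt ℝ (fun y => (hamPair a H y).1) x :=
    (hx.contDiffAt_hamPair hH).fst.differentiableAt h0
  -- Cartan's formula by hand: `a(X) = H` is differentiated, and `dH` is then eliminated with the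
  -- equation `ι_X da + dH = ρ a`.
  have h2 := (ha.clm_apply hX.hasFDerivAt).fderiv
  rw [h1.fderiv_eq] at h2
  have h3 := congrArg (fun L => L w) h2
  simp at h3
  have h4 := hx.dOne_hamPair H w
  rw [dOne] at h4
  linarith

/-- Solutions of scalar linear differential equations vanish identically or nowhere. -/
theorem linear_ode_eq_zero_iff {q m : ℝ → ℝ} {ε : ℝ}
    (hm : ∀ s ∈ Ioo (-ε) ε, ContinuousAt m s)
    (hq : ∀ s ∈ Ioo (-ε) ε, HasDerivAt q (m s * q s) s) :
    ∀ s ∈ Ioo (-ε) ε, q s = 0 ↔ q 0 = 0 := by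
  intro s hs
  have hε : 0 < ε := by linarith [hs.1, hs.2]
  have hmem0 : (0 : ℝ) ∈ Ioo (-ε) ε := ⟨by linarith, hε⟩
  have hmc : ContinuousOn m (Ioo (-ε) ε) := fun s hs => (hm s hs).continuousWithinAt
  let P : ℝ → ℝ := fun s => ∫ u in (0 : ℝ)..s, m u
  have hP : ∀ s ∈ Ioo (-ε) ε, HasDerivAt P (m s) s := by
    intro s hs
    refine intervalIntegral.integral_hasDerivAt_right ?_ ?_ (hm s hs)
    · exact (hmc.mono (ordConnected_Ioo.uIcc_subset hmem0 hs)).intervalIntegrable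
    · exact hmc.stronglyMeasurableAtFilter isOpen_Ioo s hs
  have hd : ∀ s ∈ Ioo (-ε) ε, HasDerivAt (fun s => q s * Real.exp (-P s)) 0 s := by
    intro s hs
    refine ((hq s hs).mul (hP s hs).neg.exp).congr_deriv ?_
    simp only [Pi.neg_apply]
    ring
  have hconst := isOpen_Ioo.is_const_of_deriv_eq_zero isPreconnected_Ioo
    (fun s hs => (hd s hs).differentiableAt.differentiableWithinAt)
    (fun s hs => (hd s hs).deriv) hs hmem0
  have hP0 : P 0 = 0 := by simp [P]
  simp only [hP0, neg_zero, Real.exp_zero, mul_one] at hconst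
  rw [← hconst]
  simp

end ContactAlgebra

theorem minSmoothness_two_le_infty : minSmoothness ℝ 2 ≤ (∞ : WithTop ℕ∞) := by
  simpa using (show (2 : WithTop ℕ∞) ≤ ∞ from
    WithTop.coe_le_coe.2 (le_top : (2 : ℕ∞) ≤ ⊤))

/-! ### Invariance of the contact distribution under the flow -/

section FlowOut

variable {E F : Type*} [NormedAddCommGroup E] [NormedSpace ℝ E] [FiniteDimensional ℝ E]
  [NormedAddCommGroup F] [NormedSpace ℝ F]

/-- The flow of a contact Hamiltonian vector field preserves the contact distribution. -/
theorem apply_fderiv_flow_eq_zero_iff {a : E → E →L[ℝ] ℝ} {H : E → ℝ} {Φ : F × ℝ → E} {p : F}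
    (ha : ∀ᶠ y in 𝓝 (Φ (p, 0)), IsContactAt a y)
    (hH : ∀ᶠ y in 𝓝 (Φ (p, 0)), ContDiffAt ℝ ∞ H y)
    (hΦ : ∀ᶠ z in 𝓝 (p, (0 : ℝ)), ContDiffAt ℝ ∞ Φ z ∧
      HasDerivAt (fun s => Φ (z.1, s)) (hamPair a H (Φ z)).1 z.2) :
    ∀ᶠ z in 𝓝 (p, (0 : ℝ)), ∀ w, a (Φ z) (fderiv ℝ Φ z w) = 0 ↔
      a (Φ (z.1, 0)) (fderiv ℝ Φ (z.1, 0) w) = 0 := by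
  have h0 : (∞ : WithTop ℕ∞) ≠ 0 := by simp
  have hc : ContinuousAt Φ (p, 0) := hΦ.self_of_nhds.1.continuousAt
  have hall := hΦ.eventually_nhds.and
    ((hc.eventually ha.eventually_nhds).and (hc.eventually hH))
  obtain ⟨δ, hδ, hδ'⟩ := Metric.eventually_nhds_iff.1 hall
  filter_upwards [Metric.ball_mem_nhds _ hδ] with z hz w
  obtain ⟨y, s⟩ := z
  have hy : dist y p < δ := lt_of_le_of_lt (le_max_left _ _) hz
  have hs : s ∈ Ioo (-δ) δ := by
    have : dist s 0 < δ := lt_of_le_of_lt (le_max_right _ _) hz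
    rw [Real.dist_0_eq_abs] at this
    exact abs_lt.1 this
  have hP : ∀ r ∈ Ioo (-δ) δ, dist (y, r) (p, (0 : ℝ)) < δ := fun r hr => by
    rw [Prod.dist_eq]
    exact max_lt hy (by simpa using abs_lt.2 hr)
  have hline : ∀ r : ℝ, HasDerivAt (fun r : ℝ => (y, r)) ((0 : F), (1 : ℝ)) r := fun r =>
    (hasDerivAt_const r y).prodMk (hasDerivAt_id r)
  -- Along a flow line `q r = a (DΦ w)` solves `q' = ρ q`: the variational equation, obtained from
  -- symmetry of second derivatives, turns `q'` into the Lie derivative of `a` along `X`, which is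
  -- `ρ a`.
  refine linear_ode_eq_zero_iff (q := fun r => a (Φ (y, r)) (fderiv ℝ Φ (y, r) w))
    (m := fun r => (hamPair a H (Φ (y, r))).2) (ε := δ) ?_ ?_ s hs
  · intro r hr
    obtain ⟨h1, h2, h3⟩ := hδ' (hP r hr)
    have h4 := h1.self_of_nhds
    have h5 : ContinuousAt (fun z => (hamPair a H z).2) (Φ (y, r)) :=
      (h2.self_of_nhds.contDiffAt_hamPair h3).continuousAt.snd
    exact ContinuousAt.comp (g := fun z => (hamPair a H z).2) (f := fun r => Φ (y, r))
      h5 h4.2.continuousAt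
  · intro r hr
    obtain ⟨h1, h2, h3⟩ := hδ' (hP r hr)
    obtain ⟨h4, h5⟩ := h1.self_of_nhds
    have hX : ContDiffAt ℝ ∞ (fun z => (hamPair a H z).1) (Φ (y, r)) :=
      (h2.self_of_nhds.contDiffAt_hamPair h3).fst
    have h6 : HasDerivAt (fun r => a (Φ (y, r)))
        (fderiv ℝ a (Φ (y, r)) (hamPair a H (Φ (y, r))).1) r :=
      ((h2.self_of_nhds.contDiffAt.differentiableAt h0).hasFDerivAt).comp_hasDerivAt r h5
    have hd : ContDiffAt ℝ ∞ (fderiv ℝ Φ) (y, r) := h4.fderiv_right (by simp)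
    have h7 : HasDerivAt (fun r => fderiv ℝ Φ (y, r) w)
        (fderiv ℝ (fderiv ℝ Φ) (y, r) ((0 : F), (1 : ℝ)) w) r := by
      have := ((hd.differentiableAt h0).hasFDerivAt).comp_hasDerivAt r (hline r)
      simpa using this.clm_apply (hasDerivAt_const r w)
    have hsymm : fderiv ℝ (fderiv ℝ Φ) (y, r) (0, 1) w =
        fderiv ℝ (fderiv ℝ Φ) (y, r) w (0, 1) :=
      (h4.isSymmSndFDerivAt minSmoothness_two_le_infty).eq _ _
    have h8 : fderiv ℝ (fderiv ℝ Φ) (y, r) w (0, 1) =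
        fderiv ℝ (fun z => (hamPair a H z).1) (Φ (y, r)) (fderiv ℝ Φ (y, r) w) := by
      have e1 : (fun z => fderiv ℝ Φ z (0, 1)) =ᶠ[𝓝 (y, r)]
          fun z => (hamPair a H (Φ z)).1 := by
        filter_upwards [h1] with z hz
        have e2 := ((hz.1.differentiableAt h0).hasFDerivAt).comp_hasDerivAt z.2
          ((hasDerivAt_const z.2 z.1).prodMk (hasDerivAt_id z.2))
        exact e2.unique hz.2
      have e3 := e1.fderiv_eq (𝕜 := ℝ)
      have e4 : HasFDerivAt (fun z => fderiv ℝ Φ z (0, 1))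
          ((fderiv ℝ (fderiv ℝ Φ) (y, r)).flip (0, 1)) (y, r) := by
        have e6 := (hd.differentiableAt h0).hasFDerivAt
        have e7 := e6.clm_apply (hasFDerivAt_const (𝕜 := ℝ) ((0 : F), (1 : ℝ)) (y, r))
        simpa using e7
      have e5 : HasFDerivAt (fun z => (hamPair a H (Φ z)).1)
          (fderiv ℝ (fun z => (hamPair a H z).1) (Φ (y, r)) ∘L fderiv ℝ Φ (y, r)) (y, r) :=
        (hX.differentiableAt h0).hasFDerivAt.comp _ (h4.differentiableAt h0).hasFDerivAt
      rw [e4.fderiv, e5.fderiv] at e3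
      exact congrArg (fun L => L w) e3
    rw [hsymm, h8] at h7
    refine (h6.clm_apply h7).congr_deriv ?_
    exact IsContactAt.lieDerivative_hamPair h2 h3 _

end FlowOut

/-! ### Pullbacks, naturality and transversality of Hamiltonian fields -/

section Pullback

variable {E G : Type*} [NormedAddCommGroup E] [NormedSpace ℝ E]
  [NormedAddCommGroup G] [NormedSpace ℝ G]

/-- The second derivative of `f` is symmetric and cancels in the antisymmetrization. -/
theorem dOne_pullback {a : E → E →L[ℝ] ℝ} {f : G → E} {x : G}
    (ha : DifferentiableAt ℝ a (f x)) (hf : ContDiffAt ℝ ∞ f x) (u v : G) :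
    dOne (fun y => (a (f y)).comp (fderiv ℝ f y)) x u v =
      dOne a (f x) (fderiv ℝ f x u) (fderiv ℝ f x v) := by
  have h0 : (∞ : WithTop ℕ∞) ≠ 0 := by simp
  have hd : ContDiffAt ℝ ∞ (fderiv ℝ f) x := hf.fderiv_right (by simp)
  have h1 := (ha.hasFDerivAt.comp x (hf.differentiableAt h0).hasFDerivAt).clm_comp
    (hd.differentiableAt h0).hasFDerivAt
  have h2 := h1.fderiv
  have hs := (hf.isSymmSndFDerivAt minSmoothness_two_le_infty).eq u v
  unfold dOne
  simp only [Function.comp_def] at h2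
  rw [h2]
  simp [hs]

theorem dOne_smul {b : E → E →L[ℝ] ℝ} {g : E → ℝ} {x : E}
    (hb : DifferentiableAt ℝ b x) (hg : DifferentiableAt ℝ g x) (u v : E) :
    dOne (fun y => g y • b y) x u v =
      fderiv ℝ g x u * b x v - fderiv ℝ g x v * b x u + g x * dOne b x u v := by
  unfold dOne
  have h := (hg.hasFDerivAt.smul hb.hasFDerivAt).fderiv
  have h' : fderiv ℝ (fun y => g y • b y) x = _ := h
  rw [h']
  simp
  ring

theorem dOne_congr {b c : E → E →L[ℝ] ℝ} {x : E} (h : b =ᶠ[𝓝 x] c) : dOne b x = dOne c x := by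
  funext u v
  simp only [dOne, h.fderiv_eq]

theorem injective_add_smul {L : G →L[ℝ] E} (hL : Function.Injective L) {Z : E}
    (hZ : Z ∉ range L) : Function.Injective fun w : G × ℝ => L w.1 + w.2 • Z := by
  rintro ⟨v, s⟩ ⟨w, t⟩ h
  simp only at h
  have h1 : (s - t) • Z = L (w - v) := by
    rw [sub_smul, map_sub, sub_eq_sub_iff_add_eq_add, add_comm, h, add_comm]
  have hst : s = t := by
    by_contra hne
    refine hZ ⟨(s - t)⁻¹ • (w - v), ?_⟩
    rw [map_smul, ← h1, smul_smul, inv_mul_cancel₀ (sub_ne_zero.2 hne), one_smul]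
  subst hst
  rw [Prod.mk.injEq]
  exact ⟨hL (by simpa using h), rfl⟩

variable [FiniteDimensional ℝ E]

/-- Naturality of contact Hamiltonian vector fields. -/
theorem fderiv_hamPair_eq [FiniteDimensional ℝ G] {a : E → E →L[ℝ] ℝ} {b : G → G →L[ℝ] ℝ}
    {H : E → ℝ} {K : G → ℝ} {Ψ : G → E} {g : G → ℝ} {y : G}
    (hb : IsContactAt b y) (ha : IsContactAt a (Ψ y))
    (hΨ : ContDiffAt ℝ ∞ Ψ y) (hsurj : Function.Surjective (fderiv ℝ Ψ y))
    (hg : DifferentiableAt ℝ g y) (hg0 : g y ≠ 0)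
    (hK : DifferentiableAt ℝ K y) (hH : DifferentiableAt ℝ H (Ψ y))
    (hab : ∀ᶠ z in 𝓝 y, (a (Ψ z)).comp (fderiv ℝ Ψ z) = g z • b z)
    (hHK : ∀ᶠ z in 𝓝 y, H (Ψ z) = g z * K z) :
    fderiv ℝ Ψ y (hamPair b K y).1 = (hamPair a H (Ψ y)).1 := by
  have h0 : (∞ : WithTop ℕ∞) ≠ 0 := by simp
  have hap : ∀ v, a (Ψ y) (fderiv ℝ Ψ y v) = g y * b y v := fun v =>
    congrArg (fun L => L v) hab.self_of_nhds
  have h1 : ∀ v, dOne a (Ψ y) (fderiv ℝ Ψ y (hamPair b K y).1) (fderiv ℝ Ψ y v) =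
      fderiv ℝ g y (hamPair b K y).1 * b y v - fderiv ℝ g y v * K y +
        g y * dOne b y (hamPair b K y).1 v := by
    intro v
    rw [← dOne_pullback (ha.contDiffAt.differentiableAt h0) hΨ, dOne_congr hab,
      dOne_smul (hb.contDiffAt.differentiableAt h0) hg, hb.apply_hamPair]
  have h2 : ∀ v, fderiv ℝ H (Ψ y) (fderiv ℝ Ψ y v) =
      g y * fderiv ℝ K y v + K y * fderiv ℝ g y v := by
    intro v
    have e1 := (hH.hasFDerivAt.comp y (hΨ.differentiableAt h0).hasFDerivAt).fderiv
    have e2 := (hg.hasFDerivAt.mul hK.hasFDerivAt).fderiv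
    have e3 : fderiv ℝ (H ∘ Ψ) y = fderiv ℝ (g * K) y := Filter.EventuallyEq.fderiv_eq hHK
    rw [e1, e2] at e3
    simpa using congrArg (fun L => L v) e3
  -- The pushed forward field satisfies the equations defining the Hamiltonian field of `H`, with
  -- the conformal factor corrected by the logarithmic derivative of `g`. Surjectivity of the
  -- derivative allows testing on vectors `DΨ v` only.
  refine (congrArg Prod.fst (ha.eq_hamPair
    (ρ := fderiv ℝ g y (hamPair b K y).1 / g y + (hamPair b K y).2) ?_ ?_)).symm
  · rw [hap, hb.apply_hamPair, hHK.self_of_nhds]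
  · intro V
    obtain ⟨v, rfl⟩ := hsurj V
    have h3 := hb.dOne_hamPair K v
    rw [h1, h2, hap]
    field_simp
    linear_combination g y * h3

theorem exists_eq_add_smul [FiniteDimensional ℝ G]
    (hdim : Module.finrank ℝ E = Module.finrank ℝ G + 1)
    {L : G →L[ℝ] E} (hL : Function.Injective L) {Z : E} (hZ : Z ∉ range L) (V : E) :
    ∃ v, ∃ s : ℝ, V = L v + s • Z := by
  let A : G × ℝ →ₗ[ℝ] E := L.toLinearMap.coprod (LinearMap.toSpanSingleton ℝ E Z)
  have hA : Function.Injective A := injective_add_smul hL hZ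
  have hs : Function.Surjective A :=
    (LinearMap.injective_iff_surjective_of_finrank_eq_finrank (by simp [hdim])).1 hA
  obtain ⟨⟨v, s⟩, h⟩ := hs V
  exact ⟨v, s, h.symm⟩

/-- Two contact Hamiltonian vector fields whose Hamiltonians agree, up to the conformal factor
of the induced `1`-forms, along a hypersurface are simultaneously transverse to it. -/
theorem hamPair_mem_range_of_mem_range {E' : Type*} [NormedAddCommGroup E'] [NormedSpace ℝ E']
    [FiniteDimensional ℝ E'] [FiniteDimensional ℝ G]
    (hdim : Module.finrank ℝ E = Module.finrank ℝ G + 1)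
    {a : E → E →L[ℝ] ℝ} {a' : E' → E' →L[ℝ] ℝ} {j : G → E} {j' : G → E'} {H : E → ℝ} {H' : E' → ℝ}
    {f : G → ℝ} {x : G} (ha : IsContactAt a (j x)) (ha' : IsContactAt a' (j' x))
    (hj : ContDiffAt ℝ ∞ j x) (hj' : ContDiffAt ℝ ∞ j' x)
    (hjinj : Function.Injective (fderiv ℝ j x))
    (hH : DifferentiableAt ℝ H (j x)) (hH' : DifferentiableAt ℝ H' (j' x))
    (hf : DifferentiableAt ℝ f x) (hf0 : f x ≠ 0)
    (haa' : ∀ᶠ y in 𝓝 x, (a' (j' y)).comp (fderiv ℝ j' y) = f y • (a (j y)).comp (fderiv ℝ j y))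
    (hHH' : ∀ᶠ y in 𝓝 x, H' (j' y) = f y * H (j y))
    (hmem : (hamPair a' H' (j' x)).1 ∈ range (fderiv ℝ j' x)) :
    (hamPair a H (j x)).1 ∈ range (fderiv ℝ j x) := by
  have h0 : (∞ : WithTop ℕ∞) ≠ 0 := by simp
  obtain ⟨w, hw⟩ := hmem
  by_contra hnot
  set X := (hamPair a H (j x)).1 with hX
  have hap : ∀ v, a' (j' x) (fderiv ℝ j' x v) = f x * a (j x) (fderiv ℝ j x v) := fun v =>
    congrArg (fun L => L v) haa'.self_of_nhds
  have hda : DifferentiableAt ℝ (fun y => (a (j y)).comp (fderiv ℝ j y)) x :=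
    ((ha.contDiffAt.comp x hj).differentiableAt h0).clm_comp
      ((hj.fderiv_right (m := ∞) (by simp)).differentiableAt h0)
  have h1 : ∀ v, dOne a' (j' x) (fderiv ℝ j' x w) (fderiv ℝ j' x v) =
      fderiv ℝ f x w * a (j x) (fderiv ℝ j x v) - fderiv ℝ f x v * a (j x) (fderiv ℝ j x w) +
        f x * dOne a (j x) (fderiv ℝ j x w) (fderiv ℝ j x v) := by
    intro v
    rw [← dOne_pullback (ha'.contDiffAt.differentiableAt h0) hj', dOne_congr haa',
      dOne_smul hda hf, dOne_pullback (ha.contDiffAt.differentiableAt h0) hj]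
    rfl
  have h2 : ∀ v, fderiv ℝ H' (j' x) (fderiv ℝ j' x v) =
      f x * fderiv ℝ H (j x) (fderiv ℝ j x v) + H (j x) * fderiv ℝ f x v := by
    intro v
    have e1 := (hH'.hasFDerivAt.comp x (hj'.differentiableAt h0).hasFDerivAt).fderiv
    have e2 := (hf.hasFDerivAt.mul
      (hH.hasFDerivAt.comp x (hj.differentiableAt h0).hasFDerivAt)).fderiv
    have e3 : fderiv ℝ (H' ∘ j') x = fderiv ℝ (f * (H ∘ j)) x := Filter.EventuallyEq.fderiv_eq hHH'
    rw [e1, e2] at e3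
    simpa using congrArg (fun L => L v) e3
  have h3 : a (j x) (fderiv ℝ j x w) = H (j x) := by
    have e1 := ha'.apply_hamPair H'
    rw [← hw, hap, hHH'.self_of_nhds] at e1
    exact mul_left_cancel₀ hf0 e1
  -- Suppose `X' = Dj' w` is tangent and put `Z = X - Dj w`. Subtracting the two Hamiltonian
  -- equations on tangent vectors, all terms with `dH` and `df` cancel and `da (Z, ·) = κ a`
  -- remains; also `a Z = 0`. If `X` were not tangent, `Z` and the tangent vectors would span `E`,
  -- so `da (Z, ·)` would vanish on `ker a`. Nondegeneracy then gives `Z = 0`, a contradiction.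
  set κ : ℝ := (hamPair a H (j x)).2 - ((hamPair a' H' (j' x)).2 - fderiv ℝ f x w / f x) with hκ
  have h4 : ∀ v, dOne a (j x) (X - fderiv ℝ j x w) (fderiv ℝ j x v) =
      κ * a (j x) (fderiv ℝ j x v) := by
    intro v
    have e1 := ha'.dOne_hamPair H' (fderiv ℝ j' x v)
    rw [← hw, h1, h2, hap, h3] at e1
    have e2 := ha.dOne_hamPair H (fderiv ℝ j x v)
    have e3 : dOne a (j x) (X - fderiv ℝ j x w) (fderiv ℝ j x v) =
        dOne a (j x) X (fderiv ℝ j x v) -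
          dOne a (j x) (fderiv ℝ j x w) (fderiv ℝ j x v) := by
      simp [dOne]; ring
    rw [e3, hκ]
    field_simp
    linear_combination f x * e2 - e1
  have h5 : a (j x) (X - fderiv ℝ j x w) = 0 := by
    rw [map_sub, h3, hX, ha.apply_hamPair, sub_self]
  have hZ : X - fderiv ℝ j x w ∉ range (fderiv ℝ j x) := by
    rintro ⟨v, hv⟩
    exact hnot ⟨v + w, by rw [map_add, hv, sub_add_cancel]⟩
  refine hZ ⟨0, ?_⟩
  rw [map_zero]
  refine (ha.nondegenerate _ h5 fun V hV => ?_).symm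
  obtain ⟨v, s, rfl⟩ := exists_eq_add_smul hdim hjinj hZ V
  rw [map_add, map_smul, h5, smul_zero, add_zero] at hV
  have e4 : dOne a (j x) (X - fderiv ℝ j x w)
      (fderiv ℝ j x v + s • (X - fderiv ℝ j x w)) =
      dOne a (j x) (X - fderiv ℝ j x w) (fderiv ℝ j x v) := by
    simp [dOne]; ring
  rw [e4, h4, hV, mul_zero]

end Pullback

/-! ### The conformal factor between forms with the same kernels -/

section Ratio

variable {F : Type} [NormedAddCommGroup F] [NormedSpace ℝ F]

/-- A `1`-form whose exterior derivative is nondegenerate where the form vanishes. -/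
def NondegenerateZeros (b : F → F →L[ℝ] ℝ) (x : F) : Prop :=
  b x = 0 → ∀ u, (∀ v, dOne b x u v = 0) → u = 0

/-- A form vanishing near `x` has zero exterior derivative at `x`, which is degenerate as soon as
`F` is nonzero. -/
theorem NondegenerateZeros.frequently_ne_zero [Nontrivial F] {b : F → F →L[ℝ] ℝ} {x : F}
    (h : NondegenerateZeros b x) : ∃ᶠ y in 𝓝 x, b y ≠ 0 := by
  intro h1
  have h2 : b =ᶠ[𝓝 x] fun _ => 0 := by
    filter_upwards [h1] with y hy using not_not.1 hy
  obtain ⟨u, hu⟩ := exists_ne (0 : F)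
  refine hu (h h2.self_of_nhds u fun v => ?_)
  rw [dOne_congr h2]
  simp [dOne]

/-- The conformal factor between `1`-forms with nondegenerate zeros is unique. -/
theorem NondegenerateZeros.factor_unique [Nontrivial F] {b : F → F →L[ℝ] ℝ} {x : F}
    (h : NondegenerateZeros b x) {f g : F → ℝ} (hf : ContinuousAt f x) (hg : ContinuousAt g x)
    (hfg : ∀ᶠ y in 𝓝 x, f y • b y = g y • b y) : f x = g x := by
  by_contra hne
  have h1 : ∀ᶠ y in 𝓝 x, f y - g y ≠ 0 := (hf.sub hg).eventually_ne (sub_ne_zero.2 hne)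
  obtain ⟨y, hy1, hy2, hy3⟩ := (h.frequently_ne_zero.and_eventually (h1.and hfg)).exists
  refine hy1 ((smul_eq_zero.1 ?_).resolve_left hy2)
  rw [sub_smul, hy3, sub_self]

/-- Two `1`-forms with nondegenerate zeros and the same kernels differ by a smooth nonvanishing
factor. -/
theorem exists_smooth_factor [FiniteDimensional ℝ F] {b c : F → F →L[ℝ] ℝ} {p : F}
    (hb : ∀ᶠ x in 𝓝 p, ContDiffAt ℝ ∞ b x) (hc : ∀ᶠ x in 𝓝 p, ContDiffAt ℝ ∞ c x)
    (hbn : NondegenerateZeros b p) (hcn : NondegenerateZeros c p)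
    (hbc : ∀ᶠ x in 𝓝 p, ∀ v, b x v = 0 ↔ c x v = 0) :
    ∃ f : F → ℝ, ∀ᶠ x in 𝓝 p, ContDiffAt ℝ ∞ f x ∧ f x ≠ 0 ∧ c x = f x • b x := by
  have h0 : (∞ : WithTop ℕ∞) ≠ 0 := by simp
  have prop : ∀ (β γ : F →L[ℝ] ℝ) (u : F), (∀ v, β v = 0 ↔ γ v = 0) → β u ≠ 0 →
      γ = (γ u / β u) • β := by
    intro β γ u h hu
    ext v
    have : β (v - (β v / β u) • u) = 0 := by
      simp [hu]
    have h2 := (h _).1 this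
    simp only [map_sub, map_smul, smul_eq_mul] at h2
    simp only [smul_apply, smul_eq_mul]
    field_simp at h2 ⊢
    linarith
  rcases subsingleton_or_nontrivial F with hF | hF
  · refine ⟨fun _ => 1, Eventually.of_forall fun x => ⟨contDiffAt_const, one_ne_zero, ?_⟩⟩
    ext v
    simp [Subsingleton.elim v 0]
  · by_cases hp : b p = 0
    · obtain ⟨u, hu⟩ := exists_ne (0 : F)
      -- Nondegeneracy at a zero of `b` provides a fixed vector `v` for which the function `x ↦ b x
      -- v` has nonzero differential at `p`. Hadamard's lemma then divides `c x v` by `b x v`.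
      have h1 : fderiv ℝ b p ≠ 0 := by
        intro h
        exact hu (hbn hp u fun v => by simp [dOne, h])
      obtain ⟨w, hw⟩ : ∃ w, fderiv ℝ b p w ≠ 0 := by
        by_contra! h
        exact h1 (by ext w : 1; simpa using h w)
      obtain ⟨v, hv⟩ := exists_apply_ne_zero hw
      have hbv : ∀ᶠ x in 𝓝 p, ContDiffAt ℝ ∞ (fun x => b x v) x := by
        filter_upwards [hb] with x hx using hx.clm_apply contDiffAt_const
      have hcv : ∀ᶠ x in 𝓝 p, ContDiffAt ℝ ∞ (fun x => c x v) x := by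
        filter_upwards [hc] with x hx using hx.clm_apply contDiffAt_const
      have hfd : fderiv ℝ (fun x => b x v) p w = fderiv ℝ b p w v := by
        have := ((hb.self_of_nhds.differentiableAt h0).hasFDerivAt.clm_apply
          (hasFDerivAt_const v p)).fderiv
        rw [this]; simp
      have hdb : fderiv ℝ (fun x => b x v) p ≠ 0 := by
        intro h
        rw [h] at hfd
        exact hv hfd.symm
      obtain ⟨f, hf⟩ := exists_smooth_quotient hbv hcv (by simp [hp]) hdb
        (by filter_upwards [hbc] with x hx using (hx v).1)
      have hdne : ∀ᶠ x in 𝓝 p, fderiv ℝ (fun x => b x v) x ≠ 0 := by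
        have : ContinuousAt (fderiv ℝ (fun x => b x v)) p :=
          (hbv.self_of_nhds.fderiv_right (m := 0) (by simp)).continuousAt
        exact this.eventually_ne hdb
      -- Proportionality gives the identity wherever `b x v ≠ 0`. That set is dense near `p` since
      -- the differential of `x ↦ b x v` does not vanish there, and continuity does the rest.
      have heq : ∀ᶠ x in 𝓝 p, c x = f x • b x := by
        filter_upwards [hdne, hf.eventually_nhds, hbc.eventually_nhds, hb, hc]
          with x hx1 hx2 hx3 hx4 hx5
        by_contra hne
        have hcont : ContinuousAt (fun x => c x - f x • b x) x :=
          hx5.continuousAt.sub (hx2.self_of_nhds.1.continuousAt.smul hx4.continuousAt)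
        have hev := hcont.eventually_ne (sub_ne_zero.2 hne)
        have hz : (fun x => b x v) =ᶠ[𝓝 x] fun _ => 0 := by
          filter_upwards [hev, hx2, hx3] with y hy1 hy2 hy3
          by_contra hby
          refine hy1 (sub_eq_zero.2 ?_)
          have h2 := prop _ _ v hy3 hby
          rw [hy2.2, mul_div_cancel_right₀ _ hby] at h2
          exact h2
        exact hx1 (by rw [hz.fderiv_eq]; simp)
      -- If `f p = 0`, then `dc = df ∧ b + f db` vanishes at `p`, where `c` vanishes too, against
      -- the nondegeneracy of `c`.
      have hfp : f p ≠ 0 := by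
        intro hfp
        have hcp : c p = 0 := by rw [heq.self_of_nhds, hfp, zero_smul]
        refine hu (hcn hcp u fun w => ?_)
        rw [dOne_congr heq, dOne_smul (hb.self_of_nhds.differentiableAt h0)
          (hf.self_of_nhds.1.differentiableAt h0), hfp, hp]
        simp
      refine ⟨f, ?_⟩
      filter_upwards [hf, heq, hf.self_of_nhds.1.continuousAt.eventually_ne hfp] with x h1 h2 h3
      exact ⟨h1.1, h3, h2⟩
    · obtain ⟨u, hu⟩ := exists_apply_ne_zero hp
      have hcu : c p u ≠ 0 := fun h => hu ((hbc.self_of_nhds u).2 h)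
      have hbu' : ∀ᶠ x in 𝓝 p, b x u ≠ 0 :=
        (hb.self_of_nhds.continuousAt.clm_apply continuousAt_const).eventually_ne hu
      have hcu' : ∀ᶠ x in 𝓝 p, c x u ≠ 0 :=
        (hc.self_of_nhds.continuousAt.clm_apply continuousAt_const).eventually_ne hcu
      refine ⟨fun x => c x u / b x u, ?_⟩
      filter_upwards [hb, hc, hbu', hcu', hbc] with x h1 h2 h3 h4 h5
      exact ⟨(h2.clm_apply contDiffAt_const).div (h1.clm_apply contDiffAt_const) h3,
        div_ne_zero h4 h3, prop _ _ u h5 h3⟩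

end Ratio

/-! ### Induced forms on hypersurfaces -/

section NondegeneratePullback

variable {E F : Type*} [NormedAddCommGroup E] [NormedSpace ℝ E] [FiniteDimensional ℝ E]

/-- The `1`-form induced by a contact form on a hypersurface has nondegenerate zeros. -/
theorem IsContactAt.nondegenerateZeros_pullback {F : Type} [NormedAddCommGroup F] [NormedSpace ℝ F]
    [FiniteDimensional ℝ F] (hdim : Module.finrank ℝ E = Module.finrank ℝ F + 1)
    {a : E → E →L[ℝ] ℝ} {j : F → E} {x : F} (ha : IsContactAt a (j x)) (hj : ContDiffAt ℝ ∞ j x)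
    (hinj : Function.Injective (fderiv ℝ j x)) :
    NondegenerateZeros (fun y => (a (j y)).comp (fderiv ℝ j y)) x := by
  intro h u hu
  have h1 : ∀ v, a (j x) (fderiv ℝ j x v) = 0 := fun v => congrArg (fun L => L v) h
  -- Where the induced form vanishes, the tangent space of the hypersurface lies in `ker a`, hence
  -- equals it by dimension. There `da` is nondegenerate.
  obtain ⟨Z, hZ⟩ := exists_apply_ne_zero ha.ne_zero
  have hZr : Z ∉ range (fderiv ℝ j x) := by
    rintro ⟨v, rfl⟩
    exact hZ (h1 v)
  refine hinj ?_
  rw [map_zero]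
  refine ha.nondegenerate _ (h1 u) fun V hV => ?_
  obtain ⟨v, s, rfl⟩ := exists_eq_add_smul hdim hinj hZr V
  rw [map_add, h1, zero_add, map_smul, smul_eq_mul] at hV
  rw [(mul_eq_zero.1 hV).resolve_right hZ, zero_smul, add_zero,
    ← dOne_pullback (ha.contDiffAt.differentiableAt (by simp)) hj]
  exact hu v

end NondegeneratePullback

/-! ### Gluing germs along a subspace and injectivity near it -/

section Gluing

/-- A coherent family of germs along a subspace is induced by a single map. -/
theorem exists_eventuallyEq_of_coherent {T M N : Type*} [TopologicalSpace T] [TopologicalSpace M]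
    [MetrizableSpace M] [Nonempty N] {j : T → M} (hj : IsInducing j) (φ : T → M → N)
    (hφ : ∀ z, ∀ᶠ w in 𝓝 z, φ w =ᶠ[𝓝 (j w)] φ z) :
    ∃ Φ : M → N, ∀ z, Φ =ᶠ[𝓝 (j z)] φ z := by
  have h1 : ∀ z, ∃ O : Set M, IsOpen O ∧ j z ∈ O ∧ ∀ w, j w ∈ O → φ w =ᶠ[𝓝 (j w)] φ z := by
    intro z
    have := hφ z
    rw [hj.nhds_eq_comap, eventually_comap] at this
    obtain ⟨O, hO, hOo, hz⟩ := eventually_nhds_iff.1 this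
    exact ⟨O, hOo, hz, fun w hw => hO _ hw w rfl⟩
  choose O hOo hzO hO using h1
  let U : Set M := ⋃ z, O z
  have hUo : IsOpen U := isOpen_iUnion hOo
  let u : T → Set U := fun z => Subtype.val ⁻¹' O z
  have huo : ∀ z, IsOpen (u z) := fun z => (hOo z).preimage continuous_subtype_val
  have hucov : ⋃ z, u z = univ := by
    refine eq_univ_of_forall fun x => ?_
    obtain ⟨z, hz⟩ := mem_iUnion.1 x.2
    exact mem_iUnion.2 ⟨z, hz⟩
  let _ := metrizableSpaceMetric M
  -- `U` is metrizable, hence paracompact and normal, and carries a locally finite closed refinement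
  -- `C`. The value at `x` is taken from any index `z` with `x ∈ C z`. Near `j w` only the finitely
  -- many `z` with `j w ∈ C z` occur, and for each of them `φ z` and `φ w` have the same germ at `j
  -- w`, so the choice is immaterial there.
  obtain ⟨v, hvo, hvcov, hvlf, hvu⟩ := precise_refinement u huo hucov
  obtain ⟨C, hCcov, hCc, hCv⟩ := exists_iUnion_eq_closed_subset hvo (fun x => hvlf.point_finite x)
    hvcov
  have hClf : LocallyFinite C := hvlf.subset hCv
  have hex : ∀ x : U, ∃ z, x ∈ C z := fun x => mem_iUnion.1 (hCcov ▸ mem_univ x)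
  choose i hi using hex
  classical
  refine ⟨fun x => if h : x ∈ U then φ (i ⟨x, h⟩) x else Classical.arbitrary N, fun w => ?_⟩
  have hwU : j w ∈ U := mem_iUnion.2 ⟨w, hzO w⟩
  let x₀ : U := ⟨j w, hwU⟩
  have h2 : ∀ᶠ x : U in 𝓝 x₀, ∀ z, x ∈ C z → x₀ ∈ C z := by
    filter_upwards [hClf.iInter_compl_mem_nhds hCc x₀] with x hx z hxz
    by_contra hne
    exact (mem_iInter₂.1 hx z hne) hxz
  have h3 : ∀ᶠ x : U in 𝓝 x₀, ∀ z ∈ {z | x₀ ∈ C z}, φ z x = φ w x := by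
    refine (eventually_all_finite (hClf.point_finite x₀)).2 fun z hz => ?_
    have : ∀ᶠ y in 𝓝 (x₀ : M), φ z y = φ w y := (hO z w (hvu z (hCv z hz))).symm
    exact continuous_subtype_val.continuousAt.eventually this
  have h4 : ∀ᶠ x : U in 𝓝 x₀, φ (i x) x = φ w x := by
    filter_upwards [h2, h3] with x hx2 hx3
    exact hx3 _ (hx2 _ (hi x))
  have h5 : ∀ᶠ x in map (Subtype.val : U → M) (𝓝 x₀),
      (if h : x ∈ U then φ (i ⟨x, h⟩) x else Classical.arbitrary N) = φ w x := by
    rw [eventually_map]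
    filter_upwards [h4] with x hx
    rw [dif_pos x.2]
    exact hx
  rwa [hUo.isOpenEmbedding_subtypeVal.map_nhds_eq] at h5

/-- The supremum of the radii at most `1` of balls on which `Φ` is injective. -/
noncomputable def injectivityRadius {M N : Type*} [PseudoMetricSpace M] (Φ : M → N) (x : M) : ℝ :=
  sSup {r | r ≤ 1 ∧ InjOn Φ (Metric.ball x r)}

/-- A map which is locally injective along a subspace, and whose restriction to this subspace is
an embedding, is injective on a neighbourhood of the subspace. -/
theorem exists_injOn_of_isInducing {T M N : Type*} [TopologicalSpace T] [TopologicalSpace M]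
    [MetrizableSpace M] [TopologicalSpace N] [MetrizableSpace N] {j : T → M} {Φ : M → N}
    (hj : Continuous j) (hΦj : IsInducing (Φ ∘ j))
    (hc : ∀ z, ContinuousAt Φ (j z)) (hinj : ∀ z, ∃ O ∈ 𝓝 (j z), InjOn Φ O) :
    ∃ V : Set M, IsOpen V ∧ (∀ z, j z ∈ V) ∧ InjOn Φ V := by
  let _ := metrizableSpaceMetric M
  let _ := metrizableSpaceMetric N
  let S : M → Set ℝ := fun x => {r | r ≤ 1 ∧ InjOn Φ (Metric.ball x r)}
  let R : M → ℝ := injectivityRadius Φ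
  have hbdd : ∀ x, BddAbove (S x) := fun x => ⟨1, fun r hr => hr.1⟩
  have hne : ∀ x, (S x).Nonempty := fun x => ⟨0, zero_le_one, by simp⟩
  have hRinj : ∀ x, InjOn Φ (Metric.ball x (R x)) := by
    intro x y hy z hz hyz
    have hm : max (dist y x) (dist z x) < R x := max_lt hy hz
    obtain ⟨r, hr, hlt⟩ := exists_lt_of_lt_csSup (hne x) hm
    exact hr.2 (lt_of_le_of_lt (le_max_left _ _) hlt) (lt_of_le_of_lt (le_max_right _ _) hlt) hyz
  have hRpos : ∀ z, 0 < R (j z) := by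
    intro z
    obtain ⟨O, hO, hOi⟩ := hinj z
    obtain ⟨ε, hε, hεO⟩ := Metric.mem_nhds_iff.1 hO
    have : min ε 1 ∈ S (j z) := ⟨min_le_right _ _,
      hOi.mono ((Metric.ball_subset_ball (min_le_left _ _)).trans hεO)⟩
    exact lt_of_lt_of_le (lt_min hε one_pos) (le_csSup (hbdd _) this)
  -- Injectivity on the ball of radius `r` around `y` passes to the ball of radius `r - dist x y`
  -- around `x`. Nonpositive radii are admitted, so no case distinction arises.
  have hRlip : ∀ x y, R y ≤ R x + dist x y := by
    intro x y
    refine csSup_le (hne y) fun r hr => ?_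
    have : r - dist x y ∈ S x := by
      refine ⟨by linarith [hr.1, dist_nonneg (x := x) (y := y)], hr.2.mono ?_⟩
      refine Metric.ball_subset_ball' ?_
      linarith
    have h := le_csSup (hbdd x) this
    change _ ≤ R x at h
    linarith
  -- Since `Φ ∘ j` is inducing, closeness of the images of `w` and `z` forces `w` close to `z`, and
  -- so `j w` close to `j z`.
  have hσ : ∀ z, ∃ σ > 0, ∀ w, dist (Φ (j w)) (Φ (j z)) < 2 * σ →
      dist (j w) (j z) < R (j z) / 3 := by
    intro z
    have h1 : ∀ᶠ w in 𝓝 z, dist (j w) (j z) < R (j z) / 3 :=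
      hj.continuousAt.eventually (Metric.ball_mem_nhds _ (by linarith [hRpos z]))
    rw [hΦj.nhds_eq_comap, eventually_comap] at h1
    obtain ⟨ε, hε, H⟩ := Metric.eventually_nhds_iff.1 h1
    exact ⟨ε / 2, by positivity, fun w hw => H (by simpa [mul_div_cancel₀] using hw) w rfl⟩
  choose σ hσ0 hσ using hσ
  -- If `x ∈ W z` and `y ∈ W w` have the same image and `σ w ≤ σ z`, then `j w` is within `R/3` of
  -- `j z`, where `R = R (j z)`. Hence `R (j w) ≤ 4R/3`, and `y` is within `4R/30 + R/3 < R` of `j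
  -- z`. Both points lie in a ball on which `Φ` is injective.
  let W : T → Set M := fun z =>
    interior (Metric.ball (j z) (R (j z) / 10) ∩ {x | dist (Φ x) (Φ (j z)) < σ z})
  refine ⟨⋃ z, W z, isOpen_iUnion fun z => isOpen_interior, fun z => mem_iUnion.2 ⟨z, ?_⟩, ?_⟩
  · refine mem_interior_iff_mem_nhds.2 (inter_mem (Metric.ball_mem_nhds _ ?_) ?_)
    · linarith [hRpos z]
    · exact hc z (Metric.ball_mem_nhds _ (hσ0 z))
  · have main : ∀ z w x y, x ∈ W z → y ∈ W w → σ w ≤ σ z → Φ x = Φ y → x = y := by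
      intro z w x y hx hy hle hxy
      obtain ⟨hx1, hx2⟩ := interior_subset hx
      obtain ⟨hy1, hy2⟩ := interior_subset hy
      rw [Metric.mem_ball] at hx1 hy1
      rw [mem_ofPred_eq] at hx2 hy2
      have h1 : dist (Φ (j w)) (Φ (j z)) < 2 * σ z := by
        have := dist_triangle_left (Φ (j w)) (Φ (j z)) (Φ x)
        rw [← hxy] at hy2
        linarith
      have h2 := hσ z w h1
      have h3 := hRlip (j z) (j w)
      rw [dist_comm] at h3
      have h4 := dist_triangle y (j w) (j z)
      have h5 := hRpos z
      refine hRinj (j z) ?_ ?_ hxy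
      · rw [Metric.mem_ball]; linarith
      · rw [Metric.mem_ball]; linarith
    intro x hx y hy hxy
    obtain ⟨z, hz⟩ := mem_iUnion.1 hx
    obtain ⟨w, hw⟩ := mem_iUnion.1 hy
    rcases le_total (σ w) (σ z) with h | h
    · exact main z w x y hz hw h hxy
    · exact (main w z y x hw hz h hxy.symm).symm

end Gluing

/-! ### Flow-outs of a hypersurface and contactomorphism germs -/

section FlowOut

variable {E E' F : Type} [NormedAddCommGroup E] [NormedSpace ℝ E]
  [NormedAddCommGroup E'] [NormedSpace ℝ E'] [NormedAddCommGroup F] [NormedSpace ℝ F]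

/-- `Φ` is the flow-out of the map `j : F → E` along the vector field `X`, near `(x, 0)`. -/
structure IsFlowOut (X : E → E) (j : F → E) (Φ : F × ℝ → E) (x : F) : Prop where
  smooth : ∀ᶠ z in 𝓝 (x, (0 : ℝ)), ContDiffAt ℝ ∞ Φ z
  deriv : ∀ᶠ z in 𝓝 (x, (0 : ℝ)), HasDerivAt (fun s => Φ (z.1, s)) (X (Φ z)) z.2
  initial : ∀ᶠ y in 𝓝 x, Φ (y, 0) = j y
  fderiv_initial : ∀ᶠ y in 𝓝 x, ∀ w, fderiv ℝ Φ (y, 0) w = fderiv ℝ j y w.1 + w.2 • X (j y)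
  invertible : (fderiv ℝ Φ (x, 0)).IsInvertible

/-- The germ of `ψ` at `j x` extends the correspondence `j y ↦ j' y` and maps the vector field
`X` to the vector field `X'`. -/
structure Intertwines (X : E → E) (X' : E' → E') (j : F → E) (j' : F → E') (ψ : E → E') (x : F) :
    Prop where
  smooth : ∀ᶠ y in 𝓝 (j x), ContDiffAt ℝ ∞ ψ y
  comm : ∀ᶠ y in 𝓝 x, ψ (j y) = j' y
  map_field : ∀ᶠ y in 𝓝 (j x), fderiv ℝ ψ y (X y) = X' (ψ y)

theorem Intertwines.eventually {X : E → E} {X' : E' → E'} {j : F → E} {j' : F → E'} {ψ : E → E'}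
    {x : F} (h : Intertwines X X' j j' ψ x) (hj : ContinuousAt j x) :
    ∀ᶠ y in 𝓝 x, Intertwines X X' j j' ψ y := by
  filter_upwards [hj.eventually h.smooth.eventually_nhds, h.comm.eventually_nhds,
    hj.eventually h.map_field.eventually_nhds] with y h1 h2 h3 using ⟨h1, h2, h3⟩

/-- The germ of `ψ` at `j x` is a contactomorphism extending the correspondence `j y ↦ j' y`. -/
structure IsContactGerm (a : E → E →L[ℝ] ℝ) (a' : E' → E' →L[ℝ] ℝ) (j : F → E) (j' : F → E')
    (ψ : E → E') (x : F) : Prop where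
  smooth : ∀ᶠ y in 𝓝 (j x), ContDiffAt ℝ ∞ ψ y
  comm : ∀ᶠ y in 𝓝 x, ψ (j y) = j' y
  invertible : (fderiv ℝ ψ (j x)).IsInvertible
  contact : ∀ᶠ y in 𝓝 (j x), ∀ v, a' (ψ y) (fderiv ℝ ψ y v) = 0 ↔ a y v = 0

variable [FiniteDimensional ℝ E] [FiniteDimensional ℝ F]

/-- `Φ (y, s)` is the point `j y` moved for time `s` by the local flow. Its derivative at `(x, 0)`
is `(v, s) ↦ Dj v + s X`, which is injective by transversality and invertible by dimension. -/
theorem exists_isFlowOut (hdim : Module.finrank ℝ E = Module.finrank ℝ F + 1)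
    {X : E → E} {j : F → E} {x : F}
    (hX : ∀ᶠ y in 𝓝 (j x), ContDiffAt ℝ ∞ X y) (hj : ∀ᶠ y in 𝓝 x, ContDiffAt ℝ ∞ j y)
    (hinj : Function.Injective (fderiv ℝ j x)) (htr : X (j x) ∉ range (fderiv ℝ j x)) :
    ∃ Φ, IsFlowOut X j Φ x := by
  have := FiniteDimensional.complete ℝ E
  have h0 : (∞ : WithTop ℕ∞) ≠ 0 := by simp
  obtain ⟨θ, hθ, hθ0⟩ := exists_smooth_flow hX
  have hjc : ContinuousAt j x := hj.self_of_nhds.continuousAt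
  have ht : Tendsto (fun z : F × ℝ => (j z.1, z.2)) (𝓝 (x, 0)) (𝓝 (j x, 0)) := by
    have : ContinuousAt (fun z : F × ℝ => (j z.1, z.2)) (x, 0) :=
      (ContinuousAt.comp (g := j) (f := Prod.fst) (x := (x, (0 : ℝ))) hjc continuousAt_fst).prodMk
        continuousAt_snd
    exact this
  have hfst : Tendsto (Prod.fst : F × ℝ → F) (𝓝 (x, 0)) (𝓝 x) := continuousAt_fst
  have hpair : Tendsto (fun y : F => (y, (0 : ℝ))) (𝓝 x) (𝓝 (x, 0)) :=
    (continuousAt_id.prodMk continuousAt_const)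
  let Φ : F × ℝ → E := fun z => θ (j z.1, z.2)
  have hsm : ∀ᶠ z in 𝓝 (x, (0 : ℝ)), ContDiffAt ℝ ∞ Φ z := by
    filter_upwards [ht.eventually hθ, hfst.eventually hj] with z h1 h2
    exact ContDiffAt.comp (g := θ) (f := fun z : F × ℝ => (j z.1, z.2)) z h1.1
      ((h2.comp z contDiffAt_fst).prodMk contDiffAt_snd)
  have hde : ∀ᶠ z in 𝓝 (x, (0 : ℝ)), HasDerivAt (fun s => Φ (z.1, s)) (X (Φ z)) z.2 := by
    filter_upwards [ht.eventually hθ] with z h1 using h1.2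
  have hin : ∀ᶠ y in 𝓝 x, Φ (y, 0) = j y := hjc.eventually hθ0
  have hfd : ∀ᶠ y in 𝓝 x, ∀ w, fderiv ℝ Φ (y, 0) w = fderiv ℝ j y w.1 + w.2 • X (j y) := by
    filter_upwards [hpair.eventually hsm, hpair.eventually hde, hin.eventually_nhds, hj]
      with y h1 h2 h3 h4 w
    have hd := (h1.differentiableAt h0).hasFDerivAt
    have e1 : fderiv ℝ Φ (y, 0) (w.1, 0) = fderiv ℝ j y w.1 := by
      have e2 := (HasFDerivAt.comp (g := Φ) (f := fun y => (y, (0 : ℝ))) y hd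
        (hasFDerivAt_prodMk_left y (0 : ℝ))).fderiv
      have e3 : fderiv ℝ (Φ ∘ fun y => (y, (0 : ℝ))) y = fderiv ℝ j y :=
        Filter.EventuallyEq.fderiv_eq h3
      rw [e3] at e2
      rw [e2]; simp
    have e4 : fderiv ℝ Φ (y, 0) (0, w.2) = w.2 • X (j y) := by
      have e5 := hd.comp_hasDerivAt (0 : ℝ)
        ((hasDerivAt_const (0 : ℝ) y).prodMk (hasDerivAt_id (0 : ℝ)))
      have e6 := e5.unique h2
      have e7 : ((0 : F), w.2) = w.2 • ((0 : F), (1 : ℝ)) := by simp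
      rw [e7, map_smul, e6, h3.self_of_nhds]
    have e8 : w = (w.1, 0) + (0, w.2) := by simp
    conv_lhs => rw [e8]
    rw [map_add, e1, e4]
  refine ⟨Φ, hsm, hde, hin, hfd, isInvertible_of_injective (by simp [hdim]) ?_⟩
  have : ⇑(fderiv ℝ Φ (x, 0)) = fun w : F × ℝ => fderiv ℝ j x w.1 + w.2 • X (j x) :=
    funext hfd.self_of_nhds
  rw [this]
  exact injective_add_smul hinj htr

/-- Both maps send integral curves of `X` issuing from the hypersurface to integral curves of `X'`
with the same starting points, so they agree along these curves, which fill a neighbourhood of `j x`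
by transversality. -/
theorem Intertwines.germ_unique (hdim : Module.finrank ℝ E = Module.finrank ℝ F + 1)
    {X : E → E} {X' : E' → E'} {j : F → E} {j' : F → E'} {ψ ψ' : E → E'} {x : F}
    (hψ : Intertwines X X' j j' ψ x) (hψ' : Intertwines X X' j j' ψ' x)
    (hX : ∀ᶠ y in 𝓝 (j x), ContDiffAt ℝ ∞ X y) (hX' : ∀ᶠ y in 𝓝 (j' x), ContDiffAt ℝ ∞ X' y)
    (hj : ∀ᶠ y in 𝓝 x, ContDiffAt ℝ ∞ j y)
    (hinj : Function.Injective (fderiv ℝ j x)) (htr : X (j x) ∉ range (fderiv ℝ j x)) :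
    ψ =ᶠ[𝓝 (j x)] ψ' := by
  have := FiniteDimensional.complete ℝ E
  have h0 : (∞ : WithTop ℕ∞) ≠ 0 := by simp
  obtain ⟨Φ, hΦ⟩ := exists_isFlowOut hdim hX hj hinj htr
  obtain ⟨e, hxe, heΦ, -, -⟩ := exists_openPartialHomeomorph hΦ.smooth hΦ.invertible
  have hΦx : Φ (x, 0) = j x := hΦ.initial.self_of_nhds
  have hΦc : Tendsto Φ (𝓝 (x, 0)) (𝓝 (j x)) := by
    have := hΦ.smooth.self_of_nhds.continuousAt.tendsto
    rwa [hΦx] at this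
  have hψc : Tendsto ψ (𝓝 (j x)) (𝓝 (j' x)) := by
    have := hψ.smooth.self_of_nhds.continuousAt.tendsto
    rwa [hψ.comm.self_of_nhds] at this
  have hfst : Tendsto (Prod.fst : F × ℝ → F) (𝓝 (x, 0)) (𝓝 x) := continuousAt_fst
  have hall : ∀ᶠ z in 𝓝 (x, (0 : ℝ)), HasDerivAt (fun s => Φ (z.1, s)) (X (Φ z)) z.2 ∧
      (ContDiffAt ℝ ∞ ψ (Φ z) ∧ fderiv ℝ ψ (Φ z) (X (Φ z)) = X' (ψ (Φ z))) ∧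
      (ContDiffAt ℝ ∞ ψ' (Φ z) ∧ fderiv ℝ ψ' (Φ z) (X (Φ z)) = X' (ψ' (Φ z))) ∧
      ContDiffAt ℝ ∞ X' (ψ (Φ z)) ∧ Φ (z.1, 0) = j z.1 ∧ ψ (j z.1) = j' z.1 ∧
      ψ' (j z.1) = j' z.1 :=
    hΦ.deriv.and (((hΦc.eventually (hψ.smooth.and hψ.map_field)).and
      ((hΦc.eventually (hψ'.smooth.and hψ'.map_field)).and
      ((hΦc.eventually (hψc.eventually hX')).and
      ((hfst.eventually hΦ.initial).and ((hfst.eventually hψ.comm).and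
        (hfst.eventually hψ'.comm)))))))
  obtain ⟨δ, hδ, H⟩ := Metric.eventually_nhds_iff.1 hall
  have hzero : ∀ z, dist z (x, (0 : ℝ)) < δ → ψ (Φ z) = ψ' (Φ z) := by
    rintro ⟨y, s⟩ hz
    have hy : dist y x < δ := lt_of_le_of_lt (le_max_left _ _) hz
    have hs : s ∈ Ioo (-δ) δ := by
      have : dist s 0 < δ := lt_of_le_of_lt (le_max_right _ _) hz
      rw [Real.dist_0_eq_abs] at this
      exact abs_lt.1 this
    have hP : ∀ r ∈ Ioo (-δ) δ, dist (y, r) (x, (0 : ℝ)) < δ := fun r hr => by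
      rw [Prod.dist_eq]
      exact max_lt hy (by simpa using abs_lt.2 hr)
    refine integralCurve_unique (X := X') (γ := fun s => ψ (Φ (y, s)))
      (η := fun s => ψ' (Φ (y, s))) (ε := δ) ?_ ?_ ?_ ?_ s hs
    · intro r hr
      exact (H (hP r hr)).2.2.2.1.of_le (by simp)
    · intro r hr
      obtain ⟨h1, ⟨h2, h3⟩, -⟩ := H (hP r hr)
      rw [← h3]
      exact (h2.differentiableAt h0).hasFDerivAt.comp_hasDerivAt r h1
    · intro r hr
      obtain ⟨h1, -, ⟨h2, h3⟩, -⟩ := H (hP r hr)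
      rw [← h3]
      exact (h2.differentiableAt h0).hasFDerivAt.comp_hasDerivAt r h1
    · obtain ⟨-, -, -, -, h1, h2, h3⟩ := H (hP 0 ⟨by linarith, hδ⟩)
      simp only at h1 h2 h3
      rw [h1, h2, h3]
  have hev : ∀ᶠ z in 𝓝 (x, (0 : ℝ)), ψ (Φ z) = ψ' (Φ z) := by
    filter_upwards [Metric.ball_mem_nhds _ hδ] with z hz using hzero z hz
  have hmap := e.map_nhds_eq hxe
  rw [heΦ, hΦx] at hmap
  rw [EventuallyEq, ← hmap, eventually_map]
  filter_upwards [hev] with z hz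
  rw [heΦ]
  exact hz

variable [FiniteDimensional ℝ E']

/-- Flowing out along contact Hamiltonian vector fields extends the correspondence `j y ↦ j' y`
to a contactomorphism germ. -/
theorem exists_isContactGerm (hdim : Module.finrank ℝ E = Module.finrank ℝ F + 1)
    (hdim' : Module.finrank ℝ E' = Module.finrank ℝ F + 1)
    {a : E → E →L[ℝ] ℝ} {a' : E' → E' →L[ℝ] ℝ} {j : F → E} {j' : F → E'} {H : E → ℝ} {H' : E' → ℝ}
    {f : F → ℝ} {x : F} (ha : ∀ᶠ y in 𝓝 (j x), IsContactAt a y)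
    (ha' : ∀ᶠ y in 𝓝 (j' x), IsContactAt a' y)
    (hj : ∀ᶠ y in 𝓝 x, ContDiffAt ℝ ∞ j y) (hj' : ∀ᶠ y in 𝓝 x, ContDiffAt ℝ ∞ j' y)
    (hinj : Function.Injective (fderiv ℝ j x)) (hinj' : Function.Injective (fderiv ℝ j' x))
    (hH : ∀ᶠ y in 𝓝 (j x), ContDiffAt ℝ ∞ H y) (hH' : ∀ᶠ y in 𝓝 (j' x), ContDiffAt ℝ ∞ H' y)
    (hf : DifferentiableAt ℝ f x) (hf0 : ∀ᶠ y in 𝓝 x, f y ≠ 0)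
    (haa' : ∀ᶠ y in 𝓝 x, (a' (j' y)).comp (fderiv ℝ j' y) = f y • (a (j y)).comp (fderiv ℝ j y))
    (hHH' : ∀ᶠ y in 𝓝 x, H' (j' y) = f y * H (j y))
    (htr : (hamPair a H (j x)).1 ∉ range (fderiv ℝ j x)) :
    ∃ ψ, Intertwines (fun y => (hamPair a H y).1) (fun y => (hamPair a' H' y).1) j j' ψ x ∧
      IsContactGerm a a' j j' ψ x := by
  have := FiniteDimensional.complete ℝ E
  have h0 : (∞ : WithTop ℕ∞) ≠ 0 := by simp
  have hX : ∀ᶠ y in 𝓝 (j x), ContDiffAt ℝ ∞ (fun y => (hamPair a H y).1) y := by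
    filter_upwards [ha, hH] with y h1 h2 using (h1.contDiffAt_hamPair h2).fst
  have hX' : ∀ᶠ y in 𝓝 (j' x), ContDiffAt ℝ ∞ (fun y => (hamPair a' H' y).1) y := by
    filter_upwards [ha', hH'] with y h1 h2 using (h1.contDiffAt_hamPair h2).fst
  have htr' : (hamPair a' H' (j' x)).1 ∉ range (fderiv ℝ j' x) := fun hmem =>
    htr (hamPair_mem_range_of_mem_range hdim ha.self_of_nhds ha'.self_of_nhds hj.self_of_nhds
      hj'.self_of_nhds hinj (hH.self_of_nhds.differentiableAt h0)
      (hH'.self_of_nhds.differentiableAt h0) hf hf0.self_of_nhds haa' hHH' hmem)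
  obtain ⟨Φ, hΦ⟩ := exists_isFlowOut hdim hX hj hinj htr
  obtain ⟨Φ', hΦ'⟩ := exists_isFlowOut hdim' hX' hj' hinj' htr'
  obtain ⟨e, hxe, heΦ, hes, het⟩ := exists_openPartialHomeomorph hΦ.smooth hΦ.invertible
  have hΦx : Φ (x, 0) = j x := hΦ.initial.self_of_nhds
  have hΦx' : Φ' (x, 0) = j' x := hΦ'.initial.self_of_nhds
  have hfst : Tendsto (Prod.fst : F × ℝ → F) (𝓝 (x, 0)) (𝓝 x) := continuousAt_fst
  have hpair : Tendsto (fun y : F => (y, (0 : ℝ))) (𝓝 x) (𝓝 (x, 0)) :=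
    (continuousAt_id.prodMk continuousAt_const)
  have hmap : map Φ (𝓝 (x, 0)) = 𝓝 (j x) := by
    have h1 := e.map_nhds_eq hxe
    have h2 : (e : F × ℝ → E) = Φ := funext heΦ
    rwa [h2, hΦx] at h1
  let ψ : E → E' := fun y => Φ' (e.symm y)
  have hsrc : ∀ᶠ z in 𝓝 (x, (0 : ℝ)), z ∈ e.source := e.open_source.mem_nhds hxe
  have hψΦ : ∀ z ∈ e.source, ψ (Φ z) = Φ' z := fun z hz => by
    have h1 := e.left_inv hz
    rw [heΦ] at h1
    simp only [ψ, h1]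
  have hsmooth : ∀ᶠ z in 𝓝 (x, (0 : ℝ)), ContDiffAt ℝ ∞ ψ (Φ z) := by
    filter_upwards [hsrc, hΦ'.smooth] with z hz1 hz2
    have h1 := e.left_inv hz1
    have h2 := e.map_source hz1
    rw [heΦ] at h1 h2
    refine ContDiffAt.comp (g := Φ') (Φ z) ?_ (het _ h2)
    rwa [h1]
  have hchain : ∀ᶠ z in 𝓝 (x, (0 : ℝ)),
      (fderiv ℝ ψ (Φ z)).comp (fderiv ℝ Φ z) = fderiv ℝ Φ' z := by
    filter_upwards [hsrc.eventually_nhds, hsmooth] with z hz1 hz2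
    have h1 := ((hz2.differentiableAt h0).hasFDerivAt.comp z
      ((hes z hz1.self_of_nhds).1.differentiableAt h0).hasFDerivAt).fderiv
    rw [← h1]
    refine Filter.EventuallyEq.fderiv_eq ?_
    filter_upwards [hz1] with w hw using hψΦ w hw
  have hcomm : ∀ᶠ y in 𝓝 x, ψ (j y) = j' y := by
    filter_upwards [hpair.eventually hsrc, hΦ.initial, hΦ'.initial] with y h1 h2 h3
    rw [← h2, hψΦ _ h1, h3]
  refine ⟨ψ, ⟨?_, hcomm, ?_⟩, ⟨?_, hcomm, ?_, ?_⟩⟩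
  · rwa [← hmap, eventually_map]
  · rw [← hmap, eventually_map]
    filter_upwards [hsrc, hchain, hΦ.deriv, hΦ'.deriv, hΦ'.smooth] with z h1 h2 h3 h4 h5
    have hline : HasDerivAt (fun r : ℝ => (z.1, r)) ((0 : F), (1 : ℝ)) z.2 :=
      (hasDerivAt_const z.2 z.1).prodMk (hasDerivAt_id z.2)
    have e1 := (((hes z h1).1.differentiableAt h0).hasFDerivAt.comp_hasDerivAt z.2 hline).unique h3
    have e2 := ((h5.differentiableAt h0).hasFDerivAt.comp_hasDerivAt z.2 hline).unique h4
    rw [hψΦ z h1, ← e1, ← e2, ← h2]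
    rfl
  · rwa [← hmap, eventually_map]
  · obtain ⟨A, hA⟩ := hΦ.invertible
    obtain ⟨B, hB⟩ := hΦ'.invertible
    have h1 := hchain.self_of_nhds
    rw [hΦx, ← hA, ← hB] at h1
    refine ⟨A.symm.trans B, ?_⟩
    ext v
    have := congrArg (fun L => L (A.symm v)) h1
    simpa using this.symm
  · rw [← hmap, eventually_map]
    -- Invariance under both flows reduces the contact condition to time `0`. There, for `w = (v,
    -- s)`, `a (DΦ w) = a (Dj v) + s H`, while `a' (DΦ' w) = f (a (Dj v) + s H)`: the scaling of
    -- `H'` by `f` makes the transverse part match the tangential one.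
    have k1 := apply_fderiv_flow_eq_zero_iff (a := a) (H := H) (Φ := Φ) (p := x)
      (by rwa [hΦx]) (by rwa [hΦx]) (hΦ.smooth.and hΦ.deriv)
    have k2 := apply_fderiv_flow_eq_zero_iff (a := a') (H := H') (Φ := Φ') (p := x)
      (by rwa [hΦx']) (by rwa [hΦx']) (hΦ'.smooth.and hΦ'.deriv)
    have hjc := hj.self_of_nhds.continuousAt
    have hjc' := hj'.self_of_nhds.continuousAt
    filter_upwards [hsrc, hchain, k1, k2,
      hfst.eventually (hΦ.fderiv_initial.and (hΦ.initial.and (hjc.eventually ha))),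
      hfst.eventually (hΦ'.fderiv_initial.and (hΦ'.initial.and (hjc'.eventually ha'))),
      hfst.eventually (haa'.and (hHH'.and hf0))] with z h1 h2 h3 h4 h5 h6 h7 v
    obtain ⟨B, hB⟩ := (hes z h1).2
    obtain ⟨w, rfl⟩ : ∃ w, fderiv ℝ Φ z w = v := ⟨B.symm v, by rw [← hB]; simp⟩
    have e1 : fderiv ℝ ψ (Φ z) (fderiv ℝ Φ z w) = fderiv ℝ Φ' z w := congrArg (fun L => L w) h2
    have e2 : a' (j' z.1) (fderiv ℝ j' z.1 w.1) = f z.1 * a (j z.1) (fderiv ℝ j z.1 w.1) :=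
      congrArg (fun L => L w.1) h7.1
    rw [e1, hψΦ z h1, h3 w, h4 w, h5.1, h6.1, h5.2.1, h6.2.1, map_add, map_add, map_smul, map_smul,
      h5.2.2.apply_hamPair, h6.2.2.apply_hamPair, e2, h7.2.1]
    have e3 : f z.1 * a (j z.1) (fderiv ℝ j z.1 w.1) + w.2 • (f z.1 * H (j z.1)) =
        f z.1 * (a (j z.1) (fderiv ℝ j z.1 w.1) + w.2 • H (j z.1)) := by
      simp only [smul_eq_mul]; ring
    rw [e3]
    exact mul_eq_zero_iff_left h7.2.2

end FlowOut

/-! ### Relative extension of contact germs in charts -/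

section LocalExtension

variable {E F : Type} [NormedAddCommGroup E] [NormedSpace ℝ E] [FiniteDimensional ℝ E]
  [NormedAddCommGroup F] [NormedSpace ℝ F] [FiniteDimensional ℝ F]

/-- The conformal factor of a map between contact manifolds, as computed with the Reeb field. -/
noncomputable def conformalFactor {E' : Type*} [NormedAddCommGroup E'] [NormedSpace ℝ E']
    (a : E → E →L[ℝ] ℝ) (a' : E' → E' →L[ℝ] ℝ) (ψ : E → E') (y : E) : ℝ :=
  a' (ψ y) (fderiv ℝ ψ y (hamPair a (fun _ => 1) y).1)

/-- Every `v` differs from `a(v)` times the Reeb vector by an element of `ker a`, which the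
derivative of `ψ` sends to `ker a'`. -/
theorem IsContactAt.eq_conformalFactor_smul {E' : Type*} [NormedAddCommGroup E']
    [NormedSpace ℝ E'] {a : E → E →L[ℝ] ℝ} {a' : E' → E' →L[ℝ] ℝ} {ψ : E → E'} {y : E}
    (ha : IsContactAt a y) (ha' : a' (ψ y) ≠ 0) (hψ : (fderiv ℝ ψ y).IsInvertible)
    (h : ∀ v, a' (ψ y) (fderiv ℝ ψ y v) = 0 ↔ a y v = 0) :
    conformalFactor a a' ψ y ≠ 0 ∧
      (a' (ψ y)).comp (fderiv ℝ ψ y) = conformalFactor a a' ψ y • a y := by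
  have hR := ha.apply_hamPair (fun _ => 1)
  have heq : (a' (ψ y)).comp (fderiv ℝ ψ y) = conformalFactor a a' ψ y • a y := by
    ext v
    have h1 : a y (v - a y v • (hamPair a (fun _ => 1) y).1) = 0 := by simp [hR]
    have h2 := (h _).2 h1
    rw [map_sub, map_sub, map_smul, map_smul, sub_eq_zero] at h2
    rw [ContinuousLinearMap.comp_apply, h2, smul_eq_mul, mul_comm]
    rfl
  refine ⟨fun h0 => ha' ?_, heq⟩
  obtain ⟨B, hB⟩ := hψ
  rw [h0, zero_smul] at heq
  ext V
  have := congrArg (fun L => L (B.symm V)) heq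
  simpa [← hB] using this

theorem contDiffAt_conformalFactor {E' : Type*} [NormedAddCommGroup E'] [NormedSpace ℝ E']
    {a : E → E →L[ℝ] ℝ} {a' : E' → E' →L[ℝ] ℝ} {ψ : E → E'} {y : E}
    (ha : IsContactAt a y) (ha' : ContDiffAt ℝ ∞ a' (ψ y)) (hψ : ContDiffAt ℝ ∞ ψ y) :
    ContDiffAt ℝ ∞ (conformalFactor a a' ψ) y :=
  (ha'.comp y hψ).clm_apply ((hψ.fderiv_right (by simp)).clm_apply
    (ha.contDiffAt_hamPair contDiffAt_const).fst)

/-- An affine function whose contact Hamiltonian vector field has a prescribed value at a point. -/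
theorem IsContactAt.exists_hamPair_eq {a : E → E →L[ℝ] ℝ} {q : E} (ha : IsContactAt a q) (e : E) :
    ∃ H : E → ℝ, ContDiff ℝ ∞ H ∧ (hamPair a H q).1 = e := by
  -- `H` is chosen with `H q = a e` and `dH = -ι_e da` at `q`, so that `e` solves the Hamiltonian
  -- equations with `ρ = 0`.
  let D : E →L[ℝ] ℝ := fderiv ℝ a q e - (fderiv ℝ a q).flip e
  have hD : ∀ v, D v = dOne a q e v := fun v => rfl
  refine ⟨fun y => a q e - D (y - q), ?_, ?_⟩
  · exact contDiff_const.sub (D.contDiff.comp (contDiff_id.sub contDiff_const))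
  · have hd : HasFDerivAt (fun y => a q e - D (y - q)) (-D) q := by
      have := (D.hasFDerivAt.comp q ((hasFDerivAt_id q).sub_const q)).const_sub (a q e)
      simpa using this
    refine congrArg Prod.fst (ha.eq_hamPair (Z := e) (ρ := 0) (by simp) fun v => ?_)
    rw [hd.fderiv, ← hD]
    simp

/-- Germs of contactomorphisms induce the same conformal factor along a hypersurface as the
induced `1`-forms. -/
theorem IsContactGerm.conformalFactor_eq {E' : Type} [NormedAddCommGroup E'] [NormedSpace ℝ E']
    [Nontrivial F] {a : E → E →L[ℝ] ℝ} {a' : E' → E' →L[ℝ] ℝ} {j : F → E} {j' : F → E'}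
    {ψ : E → E'} {f : F → ℝ} {x : F}
    (ha : ∀ᶠ y in 𝓝 (j x), IsContactAt a y) (ha' : ∀ᶠ y in 𝓝 (j' x), IsContactAt a' y)
    (hj : ∀ᶠ y in 𝓝 x, ContDiffAt ℝ ∞ j y)
    (hψ : ∀ᶠ y in 𝓝 x, IsContactGerm a a' j j' ψ y)
    (hz : NondegenerateZeros (fun y => (a (j y)).comp (fderiv ℝ j y)) x)
    (hf : ContinuousAt f x)
    (hfac : ∀ᶠ y in 𝓝 x, (a' (j' y)).comp (fderiv ℝ j' y) = f y • (a (j y)).comp (fderiv ℝ j y)) :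
    conformalFactor a a' ψ (j x) = f x := by
  have h0 : (∞ : WithTop ℕ∞) ≠ 0 := by simp
  have hψx := hψ.self_of_nhds
  have hjc := hj.self_of_nhds.continuousAt
  have hψj : ψ (j x) = j' x := hψx.comm.self_of_nhds
  have hψc : Tendsto (fun y => ψ (j y)) (𝓝 x) (𝓝 (j' x)) := by
    have := (hψx.smooth.self_of_nhds.continuousAt.comp hjc).tendsto
    simp only [Function.comp_apply, hψj] at this
    exact this
  have hgc : ContinuousAt (conformalFactor a a' ψ) (j x) :=
    (contDiffAt_conformalFactor ha.self_of_nhds (by rw [hψj]; exact ha'.self_of_nhds.contDiffAt)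
      hψx.smooth.self_of_nhds).continuousAt
  -- Pulling `ψ^*a' = g a` back by `j` gives `j'^*a' = (g ∘ j) · j^*a`, so `g ∘ j` and `f` are both
  -- factors between the same induced forms.
  refine hz.factor_unique (ContinuousAt.comp (g := conformalFactor a a' ψ) hgc hjc) hf ?_
  filter_upwards [hψ, hfac, hj, hjc.eventually ha, hψc.eventually ha'] with y h1 h2 h3 h4 h5
  have h6 := (h4.eq_conformalFactor_smul h5.ne_zero h1.invertible h1.contact.self_of_nhds).2
  rw [← h2]
  have h7 : fderiv ℝ j' y = (fderiv ℝ ψ (j y)).comp (fderiv ℝ j y) := by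
    rw [← ((h1.smooth.self_of_nhds.differentiableAt h0).hasFDerivAt.comp y
      (h3.differentiableAt h0).hasFDerivAt).fderiv]
    exact (Filter.EventuallyEq.fderiv_eq h1.comm).symm
  rw [h7, ← h1.comm.self_of_nhds, ← ContinuousLinearMap.comp_assoc, h6,
    ContinuousLinearMap.smul_comp]
  rfl

theorem IsContactGerm.eventually {E' : Type} [NormedAddCommGroup E'] [NormedSpace ℝ E']
    {a : E → E →L[ℝ] ℝ} {a' : E' → E' →L[ℝ] ℝ} {j : F → E} {j' : F → E'} {ψ : E → E'} {x : F}
    (h : IsContactGerm a a' j j' ψ x) (hj : ContinuousAt j x) :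
    ∀ᶠ y in 𝓝 x, IsContactGerm a a' j j' ψ y := by
  have := FiniteDimensional.complete ℝ E
  have hinv : ∀ᶠ y in 𝓝 (j x), (fderiv ℝ ψ y).IsInvertible := by
    obtain ⟨e, hxe, -, he, -⟩ := exists_openPartialHomeomorph h.smooth h.invertible
    filter_upwards [e.open_source.mem_nhds hxe] with y hy using (he y hy).2
  filter_upwards [hj.eventually h.smooth.eventually_nhds, h.comm.eventually_nhds,
    hj.eventually hinv, hj.eventually h.contact.eventually_nhds] with y h1 h2 h3 h4
    using ⟨h1, h2, h3, h4⟩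

/-- Local extension of Hamiltonians: a function on `F × ℝ` which is prescribed on `F × {0}` and,
near a compact part of it, to all orders. -/
theorem exists_hamiltonian_extension {A K : Set F} {u : F → ℝ} {h : F × ℝ → ℝ}
    (hA : IsCompact A) (hu : ∀ x ∈ K, ∀ᶠ y in 𝓝 x, ContDiffAt ℝ ∞ u y)
    (hh : ∀ x ∈ A, ∀ᶠ q in 𝓝 (x, (0 : ℝ)), ContDiffAt ℝ ∞ h q)
    (hhu : ∀ x ∈ A, ∀ᶠ y in 𝓝 x, h (y, 0) = u y) :
    ∃ H : F × ℝ → ℝ, (∀ x ∈ K, ∀ᶠ q in 𝓝 (x, (0 : ℝ)), ContDiffAt ℝ ∞ H q) ∧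
      (∀ y, H (y, 0) = u y) ∧ ∀ x ∈ A, H =ᶠ[𝓝 (x, 0)] h := by
  have hfst : ∀ x : F, Tendsto (Prod.fst : F × ℝ → F) (𝓝 (x, 0)) (𝓝 x) := fun x => continuousAt_fst
  let O : Set (F × ℝ) := {q | ∀ᶠ q' in 𝓝 q, ContDiffAt ℝ ∞ h q' ∧ h (q'.1, 0) = u q'.1}
  have hO : IsOpen O := isOpen_iff_mem_nhds.2 fun q hq => hq.eventually_nhds
  have hAO : A ×ˢ {(0 : ℝ)} ⊆ O := by
    rintro ⟨x, t⟩ ⟨hx, ht⟩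
    obtain rfl : t = 0 := ht
    exact (hh x hx).and ((hfst x).eventually (hhu x hx))
  obtain ⟨T, hT, hAT, hTO⟩ := exists_compact_between (hA.prod isCompact_singleton) hO hAO
  -- On `T` the function `h` is smooth and takes the value `u y` at `(y, 0)`, so interpolating with
  -- a cut-off that vanishes off `T` does not disturb the values on `F × {0}`.
  obtain ⟨χ, hχ1, hχ0, -⟩ := exists_contMDiffMap_one_nhds_of_subset_interior 𝓘(ℝ, F × ℝ)
    (hA.prod (isCompact_singleton (x := (0 : ℝ)))).isClosed hAT (n := ⊤)
  have hχ : ContDiff ℝ ∞ χ := contMDiff_iff_contDiff.1 χ.contMDiff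
  refine ⟨fun q => χ q * h q + (1 - χ q) * u q.1, fun x hx => ?_, fun y => ?_, fun x hx => ?_⟩
  · filter_upwards [(hfst x).eventually (hu x hx)] with q hq
    have hu' : ContDiffAt ℝ ∞ (fun q : F × ℝ => u q.1) q := hq.comp q contDiffAt_fst
    by_cases hqT : q ∈ T
    · have h1 := (hTO hqT).self_of_nhds.1
      exact (hχ.contDiffAt.mul h1).add ((contDiffAt_const.sub hχ.contDiffAt).mul hu')
    · have h1 : (fun q => χ q * h q + (1 - χ q) * u q.1) =ᶠ[𝓝 q] fun q => u q.1 := by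
        filter_upwards [hT.isClosed.isOpen_compl.mem_nhds hqT] with q' hq'
        rw [hχ0 q' hq']; ring
      exact hu'.congr_of_eventuallyEq h1
  · by_cases hyT : ((y, 0) : F × ℝ) ∈ T
    · have h1 := (hTO hyT).self_of_nhds.2
      simp only at h1 ⊢
      rw [h1]; ring
    · simp only [hχ0 _ hyT]; ring
  · have h1 : ∀ᶠ q in 𝓝 (x, (0 : ℝ)), χ q = 1 :=
      hχ1.filter_mono (nhds_le_nhdsSet (show (x, (0 : ℝ)) ∈ A ×ˢ {(0 : ℝ)} from ⟨hx, rfl⟩))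
    filter_upwards [h1] with q hq
    rw [hq]; ring

/-- Along a compact set `A`, the pushforward of a function under a local diffeomorphism germ
extending `j y ↦ (y, 0)` is well defined near `A × {0}`. -/
theorem exists_pushforward {A : Set F} {j : F → E} {ψ : E → F × ℝ} {g : E → ℝ}
    (hj : ∀ x ∈ A, ContinuousAt j x)
    (hψ : ∀ x ∈ A, ∀ᶠ y in 𝓝 (j x), ContDiffAt ℝ ∞ ψ y)
    (hinv : ∀ x ∈ A, (fderiv ℝ ψ (j x)).IsInvertible)
    (hcomm : ∀ x ∈ A, ∀ᶠ y in 𝓝 x, ψ (j y) = (y, 0))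
    (hg : ∀ x ∈ A, ∀ᶠ y in 𝓝 (j x), ContDiffAt ℝ ∞ g y) :
    ∃ h : F × ℝ → ℝ, (∀ x ∈ A, ∀ᶠ q in 𝓝 (x, (0 : ℝ)), ContDiffAt ℝ ∞ h q) ∧
      ∀ x ∈ A, ∀ᶠ y in 𝓝 (j x), h (ψ y) = g y := by
  have := FiniteDimensional.complete ℝ E
  have hex : ∀ x : A, ∃ e : OpenPartialHomeomorph E (F × ℝ), j x ∈ e.source ∧ (∀ y, e y = ψ y) ∧
      ∀ y ∈ e.target, ContDiffAt ℝ ∞ e.symm y := fun x => by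
    obtain ⟨e, h1, h2, -, h3⟩ := exists_openPartialHomeomorph (hψ x x.2) (hinv x x.2)
    exact ⟨e, h1, h2, h3⟩
  choose e hje heψ hes using hex
  let ι : A → F × ℝ := fun x => (x, 0)
  have hι : IsInducing ι := by
    have h1 : IsInducing fun y : F => (y, (0 : ℝ)) := (isEmbedding_prodMkLeft (0 : ℝ)).isInducing
    exact h1.comp IsInducing.subtypeVal
  have hψj : ∀ x : A, ψ (j x) = ι x := fun x => (hcomm x x.2).self_of_nhds
  have het : ∀ x : A, ι x ∈ (e x).target := fun x => by
    have := (e x).map_source (hje x)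
    rwa [heψ, hψj] at this
  have hsymm : ∀ x : A, (e x).symm (ι x) = j x := fun x => by
    have := (e x).left_inv (hje x)
    rwa [heψ, hψj] at this
  have hst : ∀ x : A, Tendsto (e x).symm (𝓝 (ι x)) (𝓝 (j x)) := fun x => by
    have := ((e x).continuousAt_symm (het x)).tendsto
    rwa [hsymm] at this
  -- Local inverses of `ψ` at neighbouring points of `A` agree near `A × {0}`, so the germs `g ∘
  -- ψ⁻¹` are coherent. Injectivity of `ψ` near all of `j(A)` is not required.
  obtain ⟨h, hh⟩ := exists_eventuallyEq_of_coherent hι (fun x q => g ((e x).symm q)) (by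
    intro x
    have h1 : ∀ᶠ w : A in 𝓝 x, j w ∈ (e x).source :=
      ((hj x x.2).comp continuousAt_subtype_val).eventually ((e x).open_source.mem_nhds (hje x))
    filter_upwards [h1] with w hw
    filter_upwards [(hst w).eventually ((e x).open_source.mem_nhds hw),
      (e w).open_target.mem_nhds (het w)] with q h2 h3
    have h4 := (e x).left_inv h2
    rw [heψ, ← heψ w, (e w).right_inv h3] at h4
    simp only [h4])
  refine ⟨h, fun x hx => ?_, fun x hx => ?_⟩
  · filter_upwards [(hh ⟨x, hx⟩).eventuallyEq_nhds, (hst ⟨x, hx⟩).eventually (hg x hx),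
      (e ⟨x, hx⟩).open_target.mem_nhds (het ⟨x, hx⟩)] with q h1 h2 h3
    exact ContDiffAt.congr_of_eventuallyEq (h2.comp q (hes _ q h3)) h1
  · have h1 : Tendsto ψ (𝓝 (j x)) (𝓝 (ι ⟨x, hx⟩)) := by
      have := (hψ x hx).self_of_nhds.continuousAt.tendsto
      rwa [hψj ⟨x, hx⟩] at this
    filter_upwards [h1.eventually (hh ⟨x, hx⟩), (e ⟨x, hx⟩).open_source.mem_nhds (hje ⟨x, hx⟩)]
      with y h2 h3
    rw [h2, ← heψ ⟨x, hx⟩, (e ⟨x, hx⟩).left_inv h3]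

/-- Local extension of contactomorphism germs along a hypersurface, relative to a compact set. -/
theorem exists_local_extension (hdim : Module.finrank ℝ E = Module.finrank ℝ F + 1)
    {a : E → E →L[ℝ] ℝ} {a' : F × ℝ → F × ℝ →L[ℝ] ℝ} {j : F → E} {p : F}
    (ha : ∀ᶠ y in 𝓝 (j p), IsContactAt a y) (ha' : ∀ᶠ q in 𝓝 (p, (0 : ℝ)), IsContactAt a' q)
    (hj : ∀ᶠ y in 𝓝 p, ContDiffAt ℝ ∞ j y) (hinj : Function.Injective (fderiv ℝ j p))
    (hker : ∀ᶠ y in 𝓝 p, ∀ v, a (j y) (fderiv ℝ j y v) = 0 ↔ a' (y, 0) (v, 0) = 0)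
    {V : Set F} (hV : V ∈ 𝓝 p) :
    ∃ K ∈ 𝓝 p, IsCompact K ∧ K ⊆ V ∧ ∀ A ⊆ K, IsCompact A → ∀ Ψ : E → F × ℝ,
      (∀ x ∈ A, IsContactGerm a a' j (fun y => (y, 0)) Ψ x) →
      ∃ ψ : F → E → F × ℝ, (∀ x ∈ K, IsContactGerm a a' j (fun y => (y, 0)) (ψ x) x) ∧
        (∀ x ∈ K, ∀ᶠ y in 𝓝[K] x, ψ y =ᶠ[𝓝 (j y)] ψ x) ∧ ∀ x ∈ A, ψ x =ᶠ[𝓝 (j x)] Ψ := by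
  have := FiniteDimensional.complete ℝ E
  have := FiniteDimensional.proper ℝ F
  have h0 : (∞ : WithTop ℕ∞) ≠ 0 := by simp
  let j' : F → F × ℝ := fun y => (y, 0)
  have hj's : ContDiff ℝ ∞ j' := contDiff_id.prodMk contDiff_const
  have hj'd : ∀ y v, fderiv ℝ j' y v = (v, 0) := fun y v => by
    rw [(hasFDerivAt_prodMk_left y (0 : ℝ)).fderiv]; rfl
  have hj'inj : ∀ y, Function.Injective (fderiv ℝ j' y) := fun y v w h => by
    rw [hj'd, hj'd] at h
    exact (Prod.mk.inj h).1
  have hdim' : Module.finrank ℝ (F × ℝ) = Module.finrank ℝ F + 1 := by simp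
  have hjc : ContinuousAt j p := hj.self_of_nhds.continuousAt
  have hj'c : ∀ y, Tendsto j' (𝓝 y) (𝓝 (y, 0)) := fun y => hj's.continuous.continuousAt
  -- the conformal factor
  let b : F → F →L[ℝ] ℝ := fun y => (a (j y)).comp (fderiv ℝ j y)
  let b' : F → F →L[ℝ] ℝ := fun y => (a' (j' y)).comp (fderiv ℝ j' y)
  have hb : ∀ᶠ y in 𝓝 p, ContDiffAt ℝ ∞ b y := by
    filter_upwards [hjc.eventually ha, hj] with y h1 h2
    exact (h1.contDiffAt.comp y h2).clm_comp (h2.fderiv_right (by simp))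
  have hb' : ∀ᶠ y in 𝓝 p, ContDiffAt ℝ ∞ b' y := by
    filter_upwards [(hj'c p).eventually ha'] with y h1
    exact (h1.contDiffAt.comp y hj's.contDiffAt).clm_comp
      (hj's.contDiffAt.fderiv_right (by simp))
  obtain ⟨f, hf⟩ := exists_smooth_factor hb hb'
    (ha.self_of_nhds.nondegenerateZeros_pullback hdim hj.self_of_nhds hinj)
    (ha'.self_of_nhds.nondegenerateZeros_pullback hdim' hj's.contDiffAt (hj'inj p))
    (by
      filter_upwards [hker] with y hy v
      change _ ↔ a' (j' y) (fderiv ℝ j' y v) = 0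
      rw [hj'd]
      exact hy v)
  -- the Hamiltonian on the source
  obtain ⟨e, he⟩ : ∃ e, e ∉ range (fderiv ℝ j p) := by
    by_contra! h
    have h1 : Function.Surjective (fderiv ℝ j p).toLinearMap := h
    have := LinearMap.finrank_le_finrank_of_injective
      (f := ((fderiv ℝ j p).toLinearMap.exists_rightInverse_of_surjective
        (LinearMap.range_eq_top.2 h1)).choose) (by
      have h2 := ((fderiv ℝ j p).toLinearMap.exists_rightInverse_of_surjective
        (LinearMap.range_eq_top.2 h1)).choose_spec
      exact Function.LeftInverse.injective (g := fderiv ℝ j p) fun x => congrArg (fun L => L x) h2)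
    omega
  obtain ⟨H, hH, hHe⟩ := ha.self_of_nhds.exists_hamPair_eq e
  let X : E → E := fun y => (hamPair a H y).1
  have hX : ∀ᶠ y in 𝓝 (j p), ContDiffAt ℝ ∞ X y := by
    filter_upwards [ha] with y h1 using (h1.contDiffAt_hamPair hH.contDiffAt).fst
  -- Immersivity and transversality together amount to invertibility of `(v, s) ↦ Dj v + s X`, an
  -- open condition.
  have htr : ∀ᶠ y in 𝓝 p, Function.Injective (fderiv ℝ j y) ∧ X (j y) ∉ range (fderiv ℝ j y) := by
    let M : F → F × ℝ →L[ℝ] E := fun y =>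
      (fderiv ℝ j y).comp (.fst ℝ F ℝ) + (ContinuousLinearMap.snd ℝ F ℝ).smulRight (X (j y))
    have hMa : ∀ y w, M y w = fderiv ℝ j y w.1 + w.2 • X (j y) := fun y w => rfl
    have hMc : ContinuousAt M p := by
      have h1 : ContinuousAt (fderiv ℝ j) p :=
        (hj.self_of_nhds.fderiv_right (m := 0) (by simp)).continuousAt
      have h2 : ContinuousAt (fun y => X (j y)) p :=
        ContinuousAt.comp (g := X) hX.self_of_nhds.continuousAt hjc
      have h3 : Continuous fun e : E => (ContinuousLinearMap.snd ℝ F ℝ).smulRight e :=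
        (contDiff_const.smulRight contDiff_id).continuous (𝕜 := ℝ) (n := 0)
      exact (h1.clm_comp continuousAt_const).add
        (ContinuousAt.comp (g := fun e : E => (ContinuousLinearMap.snd ℝ F ℝ).smulRight e)
          h3.continuousAt h2)
    have hMp : (M p).IsInvertible := by
      refine isInvertible_of_injective (by simp [hdim]) ?_
      have : ⇑(M p) = fun w : F × ℝ => fderiv ℝ j p w.1 + w.2 • e := by
        funext w
        rw [hMa, ← hHe]
      rw [this]
      exact injective_add_smul hinj he
    obtain ⟨B, hB⟩ := hMp
    have h4 := ContinuousLinearEquiv.nhds B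
    rw [hB] at h4
    filter_upwards [hMc h4] with y hy
    obtain ⟨C, hC⟩ := hy
    have hMi : Function.Injective (M y) := by
      rw [← hC]; exact C.injective
    refine ⟨fun v w hvw => ?_, ?_⟩
    · have : M y (v, 0) = M y (w, 0) := by simp [hMa, hvw]
      exact (Prod.mk.inj (hMi this)).1
    · rintro ⟨v, hv⟩
      have : M y (-v, 1) = M y (0, 0) := by simp [hMa, hv]
      exact one_ne_zero (Prod.mk.inj (hMi this)).2
  -- the neighbourhood
  have hall := (hjc.eventually ha.eventually_nhds).and
    (((hj'c p).eventually ha'.eventually_nhds).and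
    (hj.eventually_nhds.and (hf.eventually_nhds.and htr.eventually_nhds)))
  obtain ⟨K, hKp, hKs, hK⟩ := local_compact_nhds (inter_mem hV hall)
  refine ⟨K, hKp, hK, fun x hx => (hKs hx).1, fun A hAK hA Ψ hΨ => ?_⟩
  have hW : ∀ x ∈ K, _ := fun x hx => (hKs hx).2
  -- If `F = 0`, the induced forms vanish and the factor `f` is not unique, so it need not be
  -- compatible with `Ψ`. But then `F` is a point and, if `A` is nonempty, `Ψ` is itself the
  -- required germ.
  by_cases hcase : Subsingleton F ∧ A.Nonempty
  · obtain ⟨hF, x₀, hx₀⟩ := hcase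
    refine ⟨fun _ => Ψ, fun x _ => ?_, fun x _ => Eventually.of_forall fun _ => EventuallyEq.rfl,
      fun _ _ => EventuallyEq.rfl⟩
    rw [Subsingleton.elim x x₀]
    exact hΨ x₀ hx₀
  have hcase' : ∀ x ∈ A, Nontrivial F := fun x hx =>
    (subsingleton_or_nontrivial F).resolve_left fun h => hcase ⟨h, ⟨x, hx⟩⟩
  -- the Hamiltonian on the target
  let g : E → ℝ := conformalFactor a a' Ψ
  have hΨj : ∀ x ∈ A, Tendsto Ψ (𝓝 (j x)) (𝓝 (x, 0)) := fun x hx => by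
    have h1 := (hΨ x hx).smooth.self_of_nhds.continuousAt.tendsto
    have h2 : Ψ (j x) = (x, 0) := (hΨ x hx).comm.self_of_nhds
    rwa [h2] at h1
  have hg : ∀ x ∈ A, ∀ᶠ y in 𝓝 (j x), ContDiffAt ℝ ∞ g y := fun x hx => by
    filter_upwards [(hW x (hAK hx)).1, (hΨ x hx).smooth,
      (hΨj x hx).eventually (hW x (hAK hx)).2.1] with y h1 h2 h3
    exact contDiffAt_conformalFactor h1 h3.contDiffAt h2
  have hgf : ∀ x ∈ A, ∀ᶠ y in 𝓝 x, g (j y) = f y := fun x hx => by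
    have := hcase' x hx
    obtain ⟨h1, h2, h3, h4, h5⟩ := hW x (hAK hx)
    have hjx : ContinuousAt j x := h3.self_of_nhds.continuousAt
    filter_upwards [hjx.eventually h1.eventually_nhds, (hj'c x).eventually h2.eventually_nhds,
      h3.eventually_nhds, ((hΨ x hx).eventually hjx).eventually_nhds, h4.eventually_nhds,
      h5]
      with y k1 k2 k3 k4 k5 k6
    exact IsContactGerm.conformalFactor_eq k1 k2 k3 k4
      (k1.self_of_nhds.nondegenerateZeros_pullback hdim k3.self_of_nhds k6.1)
      k5.self_of_nhds.1.continuousAt (by filter_upwards [k5] with z hz using hz.2.2)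
  -- Near `A` the target Hamiltonian is prescribed by `H' ∘ Ψ = g H`, which makes `Ψ` map `X` to
  -- `X'`. On the hypersurface this agrees with the condition `H' = f · (H ∘ j)` imposed along all
  -- of `K`, because `g ∘ j = f`.
  obtain ⟨h, hhs, hhΨ⟩ := exists_pushforward (A := A) (j := j) (ψ := Ψ) (g := fun y => g y * H y)
    (fun x hx => (hW x (hAK hx)).2.2.1.self_of_nhds.continuousAt)
    (fun x hx => (hΨ x hx).smooth) (fun x hx => (hΨ x hx).invertible)
    (fun x hx => (hΨ x hx).comm) (fun x hx => by
      filter_upwards [hg x hx] with y hy using hy.mul hH.contDiffAt)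
  obtain ⟨H', hH's, hH'0, hH'h⟩ := exists_hamiltonian_extension (A := A) (K := K)
    (u := fun y => f y * H (j y)) (h := h) hA
    (fun x hx => by
      filter_upwards [(hW x hx).2.2.1, (hW x hx).2.2.2.1] with y h1 h2
      exact h2.1.mul (hH.contDiffAt.comp y h1)) hhs
    (fun x hx => by
      have hjx : ContinuousAt j x := (hW x (hAK hx)).2.2.1.self_of_nhds.continuousAt
      filter_upwards [hjx.eventually (hhΨ x hx), (hΨ x hx).comm, hgf x hx] with y h1 h2 h3
      rw [h2, h3] at h1
      exact h1)
  let X' : F × ℝ → F × ℝ := fun y => (hamPair a' H' y).1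
  have hX' : ∀ x ∈ K, ∀ᶠ q in 𝓝 (x, (0 : ℝ)), ContDiffAt ℝ ∞ X' q := fun x hx => by
    filter_upwards [(hW x hx).2.1, hH's x hx] with q h1 h2 using (h1.contDiffAt_hamPair h2).fst
  have hXK : ∀ x ∈ K, ∀ᶠ y in 𝓝 (j x), ContDiffAt ℝ ∞ X y := fun x hx => by
    filter_upwards [(hW x hx).1] with y h1 using (h1.contDiffAt_hamPair hH.contDiffAt).fst
  have hex : ∀ x, ∃ ψ : E → F × ℝ, x ∈ K → Intertwines X X' j j' ψ x ∧
      IsContactGerm a a' j j' ψ x := fun x => by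
    by_cases hx : x ∈ K
    · obtain ⟨h1, h2, h3, h4, h5⟩ := hW x hx
      obtain ⟨ψ, hψ⟩ := exists_isContactGerm hdim hdim' (j' := j') (H := H) (H' := H') (f := f) h1
        h2 h3 (Eventually.of_forall fun _ => hj's.contDiffAt) h5.self_of_nhds.1 (hj'inj x)
        (Eventually.of_forall fun _ => hH.contDiffAt) (hH's x hx)
        (h4.self_of_nhds.1.differentiableAt h0) (by filter_upwards [h4] with y hy using hy.2.1)
        (by filter_upwards [h4] with y hy using hy.2.2) (Eventually.of_forall hH'0) h5.self_of_nhds.2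
      exact ⟨ψ, fun _ => hψ⟩
    · exact ⟨fun _ => 0, fun h => absurd h hx⟩
  choose ψ hψ using hex
  -- With `X` and `X'` fixed, a germ mapping one to the other is unique. This gives both the
  -- coherence of the germs `ψ x` along `K` and their agreement with `Ψ` along `A`.
  have huniq : ∀ x ∈ K, ∀ χ χ' : E → F × ℝ, Intertwines X X' j j' χ x →
      Intertwines X X' j j' χ' x → χ =ᶠ[𝓝 (j x)] χ' := fun x hx χ χ' hχ hχ' =>
    hχ.germ_unique hdim hχ' (hXK x hx) (hX' x hx) (hW x hx).2.2.1
      (hW x hx).2.2.2.2.self_of_nhds.1 (hW x hx).2.2.2.2.self_of_nhds.2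
  refine ⟨ψ, fun x hx => (hψ x hx).2, fun x hx => ?_, fun x hx => ?_⟩
  · have h1 := (hψ x hx).1.eventually (hW x hx).2.2.1.self_of_nhds.continuousAt
    filter_upwards [h1.filter_mono nhdsWithin_le_nhds, self_mem_nhdsWithin] with y h2 hy
    exact huniq y hy _ _ (hψ y hy).1 h2
  · refine huniq x (hAK hx) _ _ (hψ x (hAK hx)).1 ⟨(hΨ x hx).smooth, (hΨ x hx).comm, ?_⟩
    have hinv : ∀ᶠ y in 𝓝 (j x), (fderiv ℝ Ψ y).IsInvertible := by
      obtain ⟨e, hxe, -, he, -⟩ := exists_openPartialHomeomorph (hΨ x hx).smooth (hΨ x hx).invertible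
      filter_upwards [e.open_source.mem_nhds hxe] with y hy using (he y hy).2
    have hfac : ∀ᶠ y in 𝓝 (j x), g y ≠ 0 ∧ (a' (Ψ y)).comp (fderiv ℝ Ψ y) = g y • a y := by
      filter_upwards [(hW x (hAK hx)).1, (hΨj x hx).eventually (hW x (hAK hx)).2.1, hinv,
        (hΨ x hx).contact] with y h1 h2 h3 h4
      exact h1.eq_conformalFactor_smul h2.ne_zero h3 h4
    filter_upwards [(hW x (hAK hx)).1, (hΨj x hx).eventually (hW x (hAK hx)).2.1, hinv,
      (hΨ x hx).smooth, hg x hx, hfac.eventually_nhds, (hΨj x hx).eventually (hH's x (hAK hx)),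
      (hhΨ x hx).eventually_nhds, ((hΨj x hx).eventually (hH'h x hx)).eventually_nhds]
      with y h1 h2 h3 h4 h5 h6 h7 h8 h9
    refine fderiv_hamPair_eq h1 h2 h4 ?_ (h5.differentiableAt h0) h6.self_of_nhds.1
      (hH.contDiffAt.differentiableAt h0) (h7.differentiableAt h0)
      (by filter_upwards [h6] with z hz using hz.2) ?_
    · obtain ⟨B, hB⟩ := h3
      rw [← hB]
      exact B.surjective
    · filter_upwards [h8, h9] with z hz1 hz2
      rw [hz2, hz1]

end LocalExtension

/-! ### Derivatives, charts and distribution germs on manifolds -/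

section TangentDeriv

variable {E : Type*} [NormedAddCommGroup E] [NormedSpace ℝ E]
  {H : Type*} [TopologicalSpace H] {I : ModelWithCorners ℝ E H}
  {M : Type*} [TopologicalSpace M] [ChartedSpace H M]
  {E' : Type*} [NormedAddCommGroup E'] [NormedSpace ℝ E']
  {H' : Type*} [TopologicalSpace H'] {I' : ModelWithCorners ℝ E' H'}
  {M' : Type*} [TopologicalSpace M'] [ChartedSpace H' M']
  {E'' : Type*} [NormedAddCommGroup E''] [NormedSpace ℝ E'']
  {H'' : Type*} [TopologicalSpace H''] {I'' : ModelWithCorners ℝ E'' H''}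
  {M'' : Type*} [TopologicalSpace M''] [ChartedSpace H'' M'']
  {T : Type*} [TopologicalSpace T]

/-- The manifold derivative of `f` at `x`, as a continuous linear map between the model spaces. -/
noncomputable def modelDeriv (I : ModelWithCorners ℝ E H) (I' : ModelWithCorners ℝ E' H')
    (f : M → M') (x : M) : E →L[ℝ] E' :=
  mfderiv I I' f x

theorem modelDeriv_comp {g : M' → M''} {f : M → M'} {x : M}
    (hg : ContMDiffAt I' I'' ∞ g (f x)) (hf : ContMDiffAt I I' ∞ f x) :
    modelDeriv I I'' (g ∘ f) x = (modelDeriv I' I'' g (f x)).comp (modelDeriv I I' f x) :=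
  mfderiv_comp x (hg.mdifferentiableAt (by simp)) (hf.mdifferentiableAt (by simp))

theorem modelDeriv_congr {f g : M → M'} {x : M} (h : f =ᶠ[𝓝 x] g) :
    modelDeriv I I' f x = modelDeriv I I' g x :=
  h.mfderiv_eq

theorem modelDeriv_of_eventuallyEq_id {f : M → M} {x : M} (h : f =ᶠ[𝓝 x] id) :
    modelDeriv I I f x = .id ℝ E :=
  h.mfderiv_eq.trans mfderiv_id

theorem modelDeriv_eq_fderiv (f : E → E') (x : E) :
    modelDeriv 𝓘(ℝ, E) 𝓘(ℝ, E') f x = fderiv ℝ f x :=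
  mfderiv_eq_fderiv

/-- The local homeomorphism `e` is a local diffeomorphism. -/
structure IsSmoothChart (I : ModelWithCorners ℝ E H) (I' : ModelWithCorners ℝ E' H')
    (e : OpenPartialHomeomorph M M') : Prop where
  contMDiffOn : ContMDiffOn I I' ∞ e e.source
  contMDiffOn_symm : ContMDiffOn I' I ∞ e.symm e.target

namespace IsSmoothChart

variable {e : OpenPartialHomeomorph M M'}

theorem symm (he : IsSmoothChart I I' e) : IsSmoothChart I' I e.symm :=
  ⟨he.contMDiffOn_symm, he.contMDiffOn⟩

theorem trans (he : IsSmoothChart I I' e) {e' : OpenPartialHomeomorph M' M''}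
    (he' : IsSmoothChart I' I'' e') : IsSmoothChart I I'' (e.trans e') :=
  ⟨he'.contMDiffOn.comp (he.contMDiffOn.mono inter_subset_left) inter_subset_right,
    he.contMDiffOn_symm.comp (he'.contMDiffOn_symm.mono inter_subset_left) inter_subset_right⟩

theorem contMDiffAt (he : IsSmoothChart I I' e) {x : M} (hx : x ∈ e.source) :
    ContMDiffAt I I' ∞ e x :=
  he.contMDiffOn.contMDiffAt (e.open_source.mem_nhds hx)

theorem contMDiffAt_symm (he : IsSmoothChart I I' e) {y : M'} (hy : y ∈ e.target) :
    ContMDiffAt I' I ∞ e.symm y :=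
  he.symm.contMDiffAt hy

theorem modelDeriv_symm_comp (he : IsSmoothChart I I' e) {x : M} (hx : x ∈ e.source) :
    (modelDeriv I' I e.symm (e x)).comp (modelDeriv I I' e x) = .id ℝ E := by
  rw [← modelDeriv_comp (he.contMDiffAt_symm (e.map_source hx)) (he.contMDiffAt hx)]
  exact modelDeriv_of_eventuallyEq_id (e.eventually_left_inverse hx)

theorem modelDeriv_symm_apply (he : IsSmoothChart I I' e) {x : M} (hx : x ∈ e.source) (v : E) :
    modelDeriv I' I e.symm (e x) (modelDeriv I I' e x v) = v :=
  congrArg (fun L : E →L[ℝ] E => L v) (he.modelDeriv_symm_comp hx)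

theorem modelDeriv_apply_symm (he : IsSmoothChart I I' e) {x : M} (hx : x ∈ e.source) (w : E') :
    modelDeriv I I' e x (modelDeriv I' I e.symm (e x) w) = w := by
  have := he.symm.modelDeriv_symm_apply (e.map_source hx) w
  simpa only [OpenPartialHomeomorph.symm_symm, e.left_inv hx] using this

theorem isInvertible_modelDeriv (he : IsSmoothChart I I' e) {x : M} (hx : x ∈ e.source) :
    (modelDeriv I I' e x).IsInvertible :=
  ⟨.equivOfInverse _ _ (he.modelDeriv_symm_apply hx) (he.modelDeriv_apply_symm hx), rfl⟩

end IsSmoothChart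

/-- Near `i z`, the map `Φ` is a local diffeomorphism which carries the distribution `ξ` to `η`,
and it carries the germ of `i` at `z` to the germ of `i'`. -/
structure IsDistributionGerm (I : ModelWithCorners ℝ E H) (I' : ModelWithCorners ℝ E' H')
    (ξ : M → Submodule ℝ E) (η : M' → Submodule ℝ E') (i : T → M) (i' : T → M') (Φ : M → M')
    (z : T) : Prop where
  smooth : ∀ᶠ y in 𝓝 (i z), ContMDiffAt I I' ∞ Φ y
  comm : ∀ᶠ w in 𝓝 z, Φ (i w) = i' w
  invertible : (modelDeriv I I' Φ (i z)).IsInvertible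
  mem_iff : ∀ᶠ y in 𝓝 (i z), ∀ v, modelDeriv I I' Φ y v ∈ η (Φ y) ↔ v ∈ ξ y

namespace IsDistributionGerm

variable {ξ : M → Submodule ℝ E} {η : M' → Submodule ℝ E'} {ζ : M'' → Submodule ℝ E''}
  {i : T → M} {i' : T → M'} {i'' : T → M''} {Φ : M → M'} {Ψ : M' → M''} {z : T}

theorem map_eq (h : IsDistributionGerm I I' ξ η i i' Φ z) : Φ (i z) = i' z :=
  h.comm.self_of_nhds

theorem continuousAt (h : IsDistributionGerm I I' ξ η i i' Φ z) : ContinuousAt Φ (i z) :=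
  h.smooth.self_of_nhds.continuousAt

theorem tendsto (h : IsDistributionGerm I I' ξ η i i' Φ z) : Tendsto Φ (𝓝 (i z)) (𝓝 (i' z)) :=
  h.map_eq ▸ h.continuousAt

theorem comp (hΨ : IsDistributionGerm I' I'' η ζ i' i'' Ψ z)
    (hΦ : IsDistributionGerm I I' ξ η i i' Φ z) :
    IsDistributionGerm I I'' ξ ζ i i'' (Ψ ∘ Φ) z where
  smooth := by
    filter_upwards [hΦ.smooth, hΦ.tendsto.eventually hΨ.smooth] with y h1 h2 using h2.comp y h1
  comm := by
    filter_upwards [hΦ.comm, hΨ.comm] with w h1 h2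
    rw [Function.comp_apply, h1, h2]
  invertible := by
    rw [modelDeriv_comp (by rw [hΦ.map_eq]; exact hΨ.smooth.self_of_nhds) hΦ.smooth.self_of_nhds]
    refine ContinuousLinearMap.IsInvertible.comp ?_ hΦ.invertible
    rw [hΦ.map_eq]
    exact hΨ.invertible
  mem_iff := by
    filter_upwards [hΦ.smooth, hΦ.tendsto.eventually hΨ.smooth, hΦ.mem_iff,
      hΦ.tendsto.eventually hΨ.mem_iff] with y h1 h2 h3 h4 v
    rw [modelDeriv_comp h2 h1, ← h3, ← h4]
    rfl

theorem comp_param {T' : Type*} [TopologicalSpace T'] {c : T' → T} {w : T'}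
    (h : IsDistributionGerm I I' ξ η i i' Φ (c w)) (hc : ContinuousAt c w) :
    IsDistributionGerm I I' ξ η (i ∘ c) (i' ∘ c) Φ w where
  smooth := h.smooth
  comm := hc.eventually h.comm
  invertible := h.invertible
  mem_iff := h.mem_iff

theorem congr_left {k : T → M} {k' : T → M'} (h : IsDistributionGerm I I' ξ η i i' Φ z)
    (hk : i =ᶠ[𝓝 z] k) (hk' : i' =ᶠ[𝓝 z] k') : IsDistributionGerm I I' ξ η k k' Φ z := by
  have hz : i z = k z := hk.self_of_nhds
  refine ⟨hz ▸ h.smooth, ?_, hz ▸ h.invertible, hz ▸ h.mem_iff⟩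
  filter_upwards [h.comm, hk, hk'] with w h1 h2 h3
  rw [← h2, ← h3, h1]

theorem congr {Φ' : M → M'} (hi : ContinuousAt i z) (h : IsDistributionGerm I I' ξ η i i' Φ z)
    (hΦ : Φ =ᶠ[𝓝 (i z)] Φ') : IsDistributionGerm I I' ξ η i i' Φ' z where
  smooth := by
    filter_upwards [h.smooth, hΦ.eventually_nhds] with y h1 h2
      using h1.congr_of_eventuallyEq (EventuallyEq.symm h2)
  comm := by
    filter_upwards [h.comm, hi.eventually hΦ] with w h1 h2
    rw [← h2, h1]
  invertible := modelDeriv_congr (I := I) (I' := I') hΦ ▸ h.invertible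
  mem_iff := by
    filter_upwards [h.mem_iff, hΦ.eventually_nhds] with y h1 h2 v
    rw [← modelDeriv_congr h2, ← h1, Eventually.self_of_nhds h2]

end IsDistributionGerm

/-- The `1`-form `α` read in the chart `e`. -/
noncomputable def chartForm (I : ModelWithCorners ℝ E H) (I' : ModelWithCorners ℝ E' H')
    (α : M → E →L[ℝ] ℝ) (e : OpenPartialHomeomorph M M') (y : M') : E' →L[ℝ] ℝ :=
  (α (e.symm y)).comp (modelDeriv I' I e.symm y)

section ChartForm

variable {e : OpenPartialHomeomorph M M'} {α : M → E →L[ℝ] ℝ} {ξ : M → Submodule ℝ E} {i : T → M}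
  {z : T}

theorem IsSmoothChart.isDistributionGerm_symm (he : IsSmoothChart I I' e) (hi : ContinuousAt i z)
    (hz : i z ∈ e.source) (hξ : ∀ᶠ x in 𝓝 (i z), ξ x = LinearMap.ker (α x).toLinearMap) :
    IsDistributionGerm I' I (fun y => LinearMap.ker (chartForm I I' α e y).toLinearMap) ξ
      (e ∘ i) i e.symm z where
  smooth := by
    filter_upwards [e.open_target.mem_nhds (e.map_source hz)] with y hy
      using he.contMDiffAt_symm hy
  comm := by
    filter_upwards [hi.eventually (e.open_source.mem_nhds hz)] with w hw using e.left_inv hw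
  invertible := he.symm.isInvertible_modelDeriv (e.map_source hz)
  mem_iff := by
    have h1 : Tendsto e.symm (𝓝 (e (i z))) (𝓝 (i z)) := e.tendsto_symm hz
    filter_upwards [h1.eventually hξ] with y hy v
    rw [hy]
    rfl

theorem IsSmoothChart.isDistributionGerm (he : IsSmoothChart I I' e)
    (hz : i z ∈ e.source) (hξ : ∀ᶠ x in 𝓝 (i z), ξ x = LinearMap.ker (α x).toLinearMap) :
    IsDistributionGerm I I' ξ (fun y => LinearMap.ker (chartForm I I' α e y).toLinearMap)
      i (e ∘ i) e z where
  smooth := by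
    filter_upwards [e.open_source.mem_nhds hz] with y hy using he.contMDiffAt hy
  comm := Eventually.of_forall fun _ => rfl
  invertible := he.isInvertible_modelDeriv hz
  mem_iff := by
    filter_upwards [hξ, e.open_source.mem_nhds hz] with y hy hye v
    rw [hy]
    change α (e.symm (e y)) (modelDeriv I' I e.symm (e y) (modelDeriv I I' e y v)) = 0 ↔ α y v = 0
    rw [he.modelDeriv_symm_apply hye, e.left_inv hye]

end ChartForm

/-- For maps between normed spaces, distribution germs for kernels of forms are contact germs. -/
theorem isDistributionGerm_ker_iff {E E' F : Type} [NormedAddCommGroup E] [NormedSpace ℝ E]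
    [NormedAddCommGroup E'] [NormedSpace ℝ E'] [NormedAddCommGroup F] [NormedSpace ℝ F]
    {a : E → E →L[ℝ] ℝ} {a' : E' → E' →L[ℝ] ℝ} {j : F → E} {j' : F → E'} {ψ : E → E'} {x : F} :
    IsDistributionGerm 𝓘(ℝ, E) 𝓘(ℝ, E') (fun y => LinearMap.ker (a y).toLinearMap)
      (fun y => LinearMap.ker (a' y).toLinearMap) j j' ψ x ↔ IsContactGerm a a' j j' ψ x := by
  constructor
  · rintro ⟨h1, h2, h3, h4⟩
    refine ⟨h1.mono fun y hy => hy.contDiffAt, h2, by rwa [modelDeriv_eq_fderiv] at h3,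
      h4.mono fun y hy v => ?_⟩
    have := hy v
    rwa [modelDeriv_eq_fderiv] at this
  · rintro ⟨h1, h2, h3, h4⟩
    refine ⟨h1.mono fun y hy => hy.contMDiffAt, h2, by rwa [modelDeriv_eq_fderiv],
      h4.mono fun y hy v => ?_⟩
    rw [modelDeriv_eq_fderiv]
    exact hy v

end TangentDeriv

/-! ### Contact forms on manifolds read in charts -/

section ManifoldForms

variable {X : Type*} [NormedAddCommGroup X] [NormedSpace ℝ X] [FiniteDimensional ℝ X] {m : ℕ}
  {M : Type*} [TopologicalSpace M] [ChartedSpace (EuclideanSpace ℝ (Fin m)) M]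
  [IsManifold (𝓡 m) ∞ M] {α : OneForm m M} {U : Set M} {e : OpenPartialHomeomorph M X}

/-- In finite dimension it suffices to evaluate on constant vectors `v`, where the chart form is the
pairing of two smooth objects along `e.symm`: the section `α` and the tangent field `D(e.symm) v`.
-/
theorem OneForm.SmoothOn.contDiffOn_chartForm (hα : α.SmoothOn U)
    (he : IsSmoothChart (𝓡 m) 𝓘(ℝ, X) e) :
    ContDiffOn ℝ ∞ (chartForm (𝓡 m) 𝓘(ℝ, X) α e) (e.target ∩ e.symm ⁻¹' U) := by
  rw [contDiffOn_clm_apply]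
  intro v
  rw [← contMDiffOn_iff_contDiffOn]
  have h1 : ContMDiffOn 𝓘(ℝ, X) ((𝓡 m).prod 𝓘(ℝ, EuclideanSpace ℝ (Fin m) →L[ℝ] ℝ)) ∞
      (fun y => (⟨e.symm y, α (e.symm y)⟩ : TotalSpace (EuclideanSpace ℝ (Fin m) →L[ℝ] ℝ)
        (fun x : M => TangentSpace (𝓡 m) x →L[ℝ] Bundle.Trivial M ℝ x)))
      (e.target ∩ e.symm ⁻¹' U) :=
    ContMDiffOn.comp hα (he.contMDiffOn_symm.mono inter_subset_left) fun y hy => hy.2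
  have h2 : ContMDiff 𝓘(ℝ, X) (𝓘(ℝ, X).prod 𝓘(ℝ, X)) ∞
      (fun y : X => (⟨y, v⟩ : TangentBundle 𝓘(ℝ, X) X)) := fun y => by
    rw [contMDiffAt_totalSpace]
    refine ⟨contMDiffAt_id, ?_⟩
    simp only [mfld_simps]
    exact contMDiffAt_const
  have h3 : ContMDiffOn 𝓘(ℝ, X) ((𝓡 m).prod 𝓘(ℝ, EuclideanSpace ℝ (Fin m))) ∞
      (fun y => (⟨e.symm y, mfderiv 𝓘(ℝ, X) (𝓡 m) e.symm y v⟩ : TangentBundle (𝓡 m) M))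
      (e.target ∩ e.symm ⁻¹' U) := by
    have h4 := he.contMDiffOn_symm.contMDiffOn_tangentMapWithin (m := ∞) (by simp)
      e.open_target.uniqueMDiffOn
    refine (h4.comp h2.contMDiffOn (s := e.target ∩ e.symm ⁻¹' U) fun y hy => hy.1).congr
      fun y hy => ?_
    simp only [Function.comp_apply, tangentMapWithin,
      mfderivWithin_of_isOpen e.open_target hy.1]
  have h5 := ContMDiffOn.clm_bundle_apply (F₂ := ℝ) (E₂ := Bundle.Trivial M ℝ) h1 h3
  intro y hy
  have h6 := (contMDiffWithinAt_totalSpace.1 (h5 y hy)).2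
  exact h6

theorem isSmoothChart_of_mem_maximalAtlas
    {e : OpenPartialHomeomorph M (EuclideanSpace ℝ (Fin m))}
    (he : e ∈ IsManifold.maximalAtlas (𝓡 m) ∞ M) :
    IsSmoothChart (𝓡 m) 𝓘(ℝ, EuclideanSpace ℝ (Fin m)) e :=
  ⟨contMDiffOn_of_mem_maximalAtlas he, contMDiffOn_symm_of_mem_maximalAtlas he⟩

theorem isSmoothChart_chartAt (x : M) :
    IsSmoothChart (𝓡 m) 𝓘(ℝ, EuclideanSpace ℝ (Fin m))
      (chartAt (EuclideanSpace ℝ (Fin m)) x) :=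
  isSmoothChart_of_mem_maximalAtlas (IsManifold.chart_mem_maximalAtlas x)

theorem extDeriv_ofSubsingleton_apply {b : X → X →L[ℝ] ℝ} {x : X} (hb : DifferentiableAt ℝ b x)
    (u v : X) :
    extDeriv (fun y => ContinuousAlternatingMap.ofSubsingleton ℝ X ℝ (0 : Fin 1) (b y)) x ![u, v]
      = dOne b x u v := by
  let L := ContinuousAlternatingMap.ofSubsingletonLIE (𝕜 := ℝ) (E := X) (F := ℝ) (0 : Fin 1)
  have h1 : DifferentiableAt ℝ
      (fun y => ContinuousAlternatingMap.ofSubsingleton ℝ X ℝ (0 : Fin 1) (b y)) x :=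
    (L.toContinuousLinearEquiv.differentiableAt (x := b x)).comp x hb
  have h2 : ∀ w w', fderiv ℝ (fun y => b y w) x w' = fderiv ℝ b x w' w := fun w w' => by
    rw [fderiv_clm_apply hb (differentiableAt_const w)]
    simp
  rw [extDeriv_apply h1]
  simp [dOne, Fin.sum_univ_two, Fin.removeNth, h2, sub_eq_add_neg]

/-- Together with `dOne_pullback` this makes nondegeneracy independent of the chart, whereas
`OneForm.d` uses the preferred chart of each individual point. -/
theorem chartForm_eventuallyEq {X' : Type*} [NormedAddCommGroup X'] [NormedSpace ℝ X']
    {e' : OpenPartialHomeomorph M X'} (he : IsSmoothChart (𝓡 m) 𝓘(ℝ, X) e)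
    (he' : IsSmoothChart (𝓡 m) 𝓘(ℝ, X') e') {y : X} (hy : y ∈ e.target)
    (hy' : e.symm y ∈ e'.source) :
    chartForm (𝓡 m) 𝓘(ℝ, X) α e =ᶠ[𝓝 y] fun z =>
      (chartForm (𝓡 m) 𝓘(ℝ, X') α e' ((e' ∘ e.symm) z)).comp (fderiv ℝ (e' ∘ e.symm) z) := by
  have h1 : ∀ᶠ z in 𝓝 y, e.symm z ∈ e'.source :=
    (he.contMDiffAt_symm hy).continuousAt.eventually (e'.open_source.mem_nhds hy')
  filter_upwards [e.open_target.mem_nhds hy, h1] with z hz hz'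
  rw [← modelDeriv_eq_fderiv, modelDeriv_comp (he'.contMDiffAt hz') (he.contMDiffAt_symm hz)]
  ext v
  change α (e.symm z) (modelDeriv 𝓘(ℝ, X) (𝓡 m) e.symm z v) =
    α (e'.symm (e' (e.symm z))) (modelDeriv 𝓘(ℝ, X') (𝓡 m) e'.symm (e' (e.symm z))
      (modelDeriv (𝓡 m) 𝓘(ℝ, X') e' (e.symm z) (modelDeriv 𝓘(ℝ, X) (𝓡 m) e.symm z v)))
  rw [he'.modelDeriv_symm_apply hz', e'.left_inv hz']

theorem OneForm.SmoothOn.eventually_contDiffAt_chartForm (hα : α.SmoothOn U) (hU : IsOpen U)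
    (he : IsSmoothChart (𝓡 m) 𝓘(ℝ, X) e) {y : X} (hy : y ∈ e.target) (hyU : e.symm y ∈ U) :
    ∀ᶠ z in 𝓝 y, ContDiffAt ℝ ∞ (chartForm (𝓡 m) 𝓘(ℝ, X) α e) z := by
  have hO : IsOpen (e.target ∩ e.symm ⁻¹' U) := e.symm.isOpen_inter_preimage hU
  filter_upwards [hO.mem_nhds ⟨hy, hyU⟩] with z hz
    using (hα.contDiffOn_chartForm he).contDiffAt (hO.mem_nhds hz)

theorem OneForm.SmoothOn.d_eq (hα : α.SmoothOn U) (hU : IsOpen U) {x : M} (hx : x ∈ U)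
    (u v : EuclideanSpace ℝ (Fin m)) :
    α.d x u v = dOne (chartForm (𝓡 m) 𝓘(ℝ, EuclideanSpace ℝ (Fin m)) α
        (chartAt (EuclideanSpace ℝ (Fin m)) x)) (chartAt (EuclideanSpace ℝ (Fin m)) x x)
      (modelDeriv (𝓡 m) 𝓘(ℝ, EuclideanSpace ℝ (Fin m)) (chartAt (EuclideanSpace ℝ (Fin m)) x) x u)
      (modelDeriv (𝓡 m) 𝓘(ℝ, EuclideanSpace ℝ (Fin m)) (chartAt (EuclideanSpace ℝ (Fin m)) x) x
        v) := by
  have hxc := mem_chart_source (EuclideanSpace ℝ (Fin m)) x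
  rw [← extDeriv_ofSubsingleton_apply]
  · rfl
  · refine (hα.eventually_contDiffAt_chartForm hU (isSmoothChart_chartAt x)
      (OpenPartialHomeomorph.map_source _ hxc) ?_).self_of_nhds.differentiableAt (by simp)
    rwa [OpenPartialHomeomorph.left_inv _ hxc]

/-- A contact form on a manifold, read in a chart, is a contact form. -/
theorem OneForm.IsContactOn.isContactAt_chartForm (hα : α.IsContactOn U) (hU : IsOpen U)
    (he : IsSmoothChart (𝓡 m) 𝓘(ℝ, X) e) {y : X} (hy : y ∈ e.target) (hyU : e.symm y ∈ U) :
    IsContactAt (chartForm (𝓡 m) 𝓘(ℝ, X) α e) y := by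
  set x : M := e.symm y with hx
  have hxe : x ∈ e.source := e.map_target hy
  have hexy : e x = y := e.right_inv hy
  have hinv : ∀ v, modelDeriv 𝓘(ℝ, X) (𝓡 m) e.symm y (modelDeriv (𝓡 m) 𝓘(ℝ, X) e x v) = v :=
    fun v => by
    have := he.modelDeriv_symm_apply hxe v
    rwa [hexy] at this
  have hinv' : ∀ w, modelDeriv (𝓡 m) 𝓘(ℝ, X) e x (modelDeriv 𝓘(ℝ, X) (𝓡 m) e.symm y w) = w :=
    fun w => by
    have := he.modelDeriv_apply_symm hxe w
    rwa [hexy] at this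
  let c := chartAt (EuclideanSpace ℝ (Fin m)) x
  let A : EuclideanSpace ℝ (Fin m) →L[ℝ] ℝ := α x
  have hA : ∀ w, chartForm (𝓡 m) 𝓘(ℝ, X) α e y w =
    A (modelDeriv 𝓘(ℝ, X) (𝓡 m) e.symm y w) := fun w => rfl
  have hA0 : A ≠ 0 := hα.ne_zero x hyU
  have hnd : ∀ u, A u = 0 → (∀ v, A v = 0 → dOne (chartForm (𝓡 m) (𝓡 m) α c) (c x)
      (modelDeriv (𝓡 m) (𝓡 m) c x u) (modelDeriv (𝓡 m) (𝓡 m) c x v) = 0) → u = 0 :=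
    fun u hu h => hα.nondegenerate x hyU u hu fun v hv =>
      (hα.smoothOn.d_eq hU hyU u v).trans (h v hv)
  refine ⟨hα.smoothOn.eventually_contDiffAt_chartForm hU he hy hyU, fun h => ?_,
    fun u hu h => ?_⟩
  · refine hA0 (ContinuousLinearMap.ext fun v => ?_)
    have := hA (modelDeriv (𝓡 m) 𝓘(ℝ, X) e x v)
    rw [hinv, h] at this
    exact this.symm
  · have hc : IsSmoothChart (𝓡 m) 𝓘(ℝ, EuclideanSpace ℝ (Fin m)) c := isSmoothChart_chartAt x
    have hxc : x ∈ c.source := mem_chart_source _ x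
    have hg : ContDiffAt ℝ ∞ (c ∘ e.symm) y :=
      ((hc.contMDiffAt hxc).comp y (he.contMDiffAt_symm hy)).contDiffAt
    have hcd : ContDiffAt ℝ ∞ (chartForm (𝓡 m) (𝓡 m) α c) ((c ∘ e.symm) y) :=
      (hα.smoothOn.eventually_contDiffAt_chartForm hU hc (c.map_source hxc)
        (by rwa [c.left_inv hxc])).self_of_nhds
    have hD : ∀ w, fderiv ℝ (c ∘ e.symm) y w =
        modelDeriv (𝓡 m) (𝓡 m) c x (modelDeriv 𝓘(ℝ, X) (𝓡 m) e.symm y w) := fun w => by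
      have h1 : modelDeriv 𝓘(ℝ, X) (𝓡 m) (c ∘ e.symm) y =
          (modelDeriv (𝓡 m) (𝓡 m) c x).comp (modelDeriv 𝓘(ℝ, X) (𝓡 m) e.symm y) :=
        modelDeriv_comp (hc.contMDiffAt hxc) (he.contMDiffAt_symm hy)
      rw [← modelDeriv_eq_fderiv, h1]
      rfl
    have h0 := hnd (modelDeriv 𝓘(ℝ, X) (𝓡 m) e.symm y u) hu fun v hv => by
      have h1 := h (modelDeriv (𝓡 m) 𝓘(ℝ, X) e x v) (by rwa [hA, hinv])
      rw [dOne_congr (chartForm_eventuallyEq he hc hy hxc),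
        dOne_pullback (f := c ∘ e.symm) (hcd.differentiableAt (by simp)) hg, hD, hD, hinv] at h1
      exact h1
    rw [← hinv' u, h0, map_zero]

end ManifoldForms

/-! ### Local extension of contact germs on manifolds -/

section ManifoldExtension

variable {k : ℕ}
  {M₀ : Type*} [TopologicalSpace M₀] [ChartedSpace (EuclideanSpace ℝ (Fin (k + 1))) M₀]
  [IsManifold (𝓡 (k + 1)) ∞ M₀]
  {M₁ : Type*} [TopologicalSpace M₁] [ChartedSpace (EuclideanSpace ℝ (Fin (k + 1))) M₁]
  [IsManifold (𝓡 (k + 1)) ∞ M₁]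
  {S : Type*} [TopologicalSpace S] [ChartedSpace (EuclideanSpace ℝ (Fin k)) S]
  [IsManifold (𝓡 k) ∞ S]

/-- Around a point of an immersed hypersurface there are charts in which the immersion is the
inclusion of a coordinate hyperplane. -/
theorem exists_isSmoothChart_of_isImmersionAt {i : S → M₁} {p : S}
    (hi : Manifold.IsImmersionAt (𝓡 k) (𝓡 (k + 1)) ∞ i p) :
    ∃ (c : OpenPartialHomeomorph S (EuclideanSpace ℝ (Fin k)))
      (e : OpenPartialHomeomorph M₁ (EuclideanSpace ℝ (Fin k) × ℝ)),
      IsSmoothChart (𝓡 k) (𝓡 k) c ∧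
      IsSmoothChart (𝓡 (k + 1)) 𝓘(ℝ, EuclideanSpace ℝ (Fin k) × ℝ) e ∧ p ∈ c.source ∧
      (∀ x ∈ c.source, i x ∈ e.source) ∧ ∀ y ∈ c.target, e (i (c.symm y)) = (y, 0) := by
  obtain ⟨F', _, _, h⟩ := hi
  have hfin : FiniteDimensional ℝ (EuclideanSpace ℝ (Fin k) × F') :=
    h.equiv.symm.toLinearEquiv.finiteDimensional
  have hF' : FiniteDimensional ℝ F' :=
    FiniteDimensional.of_surjective (LinearMap.snd ℝ (EuclideanSpace ℝ (Fin k)) F')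
      LinearMap.snd_surjective
  -- The complement in the immersion normal form is a line by a dimension count, and may be replaced
  -- by `ℝ`.
  have hrank : Module.finrank ℝ F' = 1 := by
    have h1 := h.equiv.toLinearEquiv.finrank_eq
    rw [Module.finrank_prod, finrank_euclideanSpace_fin, finrank_euclideanSpace_fin] at h1
    omega
  let l : F' ≃L[ℝ] ℝ := ContinuousLinearEquiv.ofFinrankEq (by simp [hrank])
  let L : EuclideanSpace ℝ (Fin (k + 1)) ≃L[ℝ] EuclideanSpace ℝ (Fin k) × ℝ :=
    h.equiv.symm.trans ((ContinuousLinearEquiv.refl ℝ _).prodCongr l)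
  have hL : IsSmoothChart (𝓡 (k + 1)) 𝓘(ℝ, EuclideanSpace ℝ (Fin k) × ℝ)
      L.toHomeomorph.toOpenPartialHomeomorph :=
    ⟨L.contDiff.contMDiff.contMDiffOn, L.symm.contDiff.contMDiff.contMDiffOn⟩
  let cod : OpenPartialHomeomorph M₁ (EuclideanSpace ℝ (Fin (k + 1))) := h.codChart
  have hcod : IsSmoothChart (𝓡 (k + 1)) (𝓡 (k + 1)) cod :=
    isSmoothChart_of_mem_maximalAtlas h.codChart_mem_maximalAtlas
  refine ⟨h.domChart, cod.trans L.toHomeomorph.toOpenPartialHomeomorph,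
    isSmoothChart_of_mem_maximalAtlas h.domChart_mem_maximalAtlas, hcod.trans hL,
    h.mem_domChart_source, fun x hx => ?_, fun y hy => ?_⟩
  · simpa using h.source_subset_preimage_source hx
  · have h1 : (h.codChart.extend (𝓡 (k + 1)) ∘ i ∘ (h.domChart.extend (𝓡 k)).symm) y =
        h.equiv (y, 0) := h.writtenInCharts (by simpa using hy)
    have h2 : h.codChart (i (h.domChart.symm y)) = h.equiv (y, 0) := by simpa using h1
    change L (h.codChart (i (h.domChart.symm y))) = (y, 0)
    rw [h2]
    simp [L]

theorem modelDeriv_chart_comp {X : Type*} [NormedAddCommGroup X] [NormedSpace ℝ X] {i : S → M₁}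
    {c : OpenPartialHomeomorph S (EuclideanSpace ℝ (Fin k))} {e : OpenPartialHomeomorph M₁ X}
    (hc : IsSmoothChart (𝓡 k) (𝓡 k) c) (he : IsSmoothChart (𝓡 (k + 1)) 𝓘(ℝ, X) e)
    {y : EuclideanSpace ℝ (Fin k)} (hy : y ∈ c.target)
    (hi : ContMDiffAt (𝓡 k) (𝓡 (k + 1)) ∞ i (c.symm y)) (hye : i (c.symm y) ∈ e.source) :
    ContDiffAt ℝ ∞ (e ∘ i ∘ c.symm) y ∧ fderiv ℝ (e ∘ i ∘ c.symm) y =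
      (modelDeriv (𝓡 (k + 1)) 𝓘(ℝ, X) e (i (c.symm y))).comp
        ((modelDeriv (𝓡 k) (𝓡 (k + 1)) i (c.symm y)).comp
          (modelDeriv (𝓡 k) (𝓡 k) c.symm y)) := by
  have h1 : ContMDiffAt (𝓡 k) (𝓡 (k + 1)) ∞ (i ∘ c.symm) y := hi.comp y (hc.contMDiffAt_symm hy)
  have h2 : modelDeriv (𝓡 k) (𝓡 (k + 1)) (i ∘ c.symm) y =
      (modelDeriv (𝓡 k) (𝓡 (k + 1)) i (c.symm y)).comp (modelDeriv (𝓡 k) (𝓡 k) c.symm y) :=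
    modelDeriv_comp hi (hc.contMDiffAt_symm hy)
  have h3 : ContMDiffAt (𝓡 (k + 1)) 𝓘(ℝ, X) ∞ e ((i ∘ c.symm) y) := he.contMDiffAt hye
  refine ⟨(h3.comp y h1).contDiffAt, ?_⟩
  rw [← modelDeriv_eq_fderiv, modelDeriv_comp h3 h1, h2]
  rfl

theorem injective_modelDeriv_of_isImmersionAt {i : S → M₁} {p : S}
    (hi : Manifold.IsImmersionAt (𝓡 k) (𝓡 (k + 1)) ∞ i p) :
    Function.Injective (modelDeriv (𝓡 k) (𝓡 (k + 1)) i p) := by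
  obtain ⟨c, e, hc, he, hp, hce, h⟩ := exists_isSmoothChart_of_isImmersionAt hi
  have hcp : c p ∈ c.target := c.map_source hp
  obtain ⟨-, h1⟩ := modelDeriv_chart_comp (i := i) hc he hcp
    (by rw [c.left_inv hp]; exact hi.contMDiffAt) (by rw [c.left_inv hp]; exact hce p hp)
  have h2 : (e ∘ i ∘ c.symm) =ᶠ[𝓝 (c p)] fun y => (y, 0) := by
    filter_upwards [c.open_target.mem_nhds hcp] with y hy using h y hy
  rw [h2.fderiv_eq, (hasFDerivAt_prodMk_left (c p) (0 : ℝ)).fderiv, c.left_inv hp] at h1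
  intro v w hvw
  have h3 : ∀ v, (modelDeriv (𝓡 k) (𝓡 k) c p v, (0 : ℝ)) =
      modelDeriv (𝓡 (k + 1)) 𝓘(ℝ, EuclideanSpace ℝ (Fin k) × ℝ) e (i p)
        (modelDeriv (𝓡 k) (𝓡 (k + 1)) i p v) := fun v => by
    have := congrArg (fun L : EuclideanSpace ℝ (Fin k) →L[ℝ] EuclideanSpace ℝ (Fin k) × ℝ =>
      L (modelDeriv (𝓡 k) (𝓡 k) c p v)) h1
    simp only [ContinuousLinearMap.comp_apply, hc.modelDeriv_symm_apply hp] at this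
    exact this
  have h4 := (h3 v).trans ((congrArg _ hvw).trans (h3 w).symm)
  rw [← hc.modelDeriv_symm_apply hp v, (Prod.mk.inj h4).1, hc.modelDeriv_symm_apply hp]

/-- Transfers the hypothesis that the induced distributions on `S` agree to the kernels of the
induced forms in charts. -/
theorem chartForm_apply_fderiv {X : Type*} [NormedAddCommGroup X] [NormedSpace ℝ X]
    {α : M₁ → EuclideanSpace ℝ (Fin (k + 1)) →L[ℝ] ℝ} {i : S → M₁}
    {c : OpenPartialHomeomorph S (EuclideanSpace ℝ (Fin k))} {e : OpenPartialHomeomorph M₁ X}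
    (hc : IsSmoothChart (𝓡 k) (𝓡 k) c) (he : IsSmoothChart (𝓡 (k + 1)) 𝓘(ℝ, X) e)
    {y : EuclideanSpace ℝ (Fin k)} (hy : y ∈ c.target)
    (hi : ContMDiffAt (𝓡 k) (𝓡 (k + 1)) ∞ i (c.symm y)) (hye : i (c.symm y) ∈ e.source)
    (v : EuclideanSpace ℝ (Fin k)) :
    chartForm (𝓡 (k + 1)) 𝓘(ℝ, X) α e ((e ∘ i ∘ c.symm) y) (fderiv ℝ (e ∘ i ∘ c.symm) y v) =
      α (i (c.symm y)) (modelDeriv (𝓡 k) (𝓡 (k + 1)) i (c.symm y)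
        (modelDeriv (𝓡 k) (𝓡 k) c.symm y v)) := by
  rw [(modelDeriv_chart_comp hc he hy hi hye).2]
  change α (e.symm (e (i (c.symm y)))) (modelDeriv 𝓘(ℝ, X) (𝓡 (k + 1)) e.symm
    (e (i (c.symm y))) (modelDeriv (𝓡 (k + 1)) 𝓘(ℝ, X) e (i (c.symm y)) _)) = _
  rw [he.modelDeriv_symm_apply hye, e.left_inv hye]
  rfl

/-- Local extension of contactomorphism germs along a hypersurface, relative to a closed set. -/
theorem exists_local_germ_extension {ξ₀ : TangentDistribution (k + 1) M₀}
    (hξ₀ : IsContactStructure ξ₀) {ξ₁ : TangentDistribution (k + 1) M₁}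
    (hξ₁ : IsContactStructure ξ₁) {ι₀ : S → M₀}
    (hι₀ : ∀ q, Manifold.IsImmersionAt (𝓡 k) (𝓡 (k + 1)) ∞ ι₀ q) {ι₁ : S → M₁}
    (hι₁ : ∀ q, Manifold.IsImmersionAt (𝓡 k) (𝓡 (k + 1)) ∞ ι₁ q)
    (hD : ∀ q v, modelDeriv (𝓡 k) (𝓡 (k + 1)) ι₀ q v ∈ ξ₀ (ι₀ q) ↔
      modelDeriv (𝓡 k) (𝓡 (k + 1)) ι₁ q v ∈ ξ₁ (ι₁ q)) (p : S) :
    ∃ K ∈ 𝓝 p, IsCompact K ∧ ∀ A, IsClosed A → ∀ Φ : M₀ → M₁,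
      (∀ z ∈ A, IsDistributionGerm (𝓡 (k + 1)) (𝓡 (k + 1)) ξ₀ ξ₁ ι₀ ι₁ Φ z) →
      ∃ θ : S → M₀ → M₁,
        (∀ z ∈ K, IsDistributionGerm (𝓡 (k + 1)) (𝓡 (k + 1)) ξ₀ ξ₁ ι₀ ι₁ (θ z) z) ∧
        (∀ z ∈ K, ∀ᶠ w in 𝓝[K] z, θ w =ᶠ[𝓝 (ι₀ w)] θ z) ∧
        ∀ z ∈ A ∩ K, θ z =ᶠ[𝓝 (ι₀ z)] Φ := by
  obtain ⟨U₀, hU₀, hpU₀, α₀, hα₀, hker₀⟩ := hξ₀ (ι₀ p)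
  obtain ⟨U₁, hU₁, hpU₁, α₁, hα₁, hker₁⟩ := hξ₁ (ι₁ p)
  -- Only the target is straightened: there the Hamiltonian has to be extended off the hypersurface,
  -- which is easy for `F × {0}` in `F × ℝ`. The source chart is arbitrary.
  obtain ⟨c, e₁, hc, he₁, hp, hce₁, hj'⟩ := exists_isSmoothChart_of_isImmersionAt (hι₁ p)
  let e₀ : OpenPartialHomeomorph M₀ (EuclideanSpace ℝ (Fin (k + 1))) := chartAt _ (ι₀ p)
  have he₀ : IsSmoothChart (𝓡 (k + 1)) (𝓡 (k + 1)) e₀ := isSmoothChart_chartAt (ι₀ p)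
  have hpe₀ : ι₀ p ∈ e₀.source := mem_chart_source _ _
  have hs₀ : ∀ q, ContMDiffAt (𝓡 k) (𝓡 (k + 1)) ∞ ι₀ q := fun q => (hι₀ q).contMDiffAt
  have hs₁ : ∀ q, ContMDiffAt (𝓡 k) (𝓡 (k + 1)) ∞ ι₁ q := fun q => (hι₁ q).contMDiffAt
  have hc₀ : Continuous ι₀ := continuous_iff_continuousAt.2 fun q => (hs₀ q).continuousAt
  have hc₁ : Continuous ι₁ := continuous_iff_continuousAt.2 fun q => (hs₁ q).continuousAt
  let j : EuclideanSpace ℝ (Fin k) → EuclideanSpace ℝ (Fin (k + 1)) := e₀ ∘ ι₀ ∘ c.symm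
  let j' : EuclideanSpace ℝ (Fin k) → EuclideanSpace ℝ (Fin k) × ℝ := fun y => (y, 0)
  let a := chartForm (𝓡 (k + 1)) (𝓡 (k + 1)) α₀ e₀
  let a' := chartForm (𝓡 (k + 1)) 𝓘(ℝ, EuclideanSpace ℝ (Fin k) × ℝ) α₁ e₁
  let V : Set (EuclideanSpace ℝ (Fin k)) :=
    c.target ∩ c.symm ⁻¹' (ι₀ ⁻¹' (e₀.source ∩ U₀) ∩ ι₁ ⁻¹' U₁)
  have hVo : IsOpen V := c.symm.isOpen_inter_preimage
    (((e₀.open_source.inter hU₀).preimage hc₀).inter (hU₁.preimage hc₁))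
  have hcp : c p ∈ c.target := c.map_source hp
  have hcsp : c.symm (c p) = p := c.left_inv hp
  have hpV : V ∈ 𝓝 (c p) := hVo.mem_nhds ⟨hcp, by
    rw [mem_preimage, hcsp]
    exact ⟨⟨hpe₀, hpU₀⟩, hpU₁⟩⟩
  have hj'V : ∀ y ∈ c.target, (e₁ ∘ ι₁ ∘ c.symm) =ᶠ[𝓝 y] j' := fun y hy => by
    filter_upwards [c.open_target.mem_nhds hy] with z hz using hj' z hz
  have hjp : j (c p) = e₀ (ι₀ p) := by
    change e₀ (ι₀ (c.symm (c p))) = _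
    rw [hcsp]
  have hjp' : e₁ (ι₁ p) = (c p, 0) := by rw [← hj' _ hcp, hcsp]
  have hpe₁ : ι₁ p ∈ e₁.source := hce₁ p hp
  obtain ⟨L, hLp, hL, hLV, hext⟩ := exists_local_extension (a := a) (a' := a') (j := j) (p := c p)
    (by simp) (by
      have hO : IsOpen (e₀.target ∩ e₀.symm ⁻¹' U₀) := e₀.symm.isOpen_inter_preimage hU₀
      filter_upwards [hO.mem_nhds (by
        rw [hjp]
        exact ⟨e₀.map_source hpe₀, by rwa [mem_preimage, e₀.left_inv hpe₀]⟩)] with y hy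
      exact hα₀.isContactAt_chartForm hU₀ he₀ hy.1 hy.2)
    (by
      have hO : IsOpen (e₁.target ∩ e₁.symm ⁻¹' U₁) := e₁.symm.isOpen_inter_preimage hU₁
      filter_upwards [hO.mem_nhds (by
        rw [← hjp']
        exact ⟨e₁.map_source hpe₁, by rwa [mem_preimage, e₁.left_inv hpe₁]⟩)] with y hy
      exact hα₁.isContactAt_chartForm hU₁ he₁ hy.1 hy.2)
    (by
      filter_upwards [hpV] with y hy
      exact (modelDeriv_chart_comp hc he₀ hy.1 (hs₀ _) hy.2.1.1).1)
    (by
      have h1 := (modelDeriv_chart_comp (i := ι₀) hc he₀ hcp (hs₀ _) (by rwa [hcsp])).2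
      rw [hcsp] at h1
      intro v w hvw
      have h2 : ∀ v, fderiv ℝ j (c p) v = _ := fun v =>
        congrArg (fun L : EuclideanSpace ℝ (Fin k) →L[ℝ] EuclideanSpace ℝ (Fin (k + 1)) => L v) h1
      rw [h2, h2] at hvw
      exact (hc.symm.isInvertible_modelDeriv hcp).injective (injective_modelDeriv_of_isImmersionAt
        (hι₀ p) ((he₀.isInvertible_modelDeriv hpe₀).injective hvw)))
    (by
      filter_upwards [hpV] with y hy v
      have h1 : a' (y, 0) (v, 0) = α₁ (ι₁ (c.symm y)) (modelDeriv (𝓡 k) (𝓡 (k + 1)) ι₁ (c.symm y)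
          (modelDeriv (𝓡 k) (𝓡 k) c.symm y v)) := by
        have h2 := chartForm_apply_fderiv (α := α₁) hc he₁ hy.1 (hs₁ _)
          (hce₁ _ (c.map_target hy.1)) v
        rw [(hj'V y hy.1).fderiv_eq, (hj'V y hy.1).self_of_nhds,
          (hasFDerivAt_prodMk_left y (0 : ℝ)).fderiv] at h2
        exact h2
      have h3 : a (j y) (fderiv ℝ j y v) = α₀ (ι₀ (c.symm y)) (modelDeriv (𝓡 k) (𝓡 (k + 1)) ι₀
          (c.symm y) (modelDeriv (𝓡 k) (𝓡 k) c.symm y v)) :=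
        chartForm_apply_fderiv (α := α₀) hc he₀ hy.1 (hs₀ _) hy.2.1.1 v
      rw [h1, h3]
      have h4 := hD (c.symm y) (modelDeriv (𝓡 k) (𝓡 k) c.symm y v)
      rw [hker₀ _ hy.2.1.2, hker₁ _ hy.2.2] at h4
      exact h4) hpV
  have hcont : ContinuousOn c.symm L := c.continuousOn_symm.mono fun y hy => (hLV hy).1
  refine ⟨c.symm '' L, ?_, hL.image_of_continuousOn hcont, fun A hA Φ hΦ => ?_⟩
  · have h1 := c.symm.map_nhds_eq (x := c p) hcp
    rw [hcsp] at h1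
    rw [← h1]
    exact image_mem_map hLp
  have hK : ∀ z ∈ c.symm '' L, c z ∈ L ∧ z ∈ c.source := by
    rintro _ ⟨y, hy, rfl⟩
    exact ⟨by rwa [c.right_inv (hLV hy).1], c.map_target (hLV hy).1⟩
  have hKV : ∀ z ∈ c.symm '' L, (ι₀ z ∈ e₀.source ∧ ι₀ z ∈ U₀) ∧ ι₁ z ∈ U₁ := by
    rintro _ ⟨y, hy, rfl⟩
    exact (hLV hy).2
  have hξe₀ : ∀ z ∈ c.symm '' L, ∀ᶠ x in 𝓝 (ι₀ z), ξ₀ x = LinearMap.ker (α₀ x).toLinearMap :=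
    fun z hz => by filter_upwards [hU₀.mem_nhds (hKV z hz).1.2] with x hx using hker₀ x hx
  have hξe₁ : ∀ z ∈ c.symm '' L, ∀ᶠ x in 𝓝 (ι₁ z), ξ₁ x = LinearMap.ker (α₁ x).toLinearMap :=
    fun z hz => by filter_upwards [hU₁.mem_nhds (hKV z hz).2] with x hx using hker₁ x hx
  have hjc : ∀ z ∈ c.source, j (c z) = e₀ (ι₀ z) := fun z hz => by
    change e₀ (ι₀ (c.symm (c z))) = _
    rw [c.left_inv hz]
  have hAL : c '' (A ∩ c.symm '' L) ⊆ L := by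
    rintro _ ⟨z, hz, rfl⟩
    exact (hK z hz.2).1
  have hAc : IsCompact (c '' (A ∩ c.symm '' L)) :=
    ((hL.image_of_continuousOn hcont).inter_left hA).image_of_continuousOn
      (c.continuousOn.mono fun z hz => (hK z hz.2).2)
  -- In charts the given map becomes `e₁ ∘ Φ ∘ e₀.symm`, which is a contact germ along the compact
  -- image of `A ∩ K`.
  obtain ⟨ψ, hψ, hψK, hψA⟩ := hext _ hAL hAc (e₁ ∘ Φ ∘ e₀.symm) (by
    rintro _ ⟨z, hz, rfl⟩
    have hzc := (hK z hz.2).2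
    have hczc : c.symm (c z) = z := c.left_inv hzc
    have hcs : ContinuousAt c.symm (c z) := c.continuousAt_symm (c.map_source hzc)
    have hg₀ := he₀.isDistributionGerm_symm (i := ι₀ ∘ c.symm) (z := c z) (α := α₀) (ξ := ξ₀)
      (hc₀.continuousAt.comp hcs) (by rw [Function.comp_apply, hczc]; exact (hKV z hz.2).1.1)
      (by rw [Function.comp_apply, hczc]; exact hξe₀ z hz.2)
    have hg₁ := he₁.isDistributionGerm (i := ι₁ ∘ c.symm) (z := c z) (α := α₁) (ξ := ξ₁)
      (by rw [Function.comp_apply, hczc]; exact hce₁ z hzc)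
      (by rw [Function.comp_apply, hczc]; exact hξe₁ z hz.2)
    have hgΦ := IsDistributionGerm.comp_param (c := c.symm) (w := c z)
      (by rw [hczc]; exact hΦ z hz.1) hcs
    exact isDistributionGerm_ker_iff.1 ((hg₁.congr_left EventuallyEq.rfl
      (hj'V _ (c.map_source hzc))).comp (hgΦ.comp hg₀)))
  refine ⟨fun z => e₁.symm ∘ ψ (c z) ∘ e₀, fun z hz => ?_, fun z hz => ?_, fun z hz => ?_⟩
  · have hzc := (hK z hz).2
    have hg₀ := he₀.isDistributionGerm (i := ι₀) (α := α₀) (ξ := ξ₀) (hKV z hz).1.1 (hξe₀ z hz)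
    have hg₁ := he₁.isDistributionGerm_symm (i := ι₁) (α := α₁) (ξ := ξ₁) hc₁.continuousAt
      (hce₁ z hzc) (hξe₁ z hz)
    have hgψ := (isDistributionGerm_ker_iff.2 (hψ (c z) (hK z hz).1)).comp_param
      (c.continuousAt hzc)
    refine hg₁.comp ((hgψ.congr_left ?_ ?_).comp hg₀)
    · filter_upwards [c.open_source.mem_nhds hzc] with w hw using hjc w hw
    · filter_upwards [c.open_source.mem_nhds hzc] with w hw
      rw [Function.comp_apply, Function.comp_apply, ← c.left_inv hw, hj' _ (c.map_source hw),
        c.left_inv hw]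
  · have hzc := (hK z hz).2
    have h1 : Tendsto c (𝓝[c.symm '' L] z) (𝓝[L] (c z)) :=
      tendsto_nhdsWithin_iff.2 ⟨(c.continuousAt hzc).mono_left nhdsWithin_le_nhds, by
        filter_upwards [self_mem_nhdsWithin] with w hw using (hK w hw).1⟩
    filter_upwards [h1.eventually (hψK _ (hK z hz).1), self_mem_nhdsWithin] with w hw hwK
    rw [hjc w (hK w hwK).2] at hw
    have h2 : Tendsto e₀ (𝓝 (ι₀ w)) (𝓝 (e₀ (ι₀ w))) := e₀.continuousAt (hKV w hwK).1.1
    filter_upwards [h2.eventually hw] with y hy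
    change e₁.symm (ψ (c w) (e₀ y)) = e₁.symm (ψ (c z) (e₀ y))
    rw [hy]
  · have hw := hψA (c z) ⟨z, hz, rfl⟩
    rw [hjc z (hK z hz.2).2] at hw
    have h2 : Tendsto e₀ (𝓝 (ι₀ z)) (𝓝 (e₀ (ι₀ z))) := e₀.continuousAt (hKV z hz.2).1.1
    filter_upwards [h2.eventually hw, e₀.open_source.mem_nhds (hKV z hz.2).1.1,
      (hΦ z hz.1).tendsto.eventually (e₁.open_source.mem_nhds (hce₁ z (hK z hz.2).2))]
      with y h3 h4 h5
    change e₁.symm (ψ (c z) (e₀ y)) = Φ y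
    rw [h3]
    change e₁.symm (e₁ (Φ (e₀.symm (e₀ y)))) = Φ y
    rw [e₀.left_inv h4, e₁.left_inv h5]

end ManifoldExtension

/-! ### Induction over a countable cover -/

section GermInduction

variable {S M N : Type*} [TopologicalSpace S] [TopologicalSpace M] [MetrizableSpace M] [Nonempty N]
  {i : S → M} {P : (M → N) → S → Prop}

/-- The germs `Φ` on `A` and `θ` on `K \ A` form a coherent family: they agree on `A ∩ K`, and away
from this intersection closedness of `A` and `K` keeps the two definitions apart. -/
theorem exists_extension_union (hi : IsInducing i)
    (hP : ∀ Φ Φ' z, P Φ z → Φ =ᶠ[𝓝 (i z)] Φ' → P Φ' z) {A K : Set S} (hA : IsClosed A)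
    (hK : IsClosed K) {Φ : M → N} (hΦ : ∀ z ∈ A, P Φ z) {θ : S → M → N} (hθ : ∀ z ∈ K, P (θ z) z)
    (hθK : ∀ z ∈ K, ∀ᶠ w in 𝓝[K] z, θ w =ᶠ[𝓝 (i w)] θ z)
    (hθA : ∀ z ∈ A ∩ K, θ z =ᶠ[𝓝 (i z)] Φ) :
    ∃ Φ' : M → N, (∀ z ∈ A ∪ K, P Φ' z) ∧ ∀ z ∈ A, Φ' =ᶠ[𝓝 (i z)] Φ := by
  classical
  let φ : ↥(A ∪ K) → M → N := fun z => if (z : S) ∈ A then Φ else θ z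
  have hφA : ∀ z : ↥(A ∪ K), (z : S) ∈ A → φ z = Φ := fun z hz => if_pos hz
  have hφK : ∀ z : ↥(A ∪ K), (z : S) ∉ A → φ z = θ z := fun z hz => if_neg hz
  have hφ : ∀ z : ↥(A ∪ K), ∀ᶠ w : ↥(A ∪ K) in 𝓝 z, φ w =ᶠ[𝓝 (i w)] φ z :=
      fun z => by
    have hval : Tendsto ((↑) : ↥(A ∪ K) → S) (𝓝 z) (𝓝 (z : S)) := continuous_subtype_val.tendsto z
    by_cases hzK : (z : S) ∈ K
    · have h1 := hval.eventually (eventually_nhdsWithin_iff.1 (hθK z hzK))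
      by_cases hzA : (z : S) ∈ A
      · have h2 := (hθA z ⟨hzA, hzK⟩).eventually_nhds
        have h3 := hval.eventually (hi.continuous.continuousAt.eventually h2)
        filter_upwards [h1, h3] with w hw1 hw2
        by_cases hwA : (w : S) ∈ A
        · rw [hφA w hwA, hφA z hzA]
        · rw [hφK w hwA, hφA z hzA]
          exact (hw1 (w.2.resolve_left hwA)).trans hw2
      · filter_upwards [h1, hval.eventually (hA.isOpen_compl.mem_nhds hzA)] with w hw1 hwA
        rw [hφK w hwA, hφK z hzA]
        exact hw1 (w.2.resolve_left hwA)
    · have hzA : (z : S) ∈ A := z.2.resolve_right hzK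
      filter_upwards [hval.eventually (hK.isOpen_compl.mem_nhds hzK)] with w hwK
      rw [hφA w (w.2.resolve_right hwK), hφA z hzA]
  obtain ⟨Φ', hΦ'⟩ := exists_eventuallyEq_of_coherent (hi.comp .subtypeVal) φ hφ
  refine ⟨Φ', fun z hz => ?_, fun z hz => ?_⟩
  · refine hP _ _ z ?_ (hΦ' ⟨z, hz⟩).symm
    by_cases hzA : z ∈ A
    · rw [hφA ⟨z, hz⟩ hzA]
      exact hΦ z hzA
    · rw [hφK ⟨z, hz⟩ hzA]
      exact hθ z (hz.resolve_left hzA)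
  · have := hΦ' ⟨z, Or.inl hz⟩
    rwa [hφA ⟨z, Or.inl hz⟩ hz] at this

/-- If germs along closed subsets of `S` can be extended over a neighbourhood of every point of
`S`, relative to a closed set, then there is a germ along all of `S`. -/
theorem exists_forall_of_local_extension [SecondCountableTopology S] (hi : IsInducing i)
    (hP : ∀ Φ Φ' z, P Φ z → Φ =ᶠ[𝓝 (i z)] Φ' → P Φ' z)
    (hstep : ∀ p : S, ∃ K ∈ 𝓝 p, IsClosed K ∧ ∀ A, IsClosed A → ∀ Φ : M → N, (∀ z ∈ A, P Φ z) →
      ∃ θ : S → M → N, (∀ z ∈ K, P (θ z) z) ∧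
        (∀ z ∈ K, ∀ᶠ w in 𝓝[K] z, θ w =ᶠ[𝓝 (i w)] θ z) ∧
        ∀ z ∈ A ∩ K, θ z =ᶠ[𝓝 (i z)] Φ) :
    ∃ Φ : M → N, ∀ z, P Φ z := by
  obtain hS | hS := isEmpty_or_nonempty S
  · exact ⟨fun _ => Classical.arbitrary N, fun z => hS.elim z⟩
  choose K hKp hK hext using hstep
  obtain ⟨s, hsc, hs⟩ := TopologicalSpace.countable_cover_nhds fun p => interior_mem_nhds.2 (hKp p)
  have hsne : s.Nonempty := by
    by_contra h
    rw [not_nonempty_iff_eq_empty.1 h] at hs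
    simp only [mem_empty_iff_false, iUnion_of_empty, iUnion_empty] at hs
    exact empty_ne_univ hs
  obtain ⟨p, rfl⟩ := hsc.exists_eq_range hsne
  let A : ℕ → Set S := fun l => ⋃ q ∈ Finset.range l, K (p q)
  have hA : ∀ l, IsClosed (A l) := fun l => isClosed_biUnion_finset fun q _ => hK (p q)
  have hAs : ∀ l, A (l + 1) = A l ∪ K (p l) := fun l => by
    simp only [A, Finset.range_add_one, Finset.set_biUnion_insert]
    exact union_comm _ _
  have hnext : ∀ l (Φ : {Φ : M → N // ∀ z ∈ A l, P Φ z}),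
      ∃ Φ' : {Φ : M → N // ∀ z ∈ A (l + 1), P Φ z}, ∀ z ∈ A l, Φ'.1 =ᶠ[𝓝 (i z)] Φ.1 :=
    fun l Φ => by
      obtain ⟨θ, h1, h2, h3⟩ := hext (p l) (A l) (hA l) Φ.1 Φ.2
      obtain ⟨Φ', h4, h5⟩ := exists_extension_union hi hP (hA l) (hK (p l)) Φ.2 h1 h2 h3
      exact ⟨⟨Φ', by rwa [hAs]⟩, h5⟩
  choose next hnext using hnext
  -- `A 0` is empty, so the recursion may start from an arbitrary map.
  let Φ : ∀ l, {Φ : M → N // ∀ z ∈ A l, P Φ z} := fun l =>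
    Nat.rec ⟨fun _ => Classical.arbitrary N, fun z hz => by simp [A] at hz⟩ (fun l Φ => next l Φ) l
  have hAm : Monotone A := monotone_nat_of_le_succ fun l => by
    rw [hAs]
    exact subset_union_left
  have hΦ : ∀ l q, l ≤ q → ∀ z ∈ A l, (Φ q).1 =ᶠ[𝓝 (i z)] (Φ l).1 := fun l q hlq => by
    induction q, hlq using Nat.le_induction with
    | base => exact fun z _ => EventuallyEq.rfl
    | succ q hq ih => exact fun z hz => (hnext q (Φ q) z (hAm hq hz)).trans (ih z hz)
  have hcov : ∀ z, ∃ l, A l ∈ 𝓝 z := fun z => by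
    have hz : z ∈ ⋃ x ∈ range p, interior (K x) := hs ▸ mem_univ z
    obtain ⟨_, ⟨l, rfl⟩, hl⟩ := mem_iUnion₂.1 hz
    refine ⟨l + 1, mem_of_superset (mem_interior_iff_mem_nhds.1 hl) ?_⟩
    rw [hAs]
    exact subset_union_right
  choose l hl using hcov
  -- Later extensions keep the germs along earlier sets, so the sequence of germs is eventually
  -- constant at each point. Since `A (l z)` is a neighbourhood of `z`, the limiting germs are
  -- coherent.
  have hcoh : ∀ z w, w ∈ A (l z) → (Φ (l w)).1 =ᶠ[𝓝 (i w)] (Φ (l z)).1 := fun z w hw =>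
    (hΦ (l w) _ (le_max_left _ (l z)) w (mem_of_mem_nhds (hl w))).symm.trans
      (hΦ (l z) _ (le_max_right _ _) w hw)
  obtain ⟨Ψ, hΨ⟩ := exists_eventuallyEq_of_coherent hi (fun z => (Φ (l z)).1) fun z => by
    filter_upwards [hl z] with w hw using hcoh z w hw
  exact ⟨Ψ, fun z => hP _ _ z ((Φ (l z)).2 z (mem_of_mem_nhds (hl z))) (hΨ z).symm⟩

end GermInduction

/-! ### From germs to a diffeomorphism of neighbourhoods -/

section Globalization

variable {m : ℕ}
  {M : Type*} [TopologicalSpace M] [ChartedSpace (EuclideanSpace ℝ (Fin m)) M]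
  [IsManifold (𝓡 m) ∞ M]
  {N : Type*} [TopologicalSpace N] [ChartedSpace (EuclideanSpace ℝ (Fin m)) N]
  [IsManifold (𝓡 m) ∞ N]

/-- The inverse function theorem on manifolds. -/
theorem exists_isSmoothChart_eqOn {Φ : M → N} {x : M}
    (hs : ∀ᶠ y in 𝓝 x, ContMDiffAt (𝓡 m) (𝓡 m) ∞ Φ y)
    (hinv : (modelDeriv (𝓡 m) (𝓡 m) Φ x).IsInvertible) :
    ∃ g : OpenPartialHomeomorph M N, IsSmoothChart (𝓡 m) (𝓡 m) g ∧ x ∈ g.source ∧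
      EqOn g Φ g.source := by
  let e₀ : OpenPartialHomeomorph M (EuclideanSpace ℝ (Fin m)) := chartAt _ x
  let e₁ : OpenPartialHomeomorph N (EuclideanSpace ℝ (Fin m)) := chartAt _ (Φ x)
  have he₀ : IsSmoothChart (𝓡 m) (𝓡 m) e₀ := isSmoothChart_chartAt x
  have he₁ : IsSmoothChart (𝓡 m) (𝓡 m) e₁ := isSmoothChart_chartAt (Φ x)
  have hx₀ : x ∈ e₀.source := mem_chart_source _ x
  have hx₁ : Φ x ∈ e₁.source := mem_chart_source _ (Φ x)
  have hex : e₀.symm (e₀ x) = x := e₀.left_inv hx₀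
  have hΦc : ContinuousAt Φ x := hs.self_of_nhds.continuousAt
  have hΦe : ∀ᶠ y in 𝓝 x, Φ y ∈ e₁.source := hΦc.eventually (e₁.open_source.mem_nhds hx₁)
  let f : EuclideanSpace ℝ (Fin m) → EuclideanSpace ℝ (Fin m) := e₁ ∘ Φ ∘ e₀.symm
  have ht : Tendsto e₀.symm (𝓝 (e₀ x)) (𝓝 x) := e₀.tendsto_symm hx₀
  have hf : ∀ᶠ y in 𝓝 (e₀ x), ContDiffAt ℝ ∞ f y := by
    filter_upwards [e₀.open_target.mem_nhds (e₀.map_source hx₀), ht.eventually hs,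
      ht.eventually hΦe] with y h1 h2 h3
    have h4 : ContMDiffAt (𝓡 m) (𝓡 m) ∞ (Φ ∘ e₀.symm) y := h2.comp y (he₀.contMDiffAt_symm h1)
    exact (ContMDiffAt.comp (g := e₁) y (he₁.contMDiffAt h3) h4).contDiffAt
  have hfd : (fderiv ℝ f (e₀ x)).IsInvertible := by
    have h1 : ContMDiffAt (𝓡 m) (𝓡 m) ∞ Φ (e₀.symm (e₀ x)) := by
      rw [hex]
      exact hs.self_of_nhds
    have h2 := he₀.contMDiffAt_symm (e₀.map_source hx₀)
    have h3 : ContMDiffAt (𝓡 m) (𝓡 m) ∞ e₁ ((Φ ∘ e₀.symm) (e₀ x)) := by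
      rw [Function.comp_apply, hex]
      exact he₁.contMDiffAt hx₁
    have h4 : modelDeriv (𝓡 m) (𝓡 m) f (e₀ x) = (modelDeriv (𝓡 m) (𝓡 m) e₁ (Φ x)).comp
        ((modelDeriv (𝓡 m) (𝓡 m) Φ x).comp (modelDeriv (𝓡 m) (𝓡 m) e₀.symm (e₀ x))) := by
      refine (modelDeriv_comp h3 (h1.comp (e₀ x) h2)).trans ?_
      rw [modelDeriv_comp h1 h2, Function.comp_apply, hex]
    rw [← modelDeriv_eq_fderiv, h4]
    exact (he₁.isInvertible_modelDeriv hx₁).comp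
      (hinv.comp (he₀.symm.isInvertible_modelDeriv (e₀.map_source hx₀)))
  obtain ⟨G, hxG, hGf, hG, hG'⟩ := exists_openPartialHomeomorph hf hfd
  have hGs : IsSmoothChart (𝓡 m) (𝓡 m) G := by
    refine ⟨fun y hy => ?_, fun y hy => (hG' y hy).contMDiffAt.contMDiffWithinAt⟩
    have : ⇑G = f := funext hGf
    rw [this]
    exact (hG y hy).1.contMDiffAt.contMDiffWithinAt
  obtain ⟨O, hOΦ, hO, hxO⟩ := mem_nhds_iff.1 hΦe
  let g := (e₀.trans G).trans e₁.symm
  have hg : IsSmoothChart (𝓡 m) (𝓡 m) g := (he₀.trans hGs).trans he₁.symm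
  refine ⟨g.restrOpen O hO, ⟨hg.contMDiffOn.mono ?_, hg.contMDiffOn_symm.mono ?_⟩, ?_, ?_⟩
  · rw [g.restrOpen_source]
    exact inter_subset_left
  · exact inter_subset_left
  · rw [g.restrOpen_source]
    refine ⟨⟨⟨hx₀, hxG⟩, ?_⟩, hxO⟩
    change G (e₀ x) ∈ e₁.target
    rw [hGf]
    change e₁ (Φ (e₀.symm (e₀ x))) ∈ _
    rw [hex]
    exact e₁.map_source hx₁
  · intro y hy
    rw [g.restrOpen_source] at hy
    change e₁.symm (G (e₀ y)) = Φ y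
    rw [hGf]
    change e₁.symm (e₁ (Φ (e₀.symm (e₀ y)))) = Φ y
    rw [e₀.left_inv hy.1.1.1, e₁.left_inv (hOΦ hy.2)]

/-- An injective local diffeomorphism of an open subset is a diffeomorphism onto an open subset. -/
theorem exists_diffeomorph_opens {Φ : M → N} (U : Opens M) (hinj : InjOn Φ U)
    (hΦ : ∀ x ∈ U, ∃ g : OpenPartialHomeomorph M N, IsSmoothChart (𝓡 m) (𝓡 m) g ∧ x ∈ g.source ∧
      EqOn g Φ g.source) :
    ∃ (U' : Opens N) (Ψ : U ≃ₘ^∞⟮𝓡 m, 𝓡 m⟯ U'), ∀ x : U, (Ψ x : N) = Φ x := by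
  have hnhds : ∀ x ∈ U, Φ '' U ∈ 𝓝 (Φ x) := fun x hx => by
    obtain ⟨g, -, hxg, hgΦ⟩ := hΦ x hx
    rw [← hgΦ hxg, ← g.map_nhds_eq hxg,
      map_congr (hgΦ.eventuallyEq_of_mem (g.open_source.mem_nhds hxg))]
    exact image_mem_map (U.isOpen.mem_nhds hx)
  let U' : Opens N := ⟨Φ '' U, isOpen_iff_mem_nhds.2 (by
    rintro _ ⟨x, hx, rfl⟩
    exact hnhds x hx)⟩
  let f : U → U' := fun x => ⟨Φ x, mem_image_of_mem Φ x.2⟩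
  have hf : Function.Bijective f := by
    refine ⟨fun x y hxy => Subtype.ext (hinj x.2 y.2 (congrArg Subtype.val hxy)), ?_⟩
    rintro ⟨_, x, hx, rfl⟩
    exact ⟨⟨x, hx⟩, rfl⟩
  let Ψ : U ≃ U' := Equiv.ofBijective f hf
  refine ⟨U', ⟨Ψ, ?_, ?_⟩, fun x => rfl⟩
  · rw [← ContMDiff.subtypeVal_comp_iff]
    intro x
    obtain ⟨g, hg, hxg, hgΦ⟩ := hΦ x x.2
    exact contMDiffAt_subtype_iff.2 ((hg.contMDiffAt hxg).congr_of_eventuallyEq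
      (hgΦ.symm.eventuallyEq_of_mem (g.open_source.mem_nhds hxg)))
  · rw [← ContMDiff.subtypeVal_comp_iff]
    intro y
    obtain ⟨x, rfl⟩ := Ψ.surjective y
    obtain ⟨g, hg, hxg, hgΦ⟩ := hΦ x x.2
    have hgx : g x = Φ x := hgΦ hxg
    have h1 : ContMDiffAt (𝓡 m) (𝓡 m) ∞ g.symm (Φ x) :=
      hgx ▸ hg.contMDiffAt_symm (g.map_source hxg)
    refine (contMDiffAt_subtype_iff (U := U') (x := Ψ x).2 h1).congr_of_eventuallyEq ?_
    have h2 : ∀ᶠ w in 𝓝 (Φ x), w ∈ g.target ∧ g.symm w ∈ U :=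
      hgx ▸ Eventually.and (g.open_target.mem_nhds (g.map_source hxg))
        ((g.tendsto_symm hxg).eventually (U.isOpen.mem_nhds x.2))
    have h3 : Tendsto ((↑) : U' → N) (𝓝 (Ψ x)) (𝓝 (Φ x)) := continuous_subtype_val.tendsto (Ψ x)
    filter_upwards [h3.eventually h2] with w hw
    refine congrArg Subtype.val (Ψ.symm_apply_eq.2 (Subtype.ext ?_) : Ψ.symm w = ⟨g.symm w, hw.2⟩)
    change (w : N) = Φ (g.symm w)
    rw [← hgΦ (g.map_target hw.1), g.right_inv hw.1]

/-- The chain rule through the two inclusions turns the pointwise equivalence for `Φ` into one for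
`Ψ`; surjectivity of the derivative of `Ψ` then gives equality of the image with the whole target
distribution. -/
theorem isContactomorphism_restrict {ξ : TangentDistribution m M} {η : TangentDistribution m N}
    {Φ : M → N} {U : Opens M} {U' : Opens N} {Ψ : U ≃ₘ^∞⟮𝓡 m, 𝓡 m⟯ U'}
    (hΨ : ∀ x : U, (Ψ x : N) = Φ x) (hΦ : ∀ x ∈ U, ContMDiffAt (𝓡 m) (𝓡 m) ∞ Φ x)
    (h : ∀ x ∈ U, ∀ v, modelDeriv (𝓡 m) (𝓡 m) Φ x v ∈ η (Φ x) ↔ v ∈ ξ x) :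
    IsContactomorphism (ξ.restrict U) (η.restrict U') Ψ := by
  intro x
  have h1 : ((↑) : U' → N) ∘ Ψ = Φ ∘ ((↑) : U → M) := funext hΨ
  have h2 : (modelDeriv (𝓡 m) (𝓡 m) ((↑) : U' → N) (Ψ x)).comp (modelDeriv (𝓡 m) (𝓡 m) Ψ x) =
      (modelDeriv (𝓡 m) (𝓡 m) Φ x).comp (modelDeriv (𝓡 m) (𝓡 m) ((↑) : U → M) x) := by
    rw [← modelDeriv_comp contMDiff_subtype_val.contMDiffAt Ψ.contMDiff.contMDiffAt, h1,
      modelDeriv_comp (hΦ x x.2) contMDiff_subtype_val.contMDiffAt]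
  have h3 : ∀ v, modelDeriv (𝓡 m) (𝓡 m) ((↑) : U' → N) (Ψ x) (modelDeriv (𝓡 m) (𝓡 m) Ψ x v) ∈
      η (Ψ x : N) ↔ modelDeriv (𝓡 m) (𝓡 m) ((↑) : U → M) x v ∈ ξ x := fun v => by
    rw [hΨ x, ← h x x.2]
    have := congrArg (fun L : EuclideanSpace ℝ (Fin m) →L[ℝ] EuclideanSpace ℝ (Fin m) => L v) h2
    exact (congrArg (fun w => w ∈ η (Φ x)) this).to_iff
  refine Submodule.ext fun w => ⟨?_, fun hw => ?_⟩
  · rintro ⟨v, hv, rfl⟩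
    exact (h3 v).2 hv
  · obtain ⟨v, rfl⟩ := (Ψ.mfderivToContinuousLinearEquiv (by simp) x).surjective w
    exact ⟨v, (h3 v).1 hw, rfl⟩

end Globalization

end ContactGeometry

/-! ### Proof of the neighbourhood theorem -/

theorem mainTheorem6 (n : ℕ)
    {M₀ : Type*} [TopologicalSpace M₀] [T2Space M₀] [SecondCountableTopology M₀]
    [ChartedSpace (EuclideanSpace ℝ (Fin (2 * n + 1))) M₀] [IsManifold (𝓡 (2 * n + 1)) ∞ M₀]
    {M₁ : Type*} [TopologicalSpace M₁] [T2Space M₁] [SecondCountableTopology M₁]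
    [ChartedSpace (EuclideanSpace ℝ (Fin (2 * n + 1))) M₁] [IsManifold (𝓡 (2 * n + 1)) ∞ M₁]
    {S : Type*} [TopologicalSpace S] [T2Space S] [SecondCountableTopology S]
    [ChartedSpace (EuclideanSpace ℝ (Fin (2 * n))) S] [IsManifold (𝓡 (2 * n)) ∞ S]
    (ξ₀ : ContactGeometry.TangentDistribution (2 * n + 1) M₀)
    (hξ₀ : ContactGeometry.IsContactStructure ξ₀)
    (ξ₁ : ContactGeometry.TangentDistribution (2 * n + 1) M₁)
    (hξ₁ : ContactGeometry.IsContactStructure ξ₁)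
    (ι₀ : S → M₀) (hι₀ : Manifold.IsSmoothEmbedding (𝓡 (2 * n)) (𝓡 (2 * n + 1)) ∞ ι₀)
    (ι₁ : S → M₁) (hι₁ : Manifold.IsSmoothEmbedding (𝓡 (2 * n)) (𝓡 (2 * n + 1)) ∞ ι₁)
    (hD : ContactGeometry.TangentDistribution.pullback (m := 2 * n) ι₀ ξ₀ =
      ContactGeometry.TangentDistribution.pullback (m := 2 * n) ι₁ ξ₁) :
    ∃ (U₀ : TopologicalSpace.Opens M₀) (U₁ : TopologicalSpace.Opens M₁)
      (h₀ : ∀ p, ι₀ p ∈ U₀) (h₁ : ∀ p, ι₁ p ∈ U₁)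
      (Φ : U₀ ≃ₘ^∞⟮𝓡 (2 * n + 1), 𝓡 (2 * n + 1)⟯ U₁),
      ContactGeometry.IsContactomorphism (ξ₀.restrict U₀) (ξ₁.restrict U₁) Φ ∧
        ∀ p, Φ ⟨ι₀ p, h₀ p⟩ = ⟨ι₁ p, h₁ p⟩ := by
  have : SigmaCompactSpace M₀ :=
    have := ChartedSpace.locallyCompactSpace (EuclideanSpace ℝ (Fin (2 * n + 1))) M₀
    inferInstance
  have : SigmaCompactSpace M₁ :=
    have := ChartedSpace.locallyCompactSpace (EuclideanSpace ℝ (Fin (2 * n + 1))) M₁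
    inferInstance
  have : MetrizableSpace M₀ := Manifold.metrizableSpace (𝓡 (2 * n + 1)) M₀
  have : MetrizableSpace M₁ := Manifold.metrizableSpace (𝓡 (2 * n + 1)) M₁
  -- Germs are represented by maps defined on all of `M₀`, which calls for a default value in `M₁`.
  -- If `M₁` is empty, so is the hypersurface, and empty neighbourhoods serve.
  obtain hM₁ | hM₁ := isEmpty_or_nonempty M₁
  · have hS : IsEmpty S := Function.isEmpty ι₁
    have h₀ : IsEmpty (⊥ : Opens M₀) := ⟨fun x => x.2⟩
    have h₁ : IsEmpty (⊥ : Opens M₁) := ⟨fun x => x.2⟩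
    exact ⟨⊥, ⊥, fun p => hS.elim p, fun p => hS.elim p,
      ⟨Equiv.equivOfIsEmpty _ _, fun x => h₀.elim x, fun x => h₁.elim x⟩, fun x => h₀.elim x,
      fun p => hS.elim p⟩
  have hD' : ∀ q v, ContactGeometry.modelDeriv (𝓡 (2 * n)) (𝓡 (2 * n + 1)) ι₀ q v ∈ ξ₀ (ι₀ q) ↔
      ContactGeometry.modelDeriv (𝓡 (2 * n)) (𝓡 (2 * n + 1)) ι₁ q v ∈ ξ₁ (ι₁ q) := fun q v =>
    (congrArg (fun D : Submodule ℝ (TangentSpace (𝓡 (2 * n)) q) => v ∈ D) (congrFun hD q)).to_iff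
  have hc₀ : Continuous ι₀ := hι₀.isEmbedding.continuous
  obtain ⟨Φ, hΦ⟩ := ContactGeometry.exists_forall_of_local_extension (N := M₁)
    hι₀.isEmbedding.isInducing
    (P := fun Φ z => ContactGeometry.IsDistributionGerm (𝓡 (2 * n + 1)) (𝓡 (2 * n + 1)) ξ₀ ξ₁
      ι₀ ι₁ Φ z)
    (fun Φ Φ' z h hΦ => h.congr hc₀.continuousAt hΦ) fun p => by
      obtain ⟨K, hKp, hK, h⟩ := ContactGeometry.exists_local_germ_extension hξ₀ hξ₁
        hι₀.isImmersion.isImmersionAt hι₁.isImmersion.isImmersionAt hD' p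
      exact ⟨K, hKp, hK.isClosed, h⟩
  have hΦι : Φ ∘ ι₀ = ι₁ := funext fun p => (hΦ p).map_eq
  have hloc := fun z => ContactGeometry.exists_isSmoothChart_eqOn (hΦ z).smooth (hΦ z).invertible
  -- `Φ` is a local diffeomorphism along the image of `ι₀`, and `Φ ∘ ι₀ = ι₁` is an embedding; this
  -- is where the embedding property of `ι₁`, beyond immersivity, enters.
  obtain ⟨V, hV, hιV, hinj⟩ := ContactGeometry.exists_injOn_of_isInducing (Φ := Φ) hc₀
    (hΦι ▸ hι₁.isEmbedding.isInducing) (fun z => (hΦ z).continuousAt) fun z => by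
      obtain ⟨g, -, hz, hg⟩ := hloc z
      exact ⟨g.source, g.open_source.mem_nhds hz, g.injOn.congr hg⟩
  let W : Set M₀ := {x | (∃ g : OpenPartialHomeomorph M₀ M₁,
    ContactGeometry.IsSmoothChart (𝓡 (2 * n + 1)) (𝓡 (2 * n + 1)) g ∧ x ∈ g.source ∧
      Set.EqOn g Φ g.source) ∧ ContMDiffAt (𝓡 (2 * n + 1)) (𝓡 (2 * n + 1)) ∞ Φ x ∧
    ∀ v, ContactGeometry.modelDeriv (𝓡 (2 * n + 1)) (𝓡 (2 * n + 1)) Φ x v ∈ ξ₁ (Φ x) ↔ v ∈ ξ₀ x}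
  have hW : ∀ z, ι₀ z ∈ interior W := fun z => by
    obtain ⟨g, hg, hz, hgΦ⟩ := hloc z
    rw [mem_interior_iff_mem_nhds]
    filter_upwards [g.open_source.mem_nhds hz, (hΦ z).smooth, (hΦ z).mem_iff] with x h1 h2 h3
      using ⟨⟨g, hg, h1, hgΦ⟩, h2, h3⟩
  let U₀ : TopologicalSpace.Opens M₀ := ⟨V ∩ interior W, hV.inter isOpen_interior⟩
  have hU₀ : ∀ x ∈ U₀, x ∈ W := fun x hx => interior_subset hx.2
  obtain ⟨U₁, Ψ, hΨ⟩ := ContactGeometry.exists_diffeomorph_opens U₀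
    (hinj.mono Set.inter_subset_left) fun x hx => (hU₀ x hx).1
  have h₀ : ∀ p, ι₀ p ∈ U₀ := fun p => ⟨hιV p, hW p⟩
  have hΨι : ∀ p, (Ψ ⟨ι₀ p, h₀ p⟩ : M₁) = ι₁ p := fun p => (hΨ _).trans (hΦ p).map_eq
  exact ⟨U₀, U₁, h₀, fun p => hΨι p ▸ (Ψ ⟨ι₀ p, h₀ p⟩).2, Ψ,
    ContactGeometry.isContactomorphism_restrict hΨ (fun x hx => (hU₀ x hx).2.1)
      fun x hx => (hU₀ x hx).2.2, fun p => Subtype.ext (hΨι p)⟩
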